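/- Let $d\ge 1$ be an integer. Write $-i\nabla$ and $-\Delta$ for the usual operators on $L^2(\mathbb R^d)$. For a compact operator $A$ on $L^2(\mathbb{R}^d)$ let $\|A\|^*_{\mathcal L^{1,\infty}}:=\sup_{j\ge 0}(j+1)\sqrt{\lambda_j(A^*A)}$, where $(\lambda_j(A^*A))_{j\ge0}$ are the eigenvalues of $A^*A$ in decreasing order, repeated according to multiplicity; $\mathcal L^{1,\infty}$ is the set of compact operators for which this quantity is finite. Let $\mathbf h:=\frac{e^e}{d}(-\Delta+|x|^2)$ be the harmonic oscillator, so that $\mathbf h\ge e^e$. For $s\ge d/2$, $E\le 0$ and a real-valued function $v\in L^2(\mathbb{R}^d)$ let $$K_{E,>1}:=v(x)\,\big((-\Delta)^s-E\big)^{-1}\mathbf 1_{|-i\nabla|>1}\,v(x),$$ that is, $K_{E,>1}u=v\,\mathcal F^{-1}\big(\mathbf 1_{|\xi|>1}(|\xi|^{2s}-E)^{-1}\,\mathcal F(vu)(\xi)\big)$ for $u\in L^2(\mathbb R^d)$, where $\mathcal F$ is the Fourier transform. 1. (Critical case $s=d/2$.) For every $\varepsilon>0$ there is a constant $C_{d,\varepsilon}$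 such that, for all $E\le 0$ and all real-valued $v\in L^2(\mathbb R^d)$ in the domain of $(\ln\mathbf h)^{1/2}(\ln\ln\mathbf h)^{1/2+\varepsilon}$, the operator $K_{E,>1}$ is well defined and bounded on $L^2(\mathbb R^d)$, belongs to $\mathcal L^{1,\infty}$, and $$\|K_{E,>1}\|^*_{\mathcal L^{1,\infty}}\le C_{d,\varepsilon}\,\big\|(\ln\mathbf h)^{1/2}(\ln\ln\mathbf h)^{1/2+\varepsilon}\,v\big\|_{L^2}^2 .$$ 2. (Case $s>d/2$.) For every $s>d/2$ there is a constant $C_{d,s}$ such that, for all $E\le 0$ and all real-valued $v\in L^2(\mathbb R^d)$, the operator $K_{E,>1}$ is well defined and bounded on $L^2(\mathbb R^d)$, belongs to $\mathcal L^{1,\infty}$, and $$\|K_{E,>1}\|^*_{\mathcal L^{1,\infty}}\le C_{d,s}\,\|v\|_{L^2}^2 .$$ -/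

import Mathlib

open MeasureTheory TemperedDistribution
open scoped ENNReal NNReal SchwartzMap FourierTransform Laplacian

noncomputable section

/-- The Euclidean space `ℝ^d`. -/
abbrev RSpace (d : ℕ) : Type := EuclideanSpace ℝ (Fin d)

/-- The complex Hilbert space `L²(ℝ^d)`. -/
abbrev L2Space (d : ℕ) : Type := Lp (α := RSpace d) ℂ 2 volume

section WeakTraceIdeals

variable {H : Type*} [NormedAddCommGroup H] [InnerProductSpace ℂ H] [CompleteSpace H]

/-- The `j`-th eigenvalue `λ_j(T)`, `j ≥ 0`, of a compact self-adjoint non-negative operator `T`: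
the nonnegative eigenvalues are sorted in decreasing order and repeated according to multiplicity,
so that `λ_j(T)` is the largest `r ≥ 0` such that the eigenvectors with eigenvalue at least `r`
span a space of dimension at least `j + 1` (and `0` if there is no such `r`). -/
def decreasingEigenvalue (T : H →L[ℂ] H) (j : ℕ) : ℝ≥0∞ :=
  ⨆ (r : ℝ≥0) (_ : ((j + 1 : ℕ) : Cardinal) ≤ Module.rank ℂ
    (⨆ (t : ℝ) (_ : (r : ℝ) ≤ t),
      Module.End.eigenspace (T : H →ₗ[ℂ] H) (t : ℂ) : Submodule ℂ H)), (r : ℝ≥0∞)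

/-- The quasinorm of the weak trace ideal `𝓛^{p,∞}`:
`sup_{j ≥ 0} (j + 1)^{1/p} √(λ_j(A^* A))`, for a compact operator `A`. -/
def weakTraceQuasinorm (p : ℝ) (A : H →L[ℂ] H) : ℝ≥0∞ :=
  ⨆ j : ℕ, ((j : ℝ≥0∞) + 1) ^ (1 / p) *
    decreasingEigenvalue (ContinuousLinearMap.adjoint A ∘L A) j ^ (1 / 2 : ℝ)

/-- Membership in the weak trace ideal `𝓛^{p,∞}`: the operator is compact and its quasinorm is
finite. -/
def MemWeakTraceIdeal (p : ℝ) (A : H →L[ℂ] H) : Prop :=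
  IsCompactOperator A ∧ weakTraceQuasinorm p A < ∞

end WeakTraceIdeals

section HarmonicOscillator

/-- The harmonic oscillator `h = c_d (-Δ + |x|²)` with `c_d = e^e / d`, acting on tempered
distributions. Its self-adjoint realization on `L²(ℝ^d)` is the restriction to the domain
`{u ∈ L² : h u ∈ L²}`. -/
def harmonicOscillator (d : ℕ) : 𝓢'(RSpace d, ℂ) →L[ℂ] 𝓢'(RSpace d, ℂ) :=
  ((Real.exp (Real.exp 1) / d : ℝ) : ℂ) •
    (smulLeftCLM ℂ (fun x : RSpace d ↦ ((‖x‖ ^ 2 : ℝ) : ℂ)) -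
      LineDeriv.laplacianCLM ℂ (RSpace d) 𝓢'(RSpace d, ℂ))

/-- The eigenspace `{u ∈ L²(ℝ^d) : h u = t u}` of the harmonic oscillator
(it is `{0}` if `t` is not an eigenvalue). -/
def harmonicEigenspace (d : ℕ) (t : ℝ) : Submodule ℂ (L2Space d) :=
  ((harmonicOscillator d - (t : ℂ) • ContinuousLinearMap.id ℂ 𝓢'(RSpace d, ℂ)) ∘L
    Lp.toTemperedDistributionCLM ℂ (volume : Measure (RSpace d)) 2).ker

instance instCompleteSpaceHarmonicEigenspace (d : ℕ) (t : ℝ) :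
    CompleteSpace (harmonicEigenspace d t) := by
  unfold harmonicEigenspace
  infer_instance

/-- The extended norm `‖f(h) u‖_{L²}` given by the functional calculus of the harmonic oscillator.
Since `h` has compact resolvent, `f(h) = ∑_t f(t) P_t` with `P_t` the orthogonal projection onto
the eigenspace for `t`, so `‖f(h) u‖² = ∑_t |f(t)|² ‖P_t u‖²`. The value is finite if and only
if `u` is in the domain of `f(h)`. -/
def harmonicCalculusNorm (d : ℕ) (f : ℝ → ℝ) (u : L2Space d) : ℝ≥0∞ :=
  (∑' t : ℝ, (‖f t‖ₑ * ‖(harmonicEigenspace d t).starProjection u‖ₑ) ^ 2) ^ (1 / 2 : ℝ)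

/-- The weight `t ↦ (ln t)^{1/2} (ln ln t)^{1/2 + ε}`, used on the spectrum of `h`, which is
contained in `[e^e, ∞)`. -/
def logWeight (ε : ℝ) (t : ℝ) : ℝ :=
  Real.log t ^ (1 / 2 : ℝ) * Real.log (Real.log t) ^ (1 / 2 + ε)

end HarmonicOscillator

section BirmanSchwinger

/-- The symbol `k ↦ 1_{|k| > 1} (|k|^{2s} - E)^{-1}` of the operator
`((-Δ)^s - E)^{-1} 1_{|-i∇| > 1}`. -/
def highFrequencySymbol {d : ℕ} (s E : ℝ) (k : RSpace d) : ℝ :=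
  Set.indicator {k : RSpace d | 1 < ‖k‖} (fun k ↦ (‖k‖ ^ (2 * s) - E)⁻¹) k

/-- The bounded operator `K` on `L²(ℝ^d)` is the high-frequency part
`v ((-Δ)^s - E)^{-1} 1_{|-i∇| > 1} v` of the Birman-Schwinger operator, where `v ∈ L²(ℝ^d)`:
for all `u ∈ L²(ℝ^d)`, the Fourier transform of the integrable function `v u`, times the symbol,
is in `L²(ℝ^d)`, and `K u` is its inverse Fourier transform multiplied by `v`. The Fourier
transform has the kernel `exp(-2πi ⟨x, ξ⟩)`, so `-i∇` is multiplication by `2πξ`. -/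
def IsHighFrequencyBirmanSchwinger {d : ℕ} (s E : ℝ) (v : RSpace d → ℝ)
    (K : L2Space d →L[ℂ] L2Space d) : Prop :=
  ∀ u : L2Space d, ∃ w : L2Space d,
    (w =ᵐ[volume] fun ξ ↦ (highFrequencySymbol s E ((2 * Real.pi) • ξ) : ℂ) *
      𝓕 (fun x ↦ (v x : ℂ) * u x) ξ) ∧
    K u =ᵐ[volume] fun x ↦ (v x : ℂ) * (𝓕⁻ w : L2Space d) x

end BirmanSchwinger

end

/-! The operator factorises as `K = G* G`, where `G` has kernel `g(ξ) exp(-2πi⟨x,ξ⟩) v(x)` and `g`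
is the square root of the symbol. It therefore suffices that the singular values of `G` are `O(X /
√N)`; those of `K` are then `O(X² / N)`. The decay of `G` is measured by its Ky Fan sums: the
pairing of `G` with two orthonormal systems of length `N` is at most `√N X`. These bounds add up
under series with constant one, so `v` can be cut into countably many pieces.

If `s > d/2`, then `g` is in `L²` uniformly in `E ≤ 0`, and `G` is Hilbert-Schmidt.

If `s = d/2`, then `|g|²` decays like `|ξ|^{-d}` and its integral diverges logarithmically. Suppose
first that `v` is constant on dyadic cubes of side `2^{-L}`. Frequencies below `2^L` are
Hilbert-Schmidt with squared norm of order `(L+1) ‖v‖²`. On a shell `|ξ| ~ 2^l` with `l ≥ L`, split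
`v` at height `t 2^{dl/2}`. The large part is nuclear: on a cube of side `2^{-l}` the recentred
phase is bounded and can be expanded in a power series, while constancy on cubes turns `L²` norms
into `L¹` norms. The small part is controlled by Plancherel. Both sums over `l` are geometric at
each point, so the shells together cost only `t N + ‖v‖² / t`. Choosing `t` optimally gives `X ~
√(L+1) ‖v‖` (`IsCriticalSymbol.exists_hasFourierKernel_of_step`).

Dyadic martingale differences extend this bound to every `w` whose `L²` modulus of continuity is at
most `2^L ‖w‖ |h|` (`IsCriticalSymbol.exists_hasFourierKernel_of_modulus`). A function in the
spectral subspace `h ≤ Λ` has gradient of size `√Λ ‖w‖`, so it qualifies with `L ~ ln Λ`. Finally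
`v` is split into the blocks `n ≤ ln ln h < n + 1`: there `√L ~ e^{n/2}` is matched by `(ln
h)^{1/2}`, and the factor `(ln ln h)^{1/2+ε} ≥ n^{1/2+ε}` makes the sum over blocks converge by
Cauchy-Schwarz.

The distributional eigenspaces are treated by hand: Schwartz eigenfunctions are generated from the
Gaussian by ladder operators, and their totality follows from a moment argument. -/

/-! ### Ky Fan bounds, compactness and the weak trace quasinorm -/

section KyFan

variable {H H' : Type*} [NormedAddCommGroup H] [InnerProductSpace ℂ H]
  [NormedAddCommGroup H'] [InnerProductSpace ℂ H']

/-- The Ky Fan norms of `T` satisfy `σ_N(T) ≤ √N X` for all `N`. -/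
def KyFanBound (T : H →L[ℂ] H') (X : ℝ) : Prop :=
  ∀ (N : ℕ) (e : Fin N → H) (f : Fin N → H'), Orthonormal ℂ e → Orthonormal ℂ f →
    ‖∑ i, inner ℂ (f i) (T (e i))‖ ≤ √N * X

theorem KyFanBound.mono {T : H →L[ℂ] H'} {X Y : ℝ} (h : KyFanBound T X) (hXY : X ≤ Y) :
    KyFanBound T Y := fun N e f he hf ↦
  (h N e f he hf).trans (mul_le_mul_of_nonneg_left hXY (Real.sqrt_nonneg _))

/-- Subadditivity with constant one is the reason for working with Ky Fan sums: a quasinorm on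
individual singular values would not allow infinite series to be summed term by term. -/
theorem KyFanBound.add {S T : H →L[ℂ] H'} {X Y : ℝ} (hS : KyFanBound S X) (hT : KyFanBound T Y) :
    KyFanBound (S + T) (X + Y) := by
  intro N e f he hf
  simp only [add_apply, inner_add_right, Finset.sum_add_distrib, mul_add]
  exact (norm_add_le _ _).trans (add_le_add (hS N e f he hf) (hT N e f he hf))

theorem KyFanBound.sum {T : ℕ → H →L[ℂ] H'} {X : ℕ → ℝ} (h : ∀ n, KyFanBound (T n) (X n))
    (s : Finset ℕ) : KyFanBound (∑ n ∈ s, T n) (∑ n ∈ s, X n) := by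
  classical
  induction s using Finset.induction_on with
  | empty => intro N e f _ _; simp
  | insert a s ha ih => rw [Finset.sum_insert ha, Finset.sum_insert ha]; exact (h a).add ih

theorem KyFanBound.of_tendsto {T : ℕ → H →L[ℂ] H'} {S : H →L[ℂ] H'} {X : ℝ}
    (h : ∀ n, KyFanBound (T n) X) (hS : Filter.Tendsto T Filter.atTop (nhds S)) :
    KyFanBound S X := by
  intro N e f he hf
  have hc : Continuous fun R : H →L[ℂ] H' ↦ ‖∑ i, inner ℂ (f i) (R (e i))‖ := by fun_prop
  exact le_of_tendsto (hc.continuousAt.tendsto.comp hS)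
    (Filter.Eventually.of_forall fun n ↦ h n N e f he hf)

theorem KyFanBound.hasSum {T : ℕ → H →L[ℂ] H'} {S : H →L[ℂ] H'} {X : ℕ → ℝ}
    (hX0 : ∀ n, 0 ≤ X n) (hX : Summable X)
    (h : ∀ n, KyFanBound (T n) (X n)) (hS : HasSum T S) : KyFanBound S (∑' n, X n) :=
  KyFanBound.of_tendsto
    (fun n ↦ (KyFanBound.sum h (Finset.range n)).mono (hX.sum_le_tsum _ fun i _ ↦ hX0 i))
    hS.tendsto_sum_nat

/-- This is the case `N = 1`, tested on `x / ‖x‖` and `T x / ‖T x‖`. It turns summable Ky Fan bounds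
into absolute convergence in operator norm. -/
theorem KyFanBound.nonneg_norm_le {T : H →L[ℂ] H'} {X : ℝ} (hX : 0 ≤ X) (h : KyFanBound T X) :
    ‖T‖ ≤ X := by
  refine T.opNorm_le_bound hX fun x ↦ ?_
  by_cases hx : x = 0
  · simp [hx]
  by_cases hTx : T x = 0
  · rw [hTx, norm_zero]; positivity
  have hx' : ‖x‖ ≠ 0 := norm_ne_zero_iff.2 hx
  have hTx' : ‖T x‖ ≠ 0 := norm_ne_zero_iff.2 hTx
  have key := h 1 (fun _ ↦ ((‖x‖⁻¹ : ℝ) : ℂ) • x) (fun _ ↦ ((‖T x‖⁻¹ : ℝ) : ℂ) • T x)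
    ⟨fun _ ↦ by simp [norm_smul, hx'], fun i j hij ↦ absurd (Subsingleton.elim i j) hij⟩
    ⟨fun _ ↦ by simp [norm_smul, hTx'], fun i j hij ↦ absurd (Subsingleton.elim i j) hij⟩
  simp only [Finset.univ_unique, Finset.sum_const, Finset.card_singleton, one_smul, map_smul,
    inner_smul_left, inner_smul_right, inner_self_eq_norm_sq_to_K, norm_mul, Nat.cast_one,
    Real.sqrt_one, one_mul] at key
  simp only [Complex.coe_algebraMap, Complex.conj_ofReal, norm_pow, Complex.norm_real, norm_inv,
    norm_norm] at key
  have : ‖x‖⁻¹ * ‖T x‖ ≤ X := by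
    convert key using 1
    field_simp
  rw [inv_mul_le_iff₀ (by positivity)] at this
  linarith

/-- The normalised images `T e_i / ‖T e_i‖` are an admissible second system, and against them the
sum becomes `∑ ‖T e_i‖`. -/
theorem KyFanBound.le_of_orthogonal {T : H →L[ℂ] H'} {X : ℝ}
    (h : KyFanBound T X) {N : ℕ} {e : Fin N → H} (he : Orthonormal ℂ e)
    (ho : ∀ i j, i ≠ j → inner ℂ (T (e i)) (T (e j)) = 0) {ε : ℝ} (hT : ∀ i, ε ≤ ‖T (e i)‖)
    (hε : 0 < ε) : N * ε ≤ √N * X := by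
  have hT0 : ∀ i, 0 < ‖T (e i)‖ := fun i ↦ hε.trans_le (hT i)
  have key := h N e (fun i ↦ ((‖T (e i)‖⁻¹ : ℝ) : ℂ) • T (e i)) he
    ⟨fun i ↦ by simp [norm_smul, (hT0 i).ne'], fun i j hij ↦ by
      simp only [inner_smul_left, inner_smul_right, ho i j hij, mul_zero]⟩
  have hsum : ∑ i, inner ℂ (((‖T (e i)‖⁻¹ : ℝ) : ℂ) • T (e i)) (T (e i)) =
      ((∑ i, ‖T (e i)‖ : ℝ) : ℂ) := by
    rw [Complex.ofReal_sum]
    refine Finset.sum_congr rfl fun i _ ↦ ?_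
    have := (hT0 i).ne'
    rw [inner_smul_left, inner_self_eq_norm_sq_to_K, Complex.conj_ofReal]
    simp only [Complex.coe_algebraMap, Complex.ofReal_inv]
    have h' : ((‖T (e i)‖ : ℝ) : ℂ) ≠ 0 := Complex.ofReal_ne_zero.2 this
    field_simp
  rw [hsum, Complex.norm_real, Real.norm_of_nonneg (by positivity)] at key
  have hge : (N : ℝ) * ε ≤ ∑ i, ‖T (e i)‖ := by
    have := Finset.sum_le_sum (s := Finset.univ) fun i _ ↦ hT i
    simpa using this
  exact hge.trans key

/-- If `T` had distance `ε > 0` from the compact operators, it could not be small on the complement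
of any finite-dimensional space. Orthonormal systems of every length `N`, with orthogonal images of
norm at least `ε / 2`, could then be chosen inductively, which contradicts `√N ε / 2 ≤ X` for large
`N`. -/
theorem KyFanBound.isCompactOperator [CompleteSpace H] [CompleteSpace H'] {T : H →L[ℂ] H'} {X : ℝ}
    (h : KyFanBound T X) : IsCompactOperator T := by
  have hclosed : IsClosed {f : H →L[ℂ] H' | IsCompactOperator f} := isClosed_setOfPred_isCompactOperator
  refine hclosed.closure_subset (Metric.mem_closure_iff.2 fun ε hε ↦ ?_)
  by_contra! hcon
  have hε2 : 0 < ε / 2 := by positivity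
  -- outside every finite-dimensional subspace, `T` is not small
  have hbig : ∀ V : Submodule ℂ H, FiniteDimensional ℂ V →
      ∃ x ∈ Vᗮ, ‖x‖ = 1 ∧ ε / 2 ≤ ‖T x‖ := by
    intro V hV
    by_contra! hV'
    have hcpt : IsCompactOperator (T ∘L V.starProjection) := by
      have : ProperSpace V := FiniteDimensional.proper ℂ V
      exact (isCompactOperator_of_locallyCompactSpace_dom V.orthogonalProjectionOnto).clm_comp
        (T ∘L V.subtypeL)
    have hlt := hcon _ hcpt
    have : ‖T - T ∘L V.starProjection‖ ≤ ε / 2 := by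
      refine ContinuousLinearMap.opNorm_le_bound _ hε2.le fun x ↦ ?_
      set y := x - V.starProjection x with hy
      have hyV : y ∈ Vᗮ := V.sub_starProjection_mem_orthogonal x
      have hTy : (T - T ∘L V.starProjection) x = T y := by simp [hy]
      have hyn : ‖y‖ ≤ ‖x‖ := by
        rw [hy, ← V.starProjection_orthogonal_val]
        exact Vᗮ.norm_starProjection_apply_le x
      rw [hTy]
      by_cases hy0 : y = 0
      · rw [hy0]; simp; positivity
      have hy0' : ‖y‖ ≠ 0 := norm_ne_zero_iff.2 hy0
      have := hV' (((‖y‖⁻¹ : ℝ) : ℂ) • y) (Vᗮ.smul_mem _ hyV) (by simp [norm_smul, hy0'])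
      rw [map_smul, norm_smul, Complex.norm_real, norm_inv, norm_norm,
        inv_mul_lt_iff₀ (by positivity)] at this
      nlinarith [norm_nonneg y]
    rw [dist_eq_norm] at hlt
    linarith
  have hsys : ∀ N : ℕ, ∃ e : Fin N → H, Orthonormal ℂ e ∧ (∀ i, ε / 2 ≤ ‖T (e i)‖) ∧
      ∀ i j, i ≠ j → inner ℂ (T (e i)) (T (e j)) = 0 := by
    intro N
    induction N with
    | zero => exact ⟨Fin.elim0, ⟨fun i ↦ i.elim0, fun i ↦ i.elim0⟩, fun i ↦ i.elim0, fun i ↦ i.elim0⟩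
    | succ N ih =>
      obtain ⟨e, he, hT, ho⟩ := ih
      -- Including `T* T e_i` makes the image of the new vector orthogonal to the previous images.
      set S : Set H := Set.range e ∪ Set.range fun i ↦ T.adjoint (T (e i)) with hS
      have hSf : S.Finite := (Set.finite_range _).union (Set.finite_range _)
      obtain ⟨x, hx, hx1, hTx⟩ := hbig (Submodule.span ℂ S) (FiniteDimensional.span_of_finite ℂ hSf)
      have hxe : ∀ i, inner ℂ (e i) x = 0 := fun i ↦
        (Submodule.mem_orthogonal _ _).1 hx _ (Submodule.subset_span (Or.inl ⟨i, rfl⟩))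
      have hxT : ∀ i, inner ℂ (T (e i)) (T x) = 0 := fun i ↦ by
        rw [← ContinuousLinearMap.adjoint_inner_left]
        exact (Submodule.mem_orthogonal _ _).1 hx _ (Submodule.subset_span (Or.inr ⟨i, rfl⟩))
      refine ⟨Fin.cons x e, ⟨?_, ?_⟩, ?_, ?_⟩
      · intro i; refine Fin.cases ?_ (fun i ↦ ?_) i
        · simpa using hx1
        · simpa using he.1 i
      · intro i j
        refine Fin.cases (Fin.cases ?_ (fun j ↦ ?_) j) (fun i ↦ Fin.cases ?_ (fun j ↦ ?_) j) i
        · intro h; exact absurd rfl h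
        · intro _; simpa using inner_eq_zero_symm.1 (hxe j)
        · intro _; simpa using hxe i
        · intro hij; simpa using he.2 (fun h ↦ hij (by rw [h]))
      · intro i; refine Fin.cases ?_ (fun i ↦ ?_) i
        · simpa using hTx
        · simpa using hT i
      · intro i j
        refine Fin.cases (Fin.cases ?_ (fun j ↦ ?_) j) (fun i ↦ Fin.cases ?_ (fun j ↦ ?_) j) i
        · intro h; exact absurd rfl h
        · intro _; simpa using inner_eq_zero_symm.1 (hxT j)
        · intro _; simpa using hxT i
        · intro hij; simpa using ho i j (fun h ↦ hij (by rw [h]))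
  obtain ⟨N, hN⟩ := exists_nat_gt ((X / (ε / 2)) ^ 2)
  obtain ⟨e, he, hT, ho⟩ := hsys N
  have key := h.le_of_orthogonal he ho hT hε2
  have hN0 : 0 < (N : ℝ) := lt_of_le_of_lt (sq_nonneg _) hN
  have h3 : √N * (ε / 2) ≤ X := by
    have h4 : √N * (√N * (ε / 2)) ≤ √N * X := by
      rw [← mul_assoc, Real.mul_self_sqrt hN0.le]; exact key
    exact le_of_mul_le_mul_left h4 (Real.sqrt_pos.2 hN0)
  have h5 : √N ≤ X / (ε / 2) := by rwa [le_div_iff₀ hε2]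
  have h6 := pow_le_pow_left₀ (Real.sqrt_nonneg _) h5 2
  rw [Real.sq_sqrt hN0.le] at h6
  linarith

/-- Eigenvectors of a self-adjoint operator for distinct eigenvalues are orthogonal, so on a finite
sum of them the form is `∑ τ ‖f_τ‖²` with all `τ ≥ ρ`. -/
theorem mem_iSup_eigenspace_form_lower_bound [CompleteSpace H] {K : H →L[ℂ] H}
    (hK : IsSelfAdjoint K) {ρ : ℝ} {x : H}
    (hx : x ∈ ⨆ τ : {τ : ℝ // ρ ≤ τ},
      Module.End.eigenspace (K : H →ₗ[ℂ] H) ((τ : ℝ) : ℂ)) :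
    ρ * ‖x‖ ^ 2 ≤ (inner ℂ x (K x)).re := by
  classical
  obtain ⟨f, hf, rfl⟩ := (Submodule.mem_iSup_iff_exists_finsupp _ _).1 hx
  have hKf : ∀ i, K (f i) = ((i : ℝ) : ℂ) • f i := fun i ↦ Module.End.mem_eigenspace_iff.1 (hf i)
  have hort : ∀ i j, i ≠ j → inner ℂ (f i) (f j) = 0 := by
    intro i j hij
    have h1 : inner ℂ (K (f i)) (f j) = inner ℂ (f i) (K (f j)) := by
      rw [← ContinuousLinearMap.adjoint_inner_right, hK.adjoint_eq]
    rw [hKf, hKf, inner_smul_left, inner_smul_right, Complex.conj_ofReal] at h1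
    have h2 : (((i : ℝ) : ℂ) - ((j : ℝ) : ℂ)) * inner ℂ (f i) (f j) = 0 := by
      rw [sub_mul, h1, sub_self]
    refine (mul_eq_zero.1 h2).resolve_left ?_
    exact fun h ↦ hij (Subtype.ext (Complex.ofReal_injective (sub_eq_zero.1 h)))
  have hexp : ∀ c : {τ : ℝ // ρ ≤ τ} → ℝ,
      inner ℂ (f.sum fun _ y ↦ y) (∑ i ∈ f.support, ((c i : ℝ) : ℂ) • f i) =
        ((∑ i ∈ f.support, c i * ‖f i‖ ^ 2 : ℝ) : ℂ) := by
    intro c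
    rw [Finsupp.sum, sum_inner, Complex.ofReal_sum]
    refine Finset.sum_congr rfl fun i hi ↦ ?_
    rw [inner_sum, Finset.sum_eq_single i]
    · rw [inner_smul_right, inner_self_eq_norm_sq_to_K]; simp
    · intro j _ hj; rw [inner_smul_right, hort i j hj.symm, mul_zero]
    · exact fun h ↦ absurd hi h
  have h1 : K (f.sum fun _ y ↦ y) = ∑ i ∈ f.support, (((i : ℝ)) : ℂ) • f i := by
    rw [Finsupp.sum, map_sum]; exact Finset.sum_congr rfl fun i _ ↦ hKf i
  have h2 : ‖f.sum fun _ y ↦ y‖ ^ 2 = ∑ i ∈ f.support, ‖f i‖ ^ 2 := by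
    have h3 := hexp fun _ ↦ 1
    simp only [Complex.ofReal_one, one_smul, one_mul] at h3
    have h4 : ∑ i ∈ f.support, f i = f.sum fun _ y ↦ y := rfl
    rw [← Complex.ofReal_inj, ← h3, h4, inner_self_eq_norm_sq_to_K]
    simp
  rw [h1, hexp fun i ↦ (i : ℝ), Complex.ofReal_re, h2, Finset.mul_sum]
  exact Finset.sum_le_sum fun i _ ↦ mul_le_mul_of_nonneg_right i.2 (sq_nonneg _)

/-- From `(K + √t)(K - √t) x = 0` the vector `y = K x - √t x` satisfies `K y = -√t y`; positivity of
`K` forces `y = 0`. -/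
theorem eigenspace_comp_self_le [CompleteSpace H] {K : H →L[ℂ] H}
    (hK : K.IsPositive) {t : ℝ} (ht : 0 < t) :
    Module.End.eigenspace ((K ∘L K : H →L[ℂ] H) : H →ₗ[ℂ] H) (t : ℂ) ≤
      Module.End.eigenspace (K : H →ₗ[ℂ] H) ((√t : ℝ) : ℂ) := by
  intro x hx
  have hx' : K (K x) = (t : ℂ) • x := Module.End.mem_eigenspace_iff.1 hx
  refine Module.End.mem_eigenspace_iff.2 ?_
  set y := K x - ((√t : ℝ) : ℂ) • x with hy
  have hKy : K y = -((√t : ℝ) : ℂ) • y := by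
    have : (t : ℂ) = ((√t : ℝ) : ℂ) * ((√t : ℝ) : ℂ) := by
      rw [← Complex.ofReal_mul, Real.mul_self_sqrt ht.le]
    rw [hy, map_sub, map_smul, hx', this, smul_sub, mul_smul, neg_smul, neg_smul]
    abel
  have h1 := hK.re_inner_nonneg_right y
  rw [hKy, inner_smul_right, inner_self_eq_norm_sq_to_K] at h1
  have h2 : 0 ≤ -(√t * ‖y‖ ^ 2) := by
    have h3 : -((√t : ℝ) : ℂ) * ((‖y‖ : ℝ) : ℂ) ^ 2 = ((-(√t * ‖y‖ ^ 2) : ℝ) : ℂ) := by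
      push_cast; ring
    simpa only [Complex.coe_algebraMap, h3, RCLike.re_eq_complex_re, Complex.ofReal_re] using h1
  have h4 : ‖y‖ ^ 2 = 0 := by
    have := Real.sqrt_pos.2 ht
    nlinarith [sq_nonneg ‖y‖]
  exact sub_eq_zero.1 (norm_eq_zero.1 (pow_eq_zero_iff two_ne_zero |>.1 h4))

/-- A lower bound of the form `‖G x‖²` on a subspace bounds its dimension. -/
theorem KyFanBound.le_of_subspace [CompleteSpace H] [CompleteSpace H'] {G : H →L[ℂ] H'} {X : ℝ}
    (h : KyFanBound G X) {V : Submodule ℂ H} [FiniteDimensional ℂ V] {N : ℕ}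
    (hN : Module.finrank ℂ V = N) {ρ : ℝ} (hρ : 0 < ρ)
    (hV : ∀ x ∈ V, ρ * ‖x‖ ^ 2 ≤ ‖G x‖ ^ 2) : N * √ρ ≤ √N * X := by
  classical
  -- `S` is the compression of `G* G` to `V`. Its eigenbasis is orthonormal with orthogonal images
  -- under `G`, as `KyFanBound.le_of_orthogonal` requires.
  set S : V →ₗ[ℂ] V :=
    ((V.orthogonalProjectionOnto ∘L G.adjoint ∘L G ∘L V.subtypeL : V →L[ℂ] V) : V →ₗ[ℂ] V) with hS
  have hform : ∀ x y : V, inner ℂ x (S y) = inner ℂ (G x) (G y) := by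
    intro x y
    rw [← ContinuousLinearMap.adjoint_inner_right]
    simp [hS]
  have hsymm : S.IsSymmetric := by
    intro x y
    rw [hform, ← inner_conj_symm, hform, inner_conj_symm]
  set b := hsymm.eigenvectorBasis hN with hb
  set e : Fin N → H := fun i ↦ (b i : H) with he
  have heo : Orthonormal ℂ e := b.orthonormal.comp_linearIsometry V.subtypeₗᵢ
  have hGo : ∀ i j, i ≠ j → inner ℂ (G (e i)) (G (e j)) = 0 := by
    intro i j hij
    rw [← hform (b i) (b j), hb, hsymm.apply_eigenvectorBasis hN j, inner_smul_right,
      ← hb, b.orthonormal.2 hij, mul_zero]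
  have hGe : ∀ i, √ρ ≤ ‖G (e i)‖ := by
    intro i
    have := hV (e i) (b i).2
    rw [heo.1 i] at this
    exact Real.sqrt_le_iff.2 ⟨norm_nonneg _, by linarith⟩
  exact h.le_of_orthogonal heo hGo hGe (Real.sqrt_pos.2 hρ)

/-- For `K = G* G` the operator `K* K` is `K²`, so eigenvalues of `K²` above `r` are eigenvalues of
`K` above `√r`. On their span `‖G x‖² ≥ √r ‖x‖²`, and a `(j+1)`-dimensional such space gives `√(j+1)
r^{1/4} ≤ X`. -/
theorem KyFanBound.decreasingEigenvalue_le [CompleteSpace H] [CompleteSpace H'] {G : H →L[ℂ] H'}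
    {X : ℝ} (h : KyFanBound G X) (j : ℕ) :
    decreasingEigenvalue (ContinuousLinearMap.adjoint (G.adjoint ∘L G) ∘L (G.adjoint ∘L G)) j ≤
      ENNReal.ofReal ((X ^ 2 / (j + 1)) ^ 2) := by
  set K := G.adjoint ∘L G with hKdef
  have hpos : K.IsPositive := G.isPositive_adjoint_comp_self
  have hsa : IsSelfAdjoint K := hpos.isSelfAdjoint
  rw [hsa.adjoint_eq]
  refine iSup₂_le fun r hr ↦ ?_
  rcases eq_or_lt_of_le (zero_le : 0 ≤ r) with h0 | h0
  · simp [← h0]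
  have hr0 : 0 < (r : ℝ) := h0
  have hle : (⨆ (t : ℝ) (_ : (r : ℝ) ≤ t),
      Module.End.eigenspace ((K ∘L K : H →L[ℂ] H) : H →ₗ[ℂ] H) (t : ℂ) : Submodule ℂ H) ≤
      ⨆ τ : {τ : ℝ // √(r : ℝ) ≤ τ}, Module.End.eigenspace (K : H →ₗ[ℂ] H) ((τ : ℝ) : ℂ) :=
    iSup₂_le fun t ht ↦ (eigenspace_comp_self_le hpos (hr0.trans_le ht)).trans
      (le_iSup (fun τ : {τ : ℝ // √(r : ℝ) ≤ τ} ↦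
        Module.End.eigenspace (K : H →ₗ[ℂ] H) ((τ : ℝ) : ℂ)) ⟨√t, Real.sqrt_le_sqrt ht⟩)
  set W : Submodule ℂ H := ⨆ (t : ℝ) (_ : (r : ℝ) ≤ t),
      Module.End.eigenspace ((K ∘L K : H →L[ℂ] H) : H →ₗ[ℂ] H) (t : ℂ) with hW
  -- `W` is not known to be finite-dimensional, so a subspace of dimension exactly `j + 1` is taken
  -- from the rank bound.
  obtain ⟨b, hb⟩ := Module.le_rank_iff_exists_linearMap.1 hr
  set V : Submodule ℂ H := LinearMap.range (W.subtype ∘ₗ b) with hV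
  have hinj : Function.Injective (W.subtype ∘ₗ b) :=
    (Submodule.injective_subtype W).comp hb
  have hfin : Module.finrank ℂ V = j + 1 := by
    rw [hV, LinearMap.finrank_range_of_inj hinj]; simp
  have hVW : V ≤ W := by rintro x ⟨y, rfl⟩; exact (b y).2
  have key := h.le_of_subspace hfin (ρ := √(r : ℝ)) (Real.sqrt_pos.2 hr0) fun x hx ↦ by
    have h1 := mem_iSup_eigenspace_form_lower_bound hsa (hle (hVW hx))
    have h2 : inner ℂ x (K x) = ((‖G x‖ ^ 2 : ℝ) : ℂ) := by
      rw [hKdef, ContinuousLinearMap.comp_apply, ContinuousLinearMap.adjoint_inner_right,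
        inner_self_eq_norm_sq_to_K]
      simp
    rwa [h2, Complex.ofReal_re] at h1
  have hN : (0 : ℝ) < ((j + 1 : ℕ) : ℝ) := by positivity
  have h1 : √((j + 1 : ℕ) : ℝ) * √(√(r : ℝ)) ≤ X := by
    refine le_of_mul_le_mul_left ?_ (Real.sqrt_pos.2 hN)
    rwa [← mul_assoc, Real.mul_self_sqrt hN.le]
  have h2 := pow_le_pow_left₀ (by positivity) h1 2
  rw [mul_pow, Real.sq_sqrt hN.le, Real.sq_sqrt (Real.sqrt_nonneg _)] at h2
  have h3 : √(r : ℝ) ≤ X ^ 2 / (j + 1) := by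
    rw [le_div_iff₀ (by positivity)]; push_cast at h2; linarith
  have h4 := pow_le_pow_left₀ (Real.sqrt_nonneg _) h3 2
  rw [Real.sq_sqrt hr0.le] at h4
  rw [← ENNReal.ofReal_coe_nnreal]
  exact ENNReal.ofReal_le_ofReal h4

theorem KyFanBound.weakTraceQuasinorm_le [CompleteSpace H] [CompleteSpace H'] {G : H →L[ℂ] H'}
    {X : ℝ} (h : KyFanBound G X) :
    weakTraceQuasinorm 1 (G.adjoint ∘L G) ≤ ENNReal.ofReal (X ^ 2) := by
  refine iSup_le fun j ↦ ?_
  have h1 : decreasingEigenvalue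
      (ContinuousLinearMap.adjoint (G.adjoint ∘L G) ∘L (G.adjoint ∘L G)) j ^ (1 / 2 : ℝ) ≤
      ENNReal.ofReal (X ^ 2 / (j + 1)) := by
    refine (ENNReal.rpow_le_rpow (h.decreasingEigenvalue_le j) (by norm_num)).trans ?_
    rw [ENNReal.ofReal_rpow_of_nonneg (by positivity) (by norm_num), ← Real.sqrt_eq_rpow,
      Real.sqrt_sq (by positivity)]
  have h2 : ((j : ℝ≥0∞) + 1) ^ (1 / 1 : ℝ) = ENNReal.ofReal (j + 1) := by
    rw [div_one, ENNReal.rpow_one, ENNReal.ofReal_add (by positivity) zero_le_one]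
    simp
  rw [h2]
  calc _ ≤ ENNReal.ofReal (j + 1) * ENNReal.ofReal (X ^ 2 / (j + 1)) := by gcongr
    _ = ENNReal.ofReal (X ^ 2) := by
      rw [← ENNReal.ofReal_mul (by positivity)]
      congr 1
      field_simp

theorem KyFanBound.memWeakTraceIdeal [CompleteSpace H] [CompleteSpace H'] {G : H →L[ℂ] H'}
    {X : ℝ} (h : KyFanBound G X) : MemWeakTraceIdeal 1 (G.adjoint ∘L G) :=
  ⟨h.isCompactOperator.clm_comp G.adjoint,
    (h.weakTraceQuasinorm_le).trans_lt ENNReal.ofReal_lt_top⟩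

end KyFan

/-! ### Square integrals and Cauchy-Schwarz in `ℝ≥0∞` -/

section Lebesgue

variable {α E : Type*} [MeasurableSpace α] {μ : Measure α} [NormedAddCommGroup E]

theorem lintegral_enorm_sq_eq_eLpNorm_sq (f : α → E) :
    ∫⁻ x, ‖f x‖ₑ ^ 2 ∂μ = eLpNorm f 2 μ ^ 2 := by
  rw [eLpNorm_eq_lintegral_rpow_enorm_toReal two_ne_zero ENNReal.ofNat_ne_top, ← ENNReal.rpow_natCast,
    ← ENNReal.rpow_mul]
  simp

theorem lintegral_enorm_sq_coeFn (f : Lp E 2 μ) : ∫⁻ x, ‖f x‖ₑ ^ 2 ∂μ = ‖f‖ₑ ^ 2 := by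
  rw [lintegral_enorm_sq_eq_eLpNorm_sq, Lp.enorm_def]

theorem ofReal_norm_sq_eq_lintegral (f : Lp E 2 μ) :
    ENNReal.ofReal (‖f‖ ^ 2) = ∫⁻ x, ‖f x‖ₑ ^ 2 ∂μ := by
  rw [lintegral_enorm_sq_coeFn, ENNReal.ofReal_pow (norm_nonneg _), ofReal_norm]

theorem memLp_two_of_lintegral_lt_top {f : α → E} (hf : AEStronglyMeasurable f μ)
    (h : ∫⁻ x, ‖f x‖ₑ ^ 2 ∂μ < ∞) : MemLp f 2 μ := by
  refine ⟨hf, ?_⟩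
  rw [lintegral_enorm_sq_eq_eLpNorm_sq] at h
  exact (ENNReal.pow_lt_top_iff.1 h).resolve_right two_ne_zero

theorem lintegral_enorm_mul_le {f g : α → ℂ} (hf : AEStronglyMeasurable f μ)
    (hg : AEStronglyMeasurable g μ) :
    ∫⁻ x, ‖f x * g x‖ₑ ∂μ ≤ eLpNorm f 2 μ * eLpNorm g 2 μ := by
  have h := ENNReal.lintegral_mul_le_Lp_mul_Lq μ Real.HolderConjugate.two_two hf.enorm hg.enorm
  simp only [enorm_mul]
  refine h.trans_eq ?_
  rw [eLpNorm_eq_lintegral_rpow_enorm_toReal two_ne_zero ENNReal.ofNat_ne_top,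
    eLpNorm_eq_lintegral_rpow_enorm_toReal two_ne_zero ENNReal.ofNat_ne_top]
  simp

end Lebesgue

/-! ### The Fourier integral and Plancherel's identity on `L¹ ∩ L²` -/

section Fourier

variable {V : Type*} [NormedAddCommGroup V] [InnerProductSpace ℝ V] [MeasurableSpace V]
  [BorelSpace V] [FiniteDimensional ℝ V]

theorem continuous_fourier_of_integrable {f : V → ℂ} (hf : Integrable f) : Continuous (𝓕 f) :=
  VectorFourier.fourierIntegral_continuous Real.continuous_fourierChar
    (innerSL ℝ).continuous₂ hf

theorem norm_fourier_le_integral_norm (f : V → ℂ) (ξ : V) : ‖𝓕 f ξ‖ ≤ ∫ x, ‖f x‖ :=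
  VectorFourier.norm_fourierIntegral_le_integral_norm _ _ _ _ _

theorem enorm_fourier_le_lintegral_enorm (f : V → ℂ) (ξ : V) : ‖𝓕 f ξ‖ₑ ≤ ∫⁻ x, ‖f x‖ₑ := by
  rw [Real.fourier_eq]
  refine (enorm_integral_le_lintegral_enorm _).trans_eq (lintegral_congr fun x ↦ ?_)
  rw [← ofReal_norm, ← ofReal_norm, Circle.norm_smul]

theorem fourier_add_of_integrable {f g : V → ℂ} (hf : Integrable f) (hg : Integrable g) (ξ : V) :
    𝓕 (fun x ↦ f x + g x) ξ = 𝓕 f ξ + 𝓕 g ξ := by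
  rw [Real.fourier_eq, Real.fourier_eq, Real.fourier_eq, ← integral_add]
  · simp_rw [smul_add]
  · exact (Real.fourierIntegral_convergent_iff ξ).2 hf
  · exact (Real.fourierIntegral_convergent_iff ξ).2 hg

theorem fourier_const_mul (c : ℂ) (f : V → ℂ) (ξ : V) :
    𝓕 (fun x ↦ c * f x) ξ = c * 𝓕 f ξ := by
  rw [Real.fourier_eq, Real.fourier_eq, ← integral_const_mul]
  congr 1 with x
  rw [Circle.smul_def, Circle.smul_def, smul_eq_mul, smul_eq_mul]
  ring

/-- On `L¹ ∩ L²` the Fourier transform on `L²` is given by the Fourier integral. -/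
theorem coeFn_fourier_toLp {f : V → ℂ} (hf : Integrable f) (hf2 : MemLp f 2) :
    (𝓕 (hf2.toLp f) : Lp (α := V) ℂ 2) =ᵐ[volume] 𝓕 f := by
  -- Both sides are locally integrable, so they may be tested against smooth compactly supported
  -- functions, where the Fourier transform is moved onto the test function.
  refine ae_eq_of_integral_contDiff_smul_eq ((Lp.memLp _).locallyIntegrable (by norm_num))
    (continuous_fourier_of_integrable hf).locallyIntegrable fun g hg hg' ↦ ?_
  have hg₁ : HasCompactSupport (Complex.ofRealCLM ∘ g) := hg'.comp_left rfl
  have hg₂ : ContDiff ℝ ((⊤ : ℕ∞) : WithTop ℕ∞) (Complex.ofRealCLM ∘ g) := 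
    Complex.ofRealCLM.contDiff.comp hg
  set ψ := hg₁.toSchwartzMap hg₂ with hψ
  have h1 := congrArg (fun T : 𝓢'(V, ℂ) ↦ T ψ)
    (Lp.fourier_toTemperedDistribution_eq (hf2.toLp f))
  simp only [TemperedDistribution.fourier_apply, Lp.toTemperedDistribution_apply] at h1
  have h2 : ∫ x, (𝓕 ψ) x • (hf2.toLp f) x = ∫ x, (𝓕 ψ) x • f x :=
    integral_congr_ae (hf2.coeFn_toLp.mono fun x hx ↦ by simp only [hx])
  have h3 : ∫ ξ, 𝓕 (ψ : V → ℂ) ξ • f ξ = ∫ x, ψ x • 𝓕 f x := by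
    have := VectorFourier.integral_fourierIntegral_smul_eq_flip (L := innerₗ V)
      (μ := volume) (ν := volume)
      Real.continuous_fourierChar continuous_inner (ψ.integrable (μ := volume)) hf
    rwa [flip_innerₗ] at this
  rw [h2, SchwartzMap.fourier_coe, h3] at h1
  simpa [hψ] using h1.symm

theorem lintegral_enorm_fourier_sq {f : V → ℂ} (hf : Integrable f) (hf2 : MemLp f 2) :
    ∫⁻ ξ, ‖𝓕 f ξ‖ₑ ^ 2 = ∫⁻ x, ‖f x‖ₑ ^ 2 := by
  calc ∫⁻ ξ, ‖𝓕 f ξ‖ₑ ^ 2 = ∫⁻ ξ, ‖(𝓕 (hf2.toLp f) : Lp (α := V) ℂ 2 volume) ξ‖ₑ ^ 2 :=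
        lintegral_congr_ae ((coeFn_fourier_toLp hf hf2).mono fun x hx ↦ by simp only [hx])
    _ = ‖hf2.toLp f‖ₑ ^ 2 := by
        rw [lintegral_enorm_sq_coeFn, ← ofReal_norm, Lp.norm_fourier_eq, ofReal_norm]
    _ = _ := by rw [Lp.enorm_toLp, lintegral_enorm_sq_eq_eLpNorm_sq]

end Fourier

/-! ### Operators with kernel `g(ξ) exp(-2πi⟨x,ξ⟩) w(x)` and their series -/

section FourierKernel

variable {d : ℕ}

theorem memLp_two_mul_integrable {w : RSpace d → ℂ} (hw : MemLp w 2) (f : L2Space d) :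
    Integrable fun x ↦ w x * f x :=
  hw.integrable_mul (Lp.memLp f)

/-- `G` is the operator with integral kernel `g(ξ) exp(-2πi ⟨x, ξ⟩) w(x)`. -/
def HasFourierKernel (g : RSpace d → ℝ) (w : RSpace d → ℂ) (G : L2Space d →L[ℂ] L2Space d) : Prop :=
  ∀ f : L2Space d, G f =ᵐ[volume] fun ξ ↦ (g ξ : ℂ) * 𝓕 (fun x ↦ w x * f x) ξ

theorem HasFourierKernel.congr_ae {g : RSpace d → ℝ} {w w' : RSpace d → ℂ}
    {G : L2Space d →L[ℂ] L2Space d} (h : HasFourierKernel g w G) (hw : w =ᵐ[volume] w') :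
    HasFourierKernel g w' G := by
  intro f
  refine (h f).trans (Filter.Eventually.of_forall fun ξ ↦ ?_)
  simp only
  have : (fun x ↦ w x * f x) =ᵐ[volume] fun x ↦ w' x * f x := hw.mono fun x hx ↦ by simp only [hx]
  rw [Real.fourier_congr_ae this]

/-- The constant `C` only serves to produce a bounded operator; the quantitative information is
supplied separately by Ky Fan bounds. -/
theorem exists_hasFourierKernel {g : RSpace d → ℝ} (hg : Measurable g) {w : RSpace d → ℂ}
    (hw : MemLp w 2) {C : ℝ} (hC : 0 ≤ C)
    (h : ∀ f : L2Space d, ∫⁻ ξ, ‖(g ξ : ℂ) * 𝓕 (fun x ↦ w x * f x) ξ‖ₑ ^ 2 ≤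
      ENNReal.ofReal ((C * ‖f‖) ^ 2)) :
    ∃ G : L2Space d →L[ℂ] L2Space d, HasFourierKernel g w G := by
  have hmem : ∀ f : L2Space d, MemLp (fun ξ ↦ (g ξ : ℂ) * 𝓕 (fun x ↦ w x * f x) ξ) 2 := by
    intro f
    refine memLp_two_of_lintegral_lt_top ?_ ((h f).trans_lt ENNReal.ofReal_lt_top)
    exact (Complex.measurable_ofReal.comp hg).aestronglyMeasurable.mul
      (continuous_fourier_of_integrable (memLp_two_mul_integrable hw f)).aestronglyMeasurable
  refine ⟨LinearMap.mkContinuous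
    { toFun := fun f ↦ ((hmem f).toLp _ : L2Space d)
      map_add' := fun f f' ↦ ?_
      map_smul' := fun c f ↦ ?_ } C fun f ↦ ?_, fun f ↦ (hmem f).coeFn_toLp⟩
  · rw [← MemLp.toLp_add]
    refine MemLp.toLp_congr _ _ (Filter.Eventually.of_forall fun ξ ↦ ?_)
    simp only [Pi.add_apply]
    rw [← mul_add, ← fourier_add_of_integrable (memLp_two_mul_integrable hw f)
      (memLp_two_mul_integrable hw f')]
    congr 1
    refine Real.fourier_congr_ae ?_ ξ
    filter_upwards [Lp.coeFn_add f f'] with x hx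
    rw [hx, Pi.add_apply, mul_add]
  · refine Eq.trans ?_ (MemLp.toLp_const_smul (𝕜 := ℂ) c (hmem f))
    refine MemLp.toLp_congr _ _ (Filter.Eventually.of_forall fun ξ ↦ ?_)
    simp only [Pi.smul_apply, smul_eq_mul]
    rw [mul_left_comm, ← fourier_const_mul c]
    congr 1
    refine Real.fourier_congr_ae ?_ ξ
    filter_upwards [Lp.coeFn_smul c f] with x hx
    rw [hx, Pi.smul_apply, smul_eq_mul, mul_left_comm]
  · have h1 : ENNReal.ofReal (‖(hmem f).toLp _‖ ^ 2) ≤ ENNReal.ofReal ((C * ‖f‖) ^ 2) := by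
      rw [ofReal_norm_sq_eq_lintegral]
      refine le_trans (le_of_eq ?_) (h f)
      exact lintegral_congr_ae ((hmem f).coeFn_toLp.mono fun x hx ↦ by simp only [hx])
    have h2 := (ENNReal.ofReal_le_ofReal_iff (by positivity)).1 h1
    exact abs_le_of_sq_le_sq' h2 (by positivity) |>.2

/-- By Cauchy-Schwarz `s_n f` tends to `w f` in `L¹`, so the Fourier integrals converge at every
point and not only in mean. -/
theorem tendsto_fourier_mul {w : RSpace d → ℂ} (hw : MemLp w 2)
    {s : ℕ → RSpace d → ℂ} (hs : ∀ n, MemLp (s n) 2)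
    (hlim : Filter.Tendsto (fun n ↦ eLpNorm (fun x ↦ w x - s n x) 2 volume)
      Filter.atTop (nhds 0)) (f : L2Space d) (ξ : RSpace d) :
    Filter.Tendsto (fun n ↦ 𝓕 (fun x ↦ s n x * f x) ξ)
      Filter.atTop (nhds (𝓕 (fun x ↦ w x * f x) ξ)) := by
  rw [tendsto_iff_edist_tendsto_0]
  have hbound : ∀ n, edist (𝓕 (fun x ↦ s n x * f x) ξ) (𝓕 (fun x ↦ w x * f x) ξ) ≤
      eLpNorm (fun x ↦ w x - s n x) 2 volume * eLpNorm f 2 volume := by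
    intro n
    have hd : MemLp (fun x ↦ w x - s n x) 2 volume := hw.sub (hs n)
    have h1 : 𝓕 (fun x ↦ w x * f x) ξ = 𝓕 (fun x ↦ s n x * f x) ξ +
        𝓕 (fun x ↦ (w x - s n x) * f x) ξ := by
      rw [← fourier_add_of_integrable (memLp_two_mul_integrable (hs n) f)
        (memLp_two_mul_integrable hd f)]
      exact congrArg (fun F : RSpace d → ℂ ↦ 𝓕 F ξ) (funext fun x ↦ by ring)
    rw [edist_comm, h1, edist_eq_enorm_sub, add_sub_cancel_left]
    refine (enorm_fourier_le_lintegral_enorm _ ξ).trans ?_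
    exact lintegral_enorm_mul_le hd.1 (Lp.aestronglyMeasurable f)
  have hz : Filter.Tendsto (fun n ↦ eLpNorm (fun x ↦ w x - s n x) 2 volume *
      eLpNorm f 2 volume) Filter.atTop (nhds 0) := by
    have := ENNReal.Tendsto.mul_const hlim (b := eLpNorm f 2 volume)
      (Or.inr (Lp.eLpNorm_ne_top f))
    rwa [zero_mul] at this
  exact tendsto_of_tendsto_of_tendsto_of_le_of_le tendsto_const_nhds hz (fun _ ↦ zero_le)
    hbound

/-- Series of operators with Fourier kernels. -/
theorem exists_hasFourierKernel_of_series {g : RSpace d → ℝ} {w : RSpace d → ℂ} (hw : MemLp w 2)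
    {u : ℕ → RSpace d → ℂ} (hu : ∀ n, MemLp (u n) 2)
    (hlim : Filter.Tendsto (fun n ↦ eLpNorm (fun x ↦ w x - ∑ k ∈ Finset.range n, u k x) 2 volume)
      Filter.atTop (nhds 0))
    {X : ℕ → ℝ} (hX0 : ∀ n, 0 ≤ X n) (hX : Summable X)
    (hG : ∀ n, ∃ G : L2Space d →L[ℂ] L2Space d, HasFourierKernel g (u n) G ∧ KyFanBound G (X n)) :
    ∃ G : L2Space d →L[ℂ] L2Space d, HasFourierKernel g w G ∧ KyFanBound G (∑' n, X n) := by
  choose G hGk hGX using hG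
  have hsum : Summable G := Summable.of_norm_bounded hX fun n ↦ (hGX n).nonneg_norm_le (hX0 n)
  refine ⟨∑' n, G n, fun f ↦ ?_, KyFanBound.hasSum hX0 hX hGX hsum.hasSum⟩
  have hL2 : Filter.Tendsto (fun n ↦ (∑ k ∈ Finset.range n, G k) f) Filter.atTop
      (nhds ((∑' n, G n) f)) :=
    ((ContinuousLinearMap.apply ℂ (L2Space d) f).continuous.tendsto _).comp
      hsum.hasSum.tendsto_sum_nat
  -- Convergence in `L²` yields almost everywhere convergence along a subsequence. The kernel
  -- formula for the partial sums converges at every `ξ`, so the two limits agree.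
  obtain ⟨ns, hns, hae⟩ := (tendstoInMeasure_of_tendsto_Lp hL2).exists_seq_tendsto_ae
  have hpart : ∀ n, ((∑ k ∈ Finset.range n, G k) f : L2Space d) =ᵐ[volume]
      fun ξ ↦ (g ξ : ℂ) * 𝓕 (fun x ↦ (∑ k ∈ Finset.range n, u k x) * f x) ξ := by
    intro n
    induction n with
    | zero =>
      refine (Lp.coeFn_zero _ _ _).trans (Filter.Eventually.of_forall fun ξ ↦ ?_)
      simp [Real.fourier_eq]
    | succ n ih =>
      rw [Finset.sum_range_succ, add_apply]
      refine (Lp.coeFn_add _ _).trans ?_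
      filter_upwards [ih, hGk n f] with ξ h1 h2
      rw [Pi.add_apply, h1, h2, ← mul_add, ← fourier_add_of_integrable
        (memLp_two_mul_integrable (memLp_finsetSum _ fun k _ ↦ hu k) f)
        (memLp_two_mul_integrable (hu n) f)]
      simp_rw [Finset.sum_range_succ, add_mul]
  have hptw := tendsto_fourier_mul hw (fun n ↦ memLp_finsetSum (Finset.range n) fun k _ ↦ hu k)
    hlim f
  filter_upwards [hae, ae_all_iff.2 hpart] with ξ h1 h2
  refine tendsto_nhds_unique h1 ?_
  simp_rw [h2]
  exact ((hptw ξ).comp hns.tendsto_atTop).const_mul _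

end FourierKernel

/-! ### Nuclear bounds for Fourier kernels localised in boxes -/

section Nuclear

variable {d N : ℕ}

theorem inner_toLp_eq_integral (f : L2Space d) {A : RSpace d → ℂ} (hA : MemLp A 2) :
    inner ℂ f (hA.toLp A) = ∫ x, (starRingEnd ℂ) (f x) * A x := by
  rw [L2.inner_def]
  refine integral_congr_ae (hA.coeFn_toLp.mono fun x hx ↦ ?_)
  simp only [hx, RCLike.inner_apply]
  ring

theorem star_toLp_inner_eq_integral (f : L2Space d) {B : RSpace d → ℂ} (hB : MemLp B 2) :
    inner ℂ (hB.star.toLp (star B)) f = ∫ x, B x * f x := by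
  rw [L2.inner_def]
  refine integral_congr_ae (hB.star.coeFn_toLp.mono fun x hx ↦ ?_)
  simp only [hx, RCLike.inner_apply, Pi.star_apply]
  simp [mul_comm]

theorem sum_norm_integral_mul_sq_le {e : Fin N → L2Space d} (he : Orthonormal ℂ e)
    {B : RSpace d → ℂ} (hB : MemLp B 2) :
    ∑ i, ‖∫ x, B x * e i x‖ ^ 2 ≤ (eLpNorm B 2 volume).toReal ^ 2 := by
  have h := he.sum_inner_products_le (hB.star.toLp (star B)) (s := Finset.univ)
  rw [Lp.norm_toLp, eLpNorm_star] at h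
  refine le_trans (le_of_eq (Finset.sum_congr rfl fun i _ ↦ ?_)) h
  rw [← star_toLp_inner_eq_integral _ hB, norm_inner_symm]

theorem sum_norm_integral_conj_mul_sq_le {f : Fin N → L2Space d} (hf : Orthonormal ℂ f)
    {A : RSpace d → ℂ} (hA : MemLp A 2) :
    ∑ i, ‖∫ x, (starRingEnd ℂ) (f i x) * A x‖ ^ 2 ≤ (eLpNorm A 2 volume).toReal ^ 2 := by
  have h := hf.sum_inner_products_le (hA.toLp A) (s := Finset.univ)
  rw [Lp.norm_toLp] at h
  refine le_trans (le_of_eq (Finset.sum_congr rfl fun i _ ↦ ?_)) h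
  rw [← inner_toLp_eq_integral]

theorem integrable_conj_mul (f : L2Space d) {A : RSpace d → ℂ} (hA : MemLp A 2) :
    Integrable fun x ↦ (starRingEnd ℂ) (f x) * A x :=
  (Lp.memLp f).star.integrable_mul hA

/-- The density `∑ conj(f_i(ξ)) A(ξ) B(x) e_i(x)` against which kernels are integrated. -/
noncomputable def pairDensity (e f : Fin N → L2Space d) (A B : RSpace d → ℂ) (z : RSpace d × RSpace d) : ℂ :=
  ∑ i, ((starRingEnd ℂ) (f i z.1) * A z.1) * (B z.2 * e i z.2)

theorem integrable_pairDensity (e f : Fin N → L2Space d) {A B : RSpace d → ℂ} (hA : MemLp A 2)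
    (hB : MemLp B 2) : Integrable (pairDensity e f A B) (volume.prod volume) :=
  integrable_finsetSum _ fun i _ ↦
    (integrable_conj_mul (f i) hA).mul_prod (memLp_two_mul_integrable hB (e i))

/-- Without the phase the kernel `A(ξ) B(x)` has rank one: Cauchy-Schwarz over `i` and Bessel's
inequality for each system give a bound independent of `N`. -/
theorem norm_integral_pairDensity_le {e f : Fin N → L2Space d} (he : Orthonormal ℂ e)
    (hf : Orthonormal ℂ f) {A B : RSpace d → ℂ} (hA : MemLp A 2) (hB : MemLp B 2) :
    ‖∫ z, pairDensity e f A B z ∂(volume.prod volume)‖ ≤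
      (eLpNorm A 2 volume).toReal * (eLpNorm B 2 volume).toReal := by
  simp only [pairDensity]
  rw [integral_finsetSum _ fun i _ ↦
    (integrable_conj_mul (f i) hA).mul_prod (memLp_two_mul_integrable hB (e i))]
  refine (norm_sum_le _ _).trans ?_
  have hprod : ∀ i, ‖∫ z, ((starRingEnd ℂ) (f i z.1) * A z.1) * (B z.2 * e i z.2)
      ∂((volume : Measure (RSpace d)).prod (volume : Measure (RSpace d)))‖ =
      ‖∫ ξ, (starRingEnd ℂ) (f i ξ) * A ξ‖ * ‖∫ x, B x * e i x‖ := fun i ↦ by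
    rw [integral_prod_mul (fun ξ ↦ (starRingEnd ℂ) (f i ξ) * A ξ) (fun x ↦ B x * e i x), norm_mul]
  simp_rw [hprod]
  refine (Real.sum_mul_le_sqrt_mul_sqrt _ _ _).trans ?_
  refine mul_le_mul ?_ ?_ (Real.sqrt_nonneg _) ENNReal.toReal_nonneg
  · exact Real.sqrt_le_iff.2 ⟨ENNReal.toReal_nonneg, sum_norm_integral_conj_mul_sq_le hf hA⟩
  · exact Real.sqrt_le_iff.2 ⟨ENNReal.toReal_nonneg, sum_norm_integral_mul_sq_le he hB⟩

theorem memLp_bounded_mul {A : RSpace d → ℂ} (hA : MemLp A 2) {φ : RSpace d → ℝ}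
    (hφ : Continuous φ) {M : ℝ} (hM : ∀ ξ, A ξ ≠ 0 → |φ ξ| ≤ M) :
    MemLp (fun ξ ↦ (φ ξ : ℂ) * A ξ) 2 ∧
      (eLpNorm (fun ξ ↦ (φ ξ : ℂ) * A ξ) 2 volume).toReal ≤
        |M| * (eLpNorm A 2 volume).toReal := by
  have hb : ∀ ξ, ‖(φ ξ : ℂ) * A ξ‖ ≤ ‖(M : ℂ) * A ξ‖ := by
    intro ξ
    by_cases h : A ξ = 0
    · simp [h]
    rw [norm_mul, norm_mul, Complex.norm_real, Complex.norm_real]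
    gcongr
    exact (hM ξ h).trans (le_abs_self M)
  have hm : MemLp (fun ξ ↦ (φ ξ : ℂ) * A ξ) 2 :=
    (hA.const_mul (M : ℂ)).mono
      ((Complex.continuous_ofReal.comp hφ).aestronglyMeasurable.mul hA.1)
      (Filter.Eventually.of_forall hb)
  refine ⟨hm, ?_⟩
  have h1 : eLpNorm (fun ξ ↦ (φ ξ : ℂ) * A ξ) 2 volume ≤ ‖(M : ℂ)‖ₑ * eLpNorm A 2 volume := by
    refine (eLpNorm_mono hb).trans (le_of_eq ?_)
    exact eLpNorm_const_smul (M : ℂ) A 2 volume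
  refine (ENNReal.toReal_mono (ENNReal.mul_ne_top (by simp) hA.2.ne) h1).trans (le_of_eq ?_)
  rw [ENNReal.toReal_mul, toReal_enorm, Complex.norm_real, Real.norm_eq_abs]

/-- One factor `⟨x - c, ξ⟩ = ∑ ξ_j (x_j - c_j)` is a sum of `d` products that can be absorbed into
`A` and `B` at the price `M₁ M₂` each. The induction changes `A` and `B`, which are therefore
quantified after `n`. -/
theorem norm_integral_pairDensity_mul_pow_le {e f : Fin N → L2Space d} (he : Orthonormal ℂ e)
    (hf : Orthonormal ℂ f) (c : RSpace d) {M₁ M₂ : ℝ} (hM₁ : 0 ≤ M₁) (hM₂ : 0 ≤ M₂) (n : ℕ) :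
    ∀ {A B : RSpace d → ℂ}, MemLp A 2 → MemLp B 2 → (∀ ξ, A ξ ≠ 0 → ∀ j, |ξ j| ≤ M₁) →
    (∀ x, B x ≠ 0 → ∀ j, |x j - c j| ≤ M₂) →
    Integrable (fun z ↦ pairDensity e f A B z * ((inner ℝ (z.2 - c) z.1 : ℝ) : ℂ) ^ n)
      (volume.prod volume) ∧
    ‖∫ z, pairDensity e f A B z * ((inner ℝ (z.2 - c) z.1 : ℝ) : ℂ) ^ n ∂(volume.prod volume)‖ ≤
      (d * (M₁ * M₂)) ^ n * ((eLpNorm A 2 volume).toReal * (eLpNorm B 2 volume).toReal) := by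
  induction n with
  | zero =>
    intro A B hA hB _ _
    simpa using ⟨integrable_pairDensity e f hA hB, norm_integral_pairDensity_le he hf hA hB⟩
  | succ n ih =>
    intro A B hA hB hsA hsB
    have hexp : ∀ z : RSpace d × RSpace d,
        pairDensity e f A B z * ((inner ℝ (z.2 - c) z.1 : ℝ) : ℂ) ^ (n + 1) =
        ∑ j, pairDensity e f (fun ξ ↦ ((ξ j : ℝ) : ℂ) * A ξ)
          (fun x ↦ ((x j - c j : ℝ) : ℂ) * B x) z * ((inner ℝ (z.2 - c) z.1 : ℝ) : ℂ) ^ n := by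
      intro z
      have h1 : ((inner ℝ (z.2 - c) z.1 : ℝ) : ℂ) =
          ∑ j, ((z.1 j : ℝ) : ℂ) * ((z.2 j - c j : ℝ) : ℂ) := by
        rw [PiLp.inner_apply]
        push_cast
        refine Finset.sum_congr rfl fun j _ ↦ ?_
        simp
      rw [pow_succ', ← mul_assoc, ← Finset.sum_mul]
      congr 1
      rw [h1, Finset.mul_sum]
      refine Finset.sum_congr rfl fun j _ ↦ ?_
      simp only [pairDensity]
      rw [Finset.sum_mul]
      refine Finset.sum_congr rfl fun i _ ↦ ?_
      ring
    have hj := fun j : Fin d ↦ memLp_bounded_mul hA (φ := fun ξ ↦ ξ j) (M := M₁) (by fun_prop)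
      (fun ξ h ↦ hsA ξ h j)
    have hk := fun j : Fin d ↦ memLp_bounded_mul hB (φ := fun x ↦ x j - c j) (M := M₂) (by fun_prop)
      (fun x h ↦ hsB x h j)
    have hi := fun j : Fin d ↦ ih (hj j).1 (hk j).1
      (fun ξ h ↦ hsA ξ (right_ne_zero_of_mul h)) (fun x h ↦ hsB x (right_ne_zero_of_mul h))
    simp_rw [hexp]
    refine ⟨integrable_finsetSum _ fun j _ ↦ (hi j).1, ?_⟩
    rw [integral_finsetSum _ fun j _ ↦ (hi j).1]
    refine (norm_sum_le _ _).trans ((Finset.sum_le_sum fun j _ ↦ (hi j).2).trans ?_)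
    have hD : 0 ≤ (d * (M₁ * M₂)) ^ n := by positivity
    calc ∑ j : Fin d, _ ≤ ∑ j : Fin d, (d * (M₁ * M₂)) ^ n *
          ((M₁ * (eLpNorm A 2 volume).toReal) * (M₂ * (eLpNorm B 2 volume).toReal)) := by
          refine Finset.sum_le_sum fun j _ ↦ mul_le_mul_of_nonneg_left ?_ hD
          refine mul_le_mul ?_ ?_ ENNReal.toReal_nonneg (by positivity)
          · simpa only [abs_of_nonneg hM₁] using (hj j).2
          · simpa only [abs_of_nonneg hM₂] using (hk j).2
      _ = _ := by
          rw [Finset.sum_const, Finset.card_univ, Fintype.card_fin, nsmul_eq_mul]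
          ring

/-- The exponential series is integrated term by term, and each power is bounded by the preceding
lemma. The support conditions give `|⟨x - c, ξ⟩| ≤ d M₁ M₂`, which justifies the interchange. -/
theorem norm_integral_pairDensity_mul_exp_le {e f : Fin N → L2Space d} (he : Orthonormal ℂ e)
    (hf : Orthonormal ℂ f) (c : RSpace d) {M₁ M₂ : ℝ} (hM₁ : 0 ≤ M₁) (hM₂ : 0 ≤ M₂)
    {A B : RSpace d → ℂ} (hA : MemLp A 2) (hB : MemLp B 2) (hsA : ∀ ξ, A ξ ≠ 0 → ∀ j, |ξ j| ≤ M₁)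
    (hsB : ∀ x, B x ≠ 0 → ∀ j, |x j - c j| ≤ M₂) (a : ℂ) :
    ‖∫ z, pairDensity e f A B z * Complex.exp (a * ((inner ℝ (z.2 - c) z.1 : ℝ) : ℂ))
      ∂(volume.prod volume)‖ ≤
      Real.exp (‖a‖ * (d * (M₁ * M₂))) *
        ((eLpNorm A 2 volume).toReal * (eLpNorm B 2 volume).toReal) := by
  set D : ℝ := d * (M₁ * M₂) with hD
  have hD0 : 0 ≤ D := by positivity
  have hpow := fun n ↦ norm_integral_pairDensity_mul_pow_le he hf c hM₁ hM₂ n hA hB hsA hsB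
  set F : ℕ → RSpace d × RSpace d → ℂ := fun n z ↦
    (a ^ n / (n.factorial : ℂ)) *
      (pairDensity e f A B z * ((inner ℝ (z.2 - c) z.1 : ℝ) : ℂ) ^ n) with hF
  have hFint : ∀ n, Integrable (F n) (volume.prod volume) := fun n ↦ (hpow n).1.const_mul _
  have hinner : ∀ z : RSpace d × RSpace d, pairDensity e f A B z ≠ 0 →
      |(inner ℝ (z.2 - c) z.1 : ℝ)| ≤ D := by
    intro z hz
    have hA0 : A z.1 ≠ 0 := fun h ↦ hz (by simp [pairDensity, h])
    have hB0 : B z.2 ≠ 0 := fun h ↦ hz (by simp [pairDensity, h])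
    rw [PiLp.inner_apply]
    refine (Finset.abs_sum_le_sum_abs _ _).trans ?_
    calc ∑ j, |(inner ℝ ((z.2 - c) j) (z.1 j) : ℝ)| ≤ ∑ _j : Fin d, M₁ * M₂ := by
          refine Finset.sum_le_sum fun j _ ↦ ?_
          have h1 : (inner ℝ ((z.2 - c) j) (z.1 j) : ℝ) = z.1 j * (z.2 j - c j) := by simp
          rw [h1, abs_mul]
          exact mul_le_mul (hsA _ hA0 j) (hsB _ hB0 j) (abs_nonneg _) hM₁
      _ = D := by rw [Finset.sum_const, Finset.card_univ, Fintype.card_fin, nsmul_eq_mul, hD]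
  have hFnorm : ∀ n z, ‖F n z‖ ≤ (‖a‖ * D) ^ n / n.factorial * ‖pairDensity e f A B z‖ := by
    intro n z
    simp only [hF, norm_mul, norm_div, norm_pow, Complex.norm_natCast, Complex.norm_real,
      Real.norm_eq_abs]
    by_cases hz : pairDensity e f A B z = 0
    · simp [hz]
    rw [mul_pow, mul_div_right_comm, mul_comm ‖pairDensity e f A B z‖, ← mul_assoc]
    gcongr
    exact hinner z hz
  have hsummable : Summable fun n ↦ ∫ z, ‖F n z‖ ∂(volume.prod volume) := by
    refine Summable.of_nonneg_of_le (fun n ↦ integral_nonneg fun z ↦ norm_nonneg _) (fun n ↦ ?_)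
      ((Real.summable_pow_div_factorial (‖a‖ * D)).mul_right
        (∫ z, ‖pairDensity e f A B z‖ ∂(volume.prod volume)))
    rw [← integral_const_mul]
    exact integral_mono (hFint n).norm ((integrable_pairDensity e f hA hB).norm.const_mul _)
      (hFnorm n)
  have hsum := hasSum_integral_of_summable_integral_norm hFint hsummable
  have htsum : ∀ z, ∑' n, F n z =
      pairDensity e f A B z * Complex.exp (a * ((inner ℝ (z.2 - c) z.1 : ℝ) : ℂ)) := by
    intro z
    rw [Complex.exp_eq_exp_ℂ, NormedSpace.exp_eq_tsum_div, ← tsum_mul_left]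
    refine tsum_congr fun n ↦ ?_
    simp only [hF, mul_pow]
    ring
  simp_rw [htsum] at hsum
  rw [← hsum.tsum_eq]
  have hterm : ∀ n, ‖∫ z, F n z ∂(volume.prod volume)‖ ≤ (‖a‖ * D) ^ n / n.factorial *
      ((eLpNorm A 2 volume).toReal * (eLpNorm B 2 volume).toReal) := by
    intro n
    simp only [hF]
    rw [integral_const_mul, norm_mul, norm_div, norm_pow, Complex.norm_natCast, mul_pow,
      mul_div_right_comm, mul_assoc (‖a‖ ^ n / _)]
    gcongr
    exact (hpow n).2
  have hexp : HasSum (fun n ↦ (‖a‖ * D) ^ n / n.factorial *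
      ((eLpNorm A 2 volume).toReal * (eLpNorm B 2 volume).toReal)) (Real.exp (‖a‖ * D) *
      ((eLpNorm A 2 volume).toReal * (eLpNorm B 2 volume).toReal)) := by
    refine HasSum.mul_right _ ?_
    rw [Real.exp_eq_exp_ℝ]
    exact NormedSpace.expSeries_div_hasSum_exp (‖a‖ * D)
  exact tsum_of_norm_bounded hexp hterm

/-- The operator with kernel `A(ξ) exp(-2πi ⟨x, ξ⟩) B(x)` is nuclear when `A`, `B` are supported in
boxes. -/
theorem norm_integral_pairDensity_mul_fourier_le {e f : Fin N → L2Space d} (he : Orthonormal ℂ e)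
    (hf : Orthonormal ℂ f) (c : RSpace d) {M₁ M₂ : ℝ} (hM₁ : 0 ≤ M₁) (hM₂ : 0 ≤ M₂)
    {A B : RSpace d → ℂ} (hA : MemLp A 2) (hB : MemLp B 2) (hsA : ∀ ξ, A ξ ≠ 0 → ∀ j, |ξ j| ≤ M₁)
    (hsB : ∀ x, B x ≠ 0 → ∀ j, |x j - c j| ≤ M₂) :
    ‖∫ z, pairDensity e f A B z *
      Complex.exp (((-2 * Real.pi * (inner ℝ z.2 z.1 : ℝ) : ℝ) : ℂ) * Complex.I)
      ∂(volume.prod volume)‖ ≤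
      Real.exp (2 * Real.pi * (d * (M₁ * M₂))) *
        ((eLpNorm A 2 volume).toReal * (eLpNorm B 2 volume).toReal) := by
  -- Recentring `x` at `c` costs the phase `exp(-2πi⟨c,ξ⟩)`, which has modulus one and is absorbed
  -- into `A`.
  set χ : RSpace d → ℂ := fun ξ ↦
    Complex.exp (((-2 * Real.pi * (inner ℝ c ξ : ℝ) : ℝ) : ℂ) * Complex.I) with hχ
  have hχn : ∀ ξ, ‖χ ξ‖ = 1 := fun ξ ↦ Complex.norm_exp_ofReal_mul_I _
  have hχc : Continuous χ := by fun_prop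
  have hA' : MemLp (fun ξ ↦ χ ξ * A ξ) 2 :=
    hA.mono (hχc.aestronglyMeasurable.mul hA.1)
      (Filter.Eventually.of_forall fun ξ ↦ by rw [norm_mul, hχn, one_mul])
  have hn : eLpNorm (fun ξ ↦ χ ξ * A ξ) 2 volume = eLpNorm A 2 volume :=
    eLpNorm_congr_norm_ae (Filter.Eventually.of_forall fun ξ ↦ by rw [norm_mul, hχn, one_mul])
  have h := norm_integral_pairDensity_mul_exp_le he hf c hM₁ hM₂ hA' hB
    (fun ξ h ↦ hsA ξ (right_ne_zero_of_mul h)) hsB (-2 * Real.pi * Complex.I)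
  rw [hn] at h
  have ha : ‖(-2 * Real.pi * Complex.I : ℂ)‖ = 2 * Real.pi := by
    simp [abs_of_pos Real.pi_pos]
  rw [ha] at h
  refine le_trans (le_of_eq ?_) h
  congr 1
  refine integral_congr_ae (Filter.Eventually.of_forall fun z ↦ ?_)
  simp only [pairDensity, Finset.sum_mul]
  refine Finset.sum_congr rfl fun i _ ↦ ?_
  have : Complex.exp (((-2 * Real.pi * (inner ℝ z.2 z.1 : ℝ) : ℝ) : ℂ) * Complex.I) =
      χ z.1 * Complex.exp (-2 * Real.pi * Complex.I * ((inner ℝ (z.2 - c) z.1 : ℝ) : ℂ)) := by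
    rw [hχ, ← Complex.exp_add, inner_sub_left]
    congr 1
    push_cast
    ring
  rw [this]
  ring

end Nuclear

/-! ### Dyadic cubes and functions constant on them -/

section Dyadic

variable {d : ℕ}

/-- The index of the half-open dyadic cube of side `2^{-l}` that contains `x`. -/
noncomputable def dyadicIndex (l : ℕ) (x : RSpace d) : Fin d → ℤ := fun j ↦ ⌊(2 : ℝ) ^ l * x j⌋

/-- The half-open dyadic cube of side `2^{-l}` with index `n`. -/
noncomputable def dyadicCube (l : ℕ) (n : Fin d → ℤ) : Set (RSpace d) := dyadicIndex l ⁻¹' {n}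

theorem measurable_dyadicIndex (l : ℕ) : Measurable (dyadicIndex l : RSpace d → Fin d → ℤ) := by
  refine measurable_pi_lambda _ fun j ↦ ?_
  have h : Measurable fun x : RSpace d ↦ (2 : ℝ) ^ l * x j := by fun_prop
  exact Int.measurable_floor.comp h

theorem measurableSet_dyadicCube (l : ℕ) (n : Fin d → ℤ) : MeasurableSet (dyadicCube l n) :=
  measurable_dyadicIndex l (MeasurableSet.of_discrete)

/-- The cubes are nested because `⌊y / 2⌋` is the integer quotient of `⌊y⌋` by `2`. -/
theorem dyadicIndex_eq_of_succ {l : ℕ} {x y : RSpace d}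
    (h : dyadicIndex (l + 1) x = dyadicIndex (l + 1) y) : dyadicIndex l x = dyadicIndex l y := by
  have key : ∀ z : RSpace d, ∀ j, dyadicIndex l z j = dyadicIndex (l + 1) z j / (2 : ℕ) := by
    intro z j
    simp only [dyadicIndex]
    rw [← Int.floor_div_natCast]
    congr 1
    push_cast
    ring
  funext j
  rw [key, key, h]

theorem dyadicIndex_eq_of_le {l m : ℕ} (hlm : l ≤ m) {x y : RSpace d}
    (h : dyadicIndex m x = dyadicIndex m y) : dyadicIndex l x = dyadicIndex l y := by
  induction m, hlm using Nat.le_induction with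
  | base => exact h
  | succ m _ ih => exact ih (dyadicIndex_eq_of_succ h)

theorem dyadicCube_eq_preimage (l : ℕ) (n : Fin d → ℤ) : dyadicCube l n =
    (WithLp.ofLp : RSpace d → (Fin d → ℝ)) ⁻¹' (Set.univ.pi fun j ↦
      Set.Ico ((n j : ℝ) / 2 ^ l) (((n j : ℝ) + 1) / 2 ^ l)) := by
  ext x
  simp only [dyadicCube, Set.mem_preimage, Set.mem_singleton_iff, Set.mem_univ_pi, Set.mem_Ico,
    funext_iff, dyadicIndex]
  refine forall_congr' fun j ↦ ?_
  rw [Int.floor_eq_iff, div_le_iff₀' (by positivity), lt_div_iff₀' (by positivity)]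

theorem volume_dyadicCube (l : ℕ) (n : Fin d → ℤ) :
    volume (dyadicCube l n) = ENNReal.ofReal (((2 : ℝ) ^ l)⁻¹ ^ d) := by
  rw [dyadicCube_eq_preimage, (PiLp.volume_preserving_ofLp (Fin d)).measure_preimage
    (MeasurableSet.univ_pi fun j ↦ measurableSet_Ico).nullMeasurableSet, Real.volume_pi_Ico,
    ← ENNReal.ofReal_prod_of_nonneg]
  · congr 1
    rw [Finset.prod_congr rfl fun j _ ↦ ?_, Finset.prod_const, Finset.card_univ, Fintype.card_fin]
    field_simp
    ring
  · intro j _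
    have : (0 : ℝ) < 2 ^ l := by positivity
    rw [sub_nonneg]
    gcongr
    linarith

theorem iUnion_dyadicCube (l : ℕ) : ⋃ n, dyadicCube l n = (Set.univ : Set (RSpace d)) := by
  ext x; simp [dyadicCube]

theorem pairwise_disjoint_dyadicCube (l : ℕ) :
    Pairwise (Function.onFun Disjoint (dyadicCube l : (Fin d → ℤ) → Set (RSpace d))) := by
  intro m n hmn
  refine Set.disjoint_left.2 fun x hm hn ↦ hmn ?_
  exact (Set.mem_singleton_iff.1 hm).symm.trans (Set.mem_singleton_iff.1 hn)

/-- `u` is constant on the dyadic cubes of side `2^{-l}`. -/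
def IsDyadicStep (l : ℕ) (u : RSpace d → ℂ) : Prop :=
  ∀ x y, dyadicIndex l x = dyadicIndex l y → u x = u y

theorem IsDyadicStep.of_le {l m : ℕ} (hlm : l ≤ m) {u : RSpace d → ℂ} (h : IsDyadicStep l u) :
    IsDyadicStep m u := fun x y hxy ↦ h x y (dyadicIndex_eq_of_le hlm hxy)

/-- The half-density factor `2^{d/2}`. -/
noncomputable def dyadicBase (d : ℕ) : ℝ := √((2 : ℝ) ^ d)

theorem dyadicBase_pos (d : ℕ) : 0 < dyadicBase d := Real.sqrt_pos.2 (by positivity)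

theorem dyadicBase_sq (d : ℕ) : dyadicBase d ^ 2 = 2 ^ d := Real.sq_sqrt (by positivity)

theorem volume_dyadicCube' (l : ℕ) (n : Fin d → ℤ) :
    volume (dyadicCube l n) = ENNReal.ofReal (dyadicBase d ^ l)⁻¹ ^ 2 := by
  have := dyadicBase_pos d
  rw [volume_dyadicCube, ← ENNReal.ofReal_pow (by positivity), inv_pow, inv_pow,
    ← pow_mul (dyadicBase d), mul_comm l 2, pow_mul (dyadicBase d), dyadicBase_sq, ← pow_mul,
    ← pow_mul, mul_comm l d]

/-- On a set of measure `2^{-dl}` a constant has `L²` norm `2^{dl/2}` times its `L¹` norm. Thus the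
`L²` norms over all cubes, which nuclear bounds produce, add up to one `L¹` norm. -/
theorem IsDyadicStep.eLpNorm_indicator {l : ℕ} {h : RSpace d → ℂ} (hs : IsDyadicStep l h)
    (n : Fin d → ℤ) : eLpNorm ((dyadicCube l n).indicator h) 2 volume =
      ENNReal.ofReal (dyadicBase d ^ l) * ∫⁻ x in dyadicCube l n, ‖h x‖ₑ := by
  have hb := dyadicBase_pos d
  rcases (dyadicCube l n).eq_empty_or_nonempty with h0 | ⟨x₀, hx₀⟩
  · simp [h0]
  have hc : ∀ x ∈ dyadicCube l n, h x = h x₀ := fun x hx ↦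
    hs x x₀ ((Set.mem_singleton_iff.1 hx).trans (Set.mem_singleton_iff.1 hx₀).symm)
  have h1 : (dyadicCube l n).indicator h = (dyadicCube l n).indicator fun _ ↦ h x₀ :=
    Set.indicator_congr hc
  have h2 : ∫⁻ x in dyadicCube l n, ‖h x‖ₑ = ‖h x₀‖ₑ * volume (dyadicCube l n) := by
    rw [setLIntegral_congr_fun (measurableSet_dyadicCube l n)
      (fun x hx ↦ by simp only [hc x hx] : Set.EqOn _ (fun _ ↦ ‖h x₀‖ₑ) _), setLIntegral_const]
  rw [h1, eLpNorm_indicator_const (measurableSet_dyadicCube l n) two_ne_zero ENNReal.ofNat_ne_top,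
    h2, volume_dyadicCube', ← ENNReal.rpow_natCast, ← ENNReal.rpow_mul, mul_left_comm]
  congr 1
  rw [Nat.cast_ofNat, ENNReal.toReal_ofNat, mul_one_div, div_self two_ne_zero, ENNReal.rpow_one,
    ENNReal.rpow_ofNat, sq, ← mul_assoc, ← ENNReal.ofReal_mul (by positivity),
    mul_inv_cancel₀ (by positivity), ENNReal.ofReal_one, one_mul]

theorem IsDyadicStep.enorm_le {l : ℕ} {h : RSpace d → ℂ} (hs : IsDyadicStep l h) (x : RSpace d) :
    ‖h x‖ₑ ≤ ENNReal.ofReal (dyadicBase d ^ l) * eLpNorm h 2 volume := by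
  have hb := dyadicBase_pos d
  set n := dyadicIndex l x with hn
  have hc : ∀ y ∈ dyadicCube l n, h y = h x := fun y hy ↦ hs y x (Set.mem_singleton_iff.1 hy)
  have h1 : eLpNorm ((dyadicCube l n).indicator h) 2 volume ≤ eLpNorm h 2 volume :=
    eLpNorm_indicator_le h
  rw [hs.eLpNorm_indicator, setLIntegral_congr_fun (measurableSet_dyadicCube l n)
      (fun y hy ↦ by simp only [hc y hy] : Set.EqOn _ (fun _ ↦ ‖h x‖ₑ) _), setLIntegral_const,
      volume_dyadicCube'] at h1
  calc ‖h x‖ₑ = ENNReal.ofReal (dyadicBase d ^ l) * (ENNReal.ofReal (dyadicBase d ^ l) *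
        (‖h x‖ₑ * ENNReal.ofReal (dyadicBase d ^ l)⁻¹ ^ 2)) := by
        have : ENNReal.ofReal (dyadicBase d ^ l) * ENNReal.ofReal (dyadicBase d ^ l)⁻¹ = 1 := by
          rw [← ENNReal.ofReal_mul (by positivity), mul_inv_cancel₀ (by positivity),
            ENNReal.ofReal_one]
        calc ‖h x‖ₑ = (ENNReal.ofReal (dyadicBase d ^ l) * ENNReal.ofReal (dyadicBase d ^ l)⁻¹) ^ 2
              * ‖h x‖ₑ := by rw [this, one_pow, one_mul]
          _ = _ := by ring
    _ ≤ _ := by gcongr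

end Dyadic

/-! ### The nuclear estimate on one frequency shell -/

section ShellLow

variable {d N : ℕ}

theorem pairDensity_indicator (e f : Fin N → L2Space d) (A h : RSpace d → ℂ)
    (q : Set (RSpace d)) (z : RSpace d × RSpace d) :
    pairDensity e f A (q.indicator h) z = (Set.univ ×ˢ q).indicator (pairDensity e f A h) z := by
  classical
  by_cases hz : z.2 ∈ q <;> simp [pairDensity, Set.indicator, hz]

theorem integrable_pairDensity_mul_fourierKernel (e f : Fin N → L2Space d) {A B : RSpace d → ℂ}
    (hA : MemLp A 2) (hB : MemLp B 2) :
    Integrable (fun z ↦ pairDensity e f A B z *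
      Complex.exp (((-2 * Real.pi * (inner ℝ z.2 z.1 : ℝ) : ℝ) : ℂ) * Complex.I))
      (volume.prod volume) := by
  refine (integrable_pairDensity e f hA hB).mul_bdd (c := 1) ?_ ?_
  · exact Continuous.aestronglyMeasurable (by fun_prop)
  · exact Filter.Eventually.of_forall fun z ↦ (Complex.norm_exp_ofReal_mul_I _).le

theorem sum_integral_mul_fourier_eq (e f : Fin N → L2Space d) {A B : RSpace d → ℂ}
    (hA : MemLp A 2) (hB : MemLp B 2) :
    ∫ ξ, ∑ i, (starRingEnd ℂ) (f i ξ) * A ξ * 𝓕 (fun x ↦ B x * e i x) ξ =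
      ∫ z, pairDensity e f A B z *
        Complex.exp (((-2 * Real.pi * (inner ℝ z.2 z.1 : ℝ) : ℝ) : ℂ) * Complex.I)
      ∂(volume.prod volume) := by
  rw [integral_prod _ (integrable_pairDensity_mul_fourierKernel e f hA hB)]
  refine integral_congr_ae (Filter.Eventually.of_forall fun ξ ↦ ?_)
  simp only [pairDensity, Finset.sum_mul]
  rw [integral_finsetSum]
  · refine Finset.sum_congr rfl fun i _ ↦ ?_
    rw [Real.fourier_eq', ← integral_const_mul]
    refine integral_congr_ae (Filter.Eventually.of_forall fun x ↦ ?_)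
    simp only [smul_eq_mul]
    ring
  · intro i _
    refine ((memLp_two_mul_integrable hB (e i)).const_mul _).mul_bdd (c := 1) ?_ ?_
    · exact Continuous.aestronglyMeasurable (by fun_prop)
    · exact Filter.Eventually.of_forall fun z ↦ (Complex.norm_exp_ofReal_mul_I _).le

/-- Space is cut into cubes of side `2^{-l}`, dual to the frequencies `|ξ_j| ≤ 2^{l+1}`. The product
of the two sizes is `2` for every `l`, so the nuclear constant `exp(4πd)` does not depend on the
scale. -/
theorem IsDyadicStep.enorm_sum_integral_le {e f : Fin N → L2Space d} (he : Orthonormal ℂ e)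
    (hf : Orthonormal ℂ f) {l : ℕ} {A h : RSpace d → ℂ} (hs : IsDyadicStep l h)
    (hA : MemLp A 2) (hh : MemLp h 2) (hsA : ∀ ξ, A ξ ≠ 0 → ∀ j, |ξ j| ≤ 2 ^ (l + 1)) :
    ‖∫ ξ, ∑ i, (starRingEnd ℂ) (f i ξ) * A ξ * 𝓕 (fun x ↦ h x * e i x) ξ‖ₑ ≤
      ENNReal.ofReal (Real.exp (4 * Real.pi * d)) * eLpNorm A 2 volume *
        (ENNReal.ofReal (dyadicBase d ^ l) * ∫⁻ x, ‖h x‖ₑ) := by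
  rw [sum_integral_mul_fourier_eq e f hA hh]
  set Ψ : RSpace d × RSpace d → ℂ := fun z ↦ pairDensity e f A h z *
        Complex.exp (((-2 * Real.pi * (inner ℝ z.2 z.1 : ℝ) : ℝ) : ℂ) * Complex.I) with hΨ
  have hΨi : Integrable Ψ (volume.prod volume) := integrable_pairDensity_mul_fourierKernel e f hA hh
  have hm : ∀ n, MeasurableSet (Set.univ ×ˢ dyadicCube l n : Set (RSpace d × RSpace d)) :=
    fun n ↦ MeasurableSet.univ.prod (measurableSet_dyadicCube l n)
  have hU : ⋃ n, (Set.univ ×ˢ dyadicCube l n : Set (RSpace d × RSpace d)) = Set.univ := by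
    rw [← Set.prod_iUnion, iUnion_dyadicCube, Set.univ_prod_univ]
  have hsum : HasSum (fun n ↦ ∫ z in Set.univ ×ˢ dyadicCube l n, Ψ z ∂(volume.prod volume))
      (∫ z, Ψ z ∂(volume.prod volume)) := by
    have := hasSum_integral_iUnion (μ := (volume : Measure (RSpace d)).prod volume) hm
      (fun m n hmn ↦ Set.disjoint_prod.2 (Or.inr (pairwise_disjoint_dyadicCube l hmn)))
      hΨi.integrableOn
    rwa [hU, setIntegral_univ] at this
  have hterm : ∀ n, ‖∫ z in Set.univ ×ˢ dyadicCube l n, Ψ z ∂(volume.prod volume)‖ₑ ≤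
      ENNReal.ofReal (Real.exp (4 * Real.pi * d)) * eLpNorm A 2 volume *
        (ENNReal.ofReal (dyadicBase d ^ l) * ∫⁻ x in dyadicCube l n, ‖h x‖ₑ) := by
    intro n
    have hhn : MemLp ((dyadicCube l n).indicator h) 2 := hh.indicator (measurableSet_dyadicCube l n)
    -- The centre is the lower corner of the cube, from which every coordinate deviates by at most
    -- the side `2^{-l}`.
    have h1 := norm_integral_pairDensity_mul_fourier_le he hf
      (WithLp.toLp 2 fun j ↦ (n j : ℝ) / 2 ^ l) (M₁ := 2 ^ (l + 1)) (M₂ := ((2 : ℝ) ^ l)⁻¹)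
      (by positivity) (by positivity) hA hhn hsA (by
        intro x hx j
        have hx' : x ∈ dyadicCube l n := by
          by_contra hc
          exact hx (Set.indicator_of_notMem hc h)
        rw [dyadicCube_eq_preimage, Set.mem_preimage, Set.mem_univ_pi] at hx'
        have h2 := hx' j
        rw [Set.mem_Ico, add_div] at h2
        rw [PiLp.toLp_apply, abs_le, ← one_div]
        have : (0 : ℝ) < 1 / 2 ^ l := by positivity
        constructor <;> linarith [h2.1, h2.2])
    have h3 : ∫ z in Set.univ ×ˢ dyadicCube l n, Ψ z ∂(volume.prod volume) =
        ∫ z, pairDensity e f A ((dyadicCube l n).indicator h) z *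
        Complex.exp (((-2 * Real.pi * (inner ℝ z.2 z.1 : ℝ) : ℝ) : ℂ) * Complex.I)
        ∂(volume.prod volume) := by
      rw [← integral_indicator (hm n)]
      refine integral_congr_ae (Filter.Eventually.of_forall fun z ↦ ?_)
      simp only [pairDensity_indicator, hΨ]
      rw [Set.indicator_mul_left]
    have h4 : 2 * Real.pi * (d * ((2 : ℝ) ^ (l + 1) * ((2 : ℝ) ^ l)⁻¹)) = 4 * Real.pi * d := by
      rw [pow_succ]; field_simp; ring
    rw [h4, ← h3] at h1
    rw [← hs.eLpNorm_indicator, ← ofReal_norm, mul_assoc]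
    refine (ENNReal.ofReal_le_ofReal h1).trans (le_of_eq ?_)
    rw [ENNReal.ofReal_mul (by positivity), ENNReal.ofReal_mul ENNReal.toReal_nonneg,
      ENNReal.ofReal_toReal hA.2.ne, ENNReal.ofReal_toReal hhn.2.ne]
  rw [← hsum.tsum_eq]
  refine enorm_tsum_le_tsum_enorm.trans ((ENNReal.tsum_le_tsum hterm).trans (le_of_eq ?_))
  rw [ENNReal.tsum_mul_left, ENNReal.tsum_mul_left, ← lintegral_iUnion
    (fun n ↦ measurableSet_dyadicCube l n) (pairwise_disjoint_dyadicCube l), iUnion_dyadicCube,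
    setLIntegral_univ]

end ShellLow

/-! ### Geometric sums and optimisation of the parameter -/

section Elementary

theorem ENNReal.mul_le_mul_sq_add_inv_mul_sq {c : ℝ≥0∞} (hc0 : c ≠ 0) (hc : c ≠ ∞) (a b : ℝ≥0∞) :
    a * b ≤ c * a ^ 2 + c⁻¹ * b ^ 2 := by
  rcases le_total (c * a) b with h | h
  · refine le_add_left ?_
    have : a ≤ c⁻¹ * b := by
      rw [mul_comm, ← div_eq_mul_inv, ENNReal.le_div_iff_mul_le (Or.inl hc0) (Or.inl hc)]
      rwa [mul_comm]
    calc a * b ≤ c⁻¹ * b * b := by gcongr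
      _ = _ := by ring
  · refine le_add_right ?_
    calc a * b ≤ a * (c * a) := by gcongr
      _ = _ := by ring

/-- The geometric sum is dominated by its last term, which is below `a / t`; the factor is `β / (β -
1) ≤ 4`. The additional bound by `β ^ M` is carried along to absorb the newest term. -/
theorem sum_geometric_below_le {β : ℝ} (hβ : 4 / 3 ≤ β) {t a : ℝ} (ht : 0 < t) (ha : 0 ≤ a) (M : ℕ) :
    ∑ l ∈ Finset.range M, (if t * β ^ l < a then β ^ l else 0) ≤ 4 * (a / t) := by
  have hβ0 : 0 < β := by linarith
  have key : (β - 1) * ∑ l ∈ Finset.range M, (if t * β ^ l < a then β ^ l else 0) ≤ β ^ M ∧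
      (β - 1) * ∑ l ∈ Finset.range M, (if t * β ^ l < a then β ^ l else 0) ≤ β * (a / t) := by
    induction M with
    | zero => simp; positivity
    | succ M ih =>
      rw [Finset.sum_range_succ, mul_add]
      have hp : 0 < β ^ M := by positivity
      split_ifs with h
      · have h1 : β ^ M ≤ a / t := by rw [le_div_iff₀ ht]; linarith
        have h2 : (β - 1) * ∑ l ∈ Finset.range M, (if t * β ^ l < a then β ^ l else 0) +
            (β - 1) * β ^ M ≤ β * β ^ M := by linarith [ih.1]
        exact ⟨by rw [pow_succ']; exact h2, h2.trans (by gcongr)⟩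
      · have h3 : β ^ M ≤ β ^ (M + 1) := pow_le_pow_right₀ (by linarith) (Nat.le_succ M)
        constructor
        · linarith [ih.1]
        · linarith [ih.2]
  have h0 : 0 ≤ ∑ l ∈ Finset.range M, (if t * β ^ l < a then β ^ l else 0) :=
    Finset.sum_nonneg fun l _ ↦ by split_ifs <;> positivity
  have h1 : 0 ≤ a / t := by positivity
  nlinarith [key.2]

/-- The first nonzero term is at most `t²` and the ratio of successive terms is at most `1/2`. The
invariant of the induction is that the sum plus twice the next term stays below `2 t²`. -/
theorem sum_geometric_above_le {β : ℝ} (hβ : 0 < β) (hβ2 : 2 ≤ β ^ 2) {t a : ℝ} (ht : 0 < t)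
    (ha : 0 ≤ a) (M : ℕ) :
    ∑ l ∈ Finset.range M, (if t * β ^ l < a then 0 else a ^ 2 * ((β ^ l)⁻¹) ^ 2) ≤ 2 * t ^ 2 := by
  have hβ1 : 1 ≤ β := by nlinarith
  set s : ℕ → ℝ := fun M ↦
    ∑ l ∈ Finset.range M, (if t * β ^ l < a then 0 else a ^ 2 * ((β ^ l)⁻¹) ^ 2) with hs
  have hle : ∀ M, ¬ t * β ^ M < a → a ^ 2 * ((β ^ M)⁻¹) ^ 2 ≤ t ^ 2 := by
    intro M h
    rw [← mul_pow]
    refine pow_le_pow_left₀ (by positivity) ?_ 2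
    rw [← div_eq_mul_inv, div_le_iff₀ (by positivity)]
    linarith
  have key : ∀ M, (¬ t * β ^ M < a → s M + 2 * (a ^ 2 * ((β ^ M)⁻¹) ^ 2) ≤ 2 * t ^ 2) ∧
      (t * β ^ M < a → s M = 0) := by
    intro M
    induction M with
    | zero =>
      refine ⟨fun h ↦ ?_, fun _ ↦ by simp [hs]⟩
      have := hle 0 h
      simp only [hs, Finset.range_zero, Finset.sum_empty]
      linarith
    | succ M ih =>
      have hsucc : s (M + 1) = s M + (if t * β ^ M < a then 0 else a ^ 2 * ((β ^ M)⁻¹) ^ 2) :=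
        Finset.sum_range_succ _ _
      have hmono : t * β ^ M ≤ t * β ^ (M + 1) := by
        gcongr
        exact Nat.le_succ M
      rw [hsucc]
      by_cases h : t * β ^ M < a
      · rw [if_pos h, add_zero, ih.2 h]
        refine ⟨fun h' ↦ ?_, fun _ ↦ rfl⟩
        have := hle (M + 1) h'
        linarith
      · rw [if_neg h]
        refine ⟨fun _ ↦ ?_, fun h' ↦ absurd (hmono.trans_lt h') h⟩
        have h1 := ih.1 h
        have h2 : 2 * (a ^ 2 * ((β ^ (M + 1))⁻¹) ^ 2) ≤ a ^ 2 * ((β ^ M)⁻¹) ^ 2 := by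
          have h3 : ((β ^ (M + 1))⁻¹) ^ 2 * 2 ≤ ((β ^ M)⁻¹) ^ 2 := by
            rw [pow_succ β, mul_inv, mul_pow, mul_assoc]
            refine mul_le_of_le_one_right (by positivity) ?_
            rw [inv_pow, inv_mul_le_iff₀ (by positivity)]
            linarith
          nlinarith [sq_nonneg a]
        linarith
  by_cases h : t * β ^ M < a
  · change s M ≤ _
    rw [(key M).2 h]; positivity
  · have := (key M).1 h
    have h2 : 0 ≤ 2 * (a ^ 2 * ((β ^ M)⁻¹) ^ 2) := by positivity
    change s M ≤ _
    linarith

/-- For `Y > 0` the choice `t = Y / √N` balances the two terms; for `Y = 0` let `t` tend to zero. -/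
theorem KyFanBound.of_forall_pos {H H' : Type*} [NormedAddCommGroup H] [InnerProductSpace ℂ H]
    [NormedAddCommGroup H'] [InnerProductSpace ℂ H'] {T : H →L[ℂ] H'} {C Y : ℝ} (hC : 0 ≤ C)
    (hY : 0 ≤ Y) (h : ∀ (N : ℕ) (e : Fin N → H) (f : Fin N → H'), Orthonormal ℂ e →
      Orthonormal ℂ f → ∀ t : ℝ, 0 < t → ‖∑ i, inner ℂ (f i) (T (e i))‖ ≤
        C * (t * N + Y ^ 2 / t)) : KyFanBound T (2 * C * Y) := by
  intro N e f he hf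
  rcases Nat.eq_zero_or_pos N with rfl | hN
  · simp
  have hN' : (0 : ℝ) < N := Nat.cast_pos.2 hN
  have hs := Real.sqrt_pos.2 hN'
  rcases hY.eq_or_lt with h0 | h0
  · rw [← h0]
    simp only [mul_zero]
    refine le_of_forall_pos_le_add fun ε hε ↦ ?_
    have h1 := h N e f he hf (ε / ((C + 1) * N)) (by positivity)
    rw [← h0] at h1
    refine h1.trans ?_
    have : C * (ε / ((C + 1) * N) * N + 0 ^ 2 / (ε / ((C + 1) * N))) = C / (C + 1) * ε := by
      field_simp
      ring
    rw [this, zero_add]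
    refine mul_le_of_le_one_left hε.le ?_
    rw [div_le_one (by positivity)]
    linarith
  · refine (h N e f he hf (Y / √N) (by positivity)).trans (le_of_eq ?_)
    have h2 : (N : ℝ) = √N * √N := (Real.mul_self_sqrt hN'.le).symm
    have h3 : Y / √N * N = √N * Y := by
      nth_rewrite 2 [h2]; field_simp
    have h4 : Y ^ 2 / (Y / √N) = √N * Y := by field_simp
    rw [h3, h4]; ring

end Elementary

/-! ### Hilbert-Schmidt bounds -/

section HilbertSchmidt

variable {d N : ℕ}

theorem sum_inner_eq_integral {g : RSpace d → ℝ} {w : RSpace d → ℂ} {G : L2Space d →L[ℂ] L2Space d}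
    (hG : HasFourierKernel g w G) (e f : Fin N → L2Space d) :
    Integrable (fun ξ ↦ ∑ i, (starRingEnd ℂ) (f i ξ) * (g ξ : ℂ) * 𝓕 (fun x ↦ w x * e i x) ξ) ∧
    ∑ i, inner ℂ (f i) (G (e i)) =
      ∫ ξ, ∑ i, (starRingEnd ℂ) (f i ξ) * (g ξ : ℂ) * 𝓕 (fun x ↦ w x * e i x) ξ := by
  have h1 : ∀ i, (fun ξ ↦ (starRingEnd ℂ) (f i ξ) * G (e i) ξ) =ᵐ[volume]
      fun ξ ↦ (starRingEnd ℂ) (f i ξ) * (g ξ : ℂ) * 𝓕 (fun x ↦ w x * e i x) ξ := fun i ↦ by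
    filter_upwards [hG (e i)] with ξ hξ
    rw [hξ, mul_assoc]
  have h2 : ∀ i, Integrable fun ξ ↦
      (starRingEnd ℂ) (f i ξ) * (g ξ : ℂ) * 𝓕 (fun x ↦ w x * e i x) ξ := fun i ↦
    (integrable_conj_mul (f i) (Lp.memLp (G (e i)))).congr (h1 i)
  refine ⟨integrable_finsetSum _ fun i _ ↦ h2 i, ?_⟩
  rw [integral_finsetSum _ fun i _ ↦ h2 i]
  refine Finset.sum_congr rfl fun i _ ↦ ?_
  rw [← integral_congr_ae (h1 i), ← inner_toLp_eq_integral _ (Lp.memLp (G (e i))), Lp.toLp_coeFn]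

/-- For fixed `ξ` the Fourier integral of `w e_i` pairs `e_i` with a single function of modulus
`|w|`, so Bessel's inequality applies. -/
theorem sum_enorm_fourier_sq_le {e : Fin N → L2Space d} (he : Orthonormal ℂ e)
    {w : RSpace d → ℂ} (hw : MemLp w 2) (ξ : RSpace d) :
    ∑ i, ‖𝓕 (fun x ↦ w x * e i x) ξ‖ₑ ^ 2 ≤ eLpNorm w 2 volume ^ 2 := by
  set χ : RSpace d → ℂ := fun x ↦
    Complex.exp (((-2 * Real.pi * (inner ℝ x ξ : ℝ) : ℝ) : ℂ) * Complex.I) with hχ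
  have hχn : ∀ x, ‖χ x‖ = 1 := fun x ↦ Complex.norm_exp_ofReal_mul_I _
  have hχc : Continuous χ := by fun_prop
  have hB : MemLp (fun x ↦ χ x * w x) 2 :=
    hw.mono (hχc.aestronglyMeasurable.mul hw.1)
      (Filter.Eventually.of_forall fun ξ ↦ by rw [norm_mul, hχn, one_mul])
  have hn : eLpNorm (fun x ↦ χ x * w x) 2 volume = eLpNorm w 2 volume :=
    eLpNorm_congr_norm_ae (Filter.Eventually.of_forall fun ξ ↦ by rw [norm_mul, hχn, one_mul])
  have h := ENNReal.ofReal_le_ofReal (sum_norm_integral_mul_sq_le he hB)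
  rw [hn, ENNReal.ofReal_pow ENNReal.toReal_nonneg, ENNReal.ofReal_toReal hw.2.ne,
    ENNReal.ofReal_sum_of_nonneg fun i _ ↦ by positivity] at h
  refine le_trans (le_of_eq (Finset.sum_congr rfl fun i _ ↦ ?_)) h
  rw [ENNReal.ofReal_pow (norm_nonneg _), ofReal_norm, Real.fourier_eq']
  congr 3 with x
  rw [smul_eq_mul, ← mul_assoc]

theorem sum_lintegral_enorm_sq_eq {f : Fin N → L2Space d} (hf : Orthonormal ℂ f) :
    ∑ i, ∫⁻ ξ, ‖f i ξ‖ₑ ^ 2 = N := by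
  have : ∀ i, ∫⁻ ξ, ‖f i ξ‖ₑ ^ 2 = 1 := fun i ↦ by
    rw [lintegral_enorm_sq_coeFn, ← ofReal_norm, hf.1 i]; simp
  simp [this]

theorem aemeasurable_enorm_coeFn (f : L2Space d) (s : Set (RSpace d)) :
    AEMeasurable (fun ξ ↦ ‖f ξ‖ₑ) (volume.restrict s) :=
  (Lp.aestronglyMeasurable f).enorm.restrict

/-- Each product is split as `a b ≤ t a² + b² / t`. The parameter `t` is kept free, and the estimate
is localised to `s`, so that it can be balanced later against the remaining frequencies. -/
theorem lintegral_sum_le_of_hilbertSchmidt {e f : Fin N → L2Space d} (he : Orthonormal ℂ e)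
    (hf : Orthonormal ℂ f) {g : RSpace d → ℝ} (hg : Measurable g) {w : RSpace d → ℂ}
    (hw : MemLp w 2) (s : Set (RSpace d)) {t : ℝ} (ht : 0 < t) :
    ∫⁻ ξ in s, ‖∑ i, (starRingEnd ℂ) (f i ξ) * (g ξ : ℂ) * 𝓕 (fun x ↦ w x * e i x) ξ‖ₑ ≤
      ENNReal.ofReal t * N +
        (ENNReal.ofReal t)⁻¹ * ((∫⁻ ξ in s, ‖g ξ‖ₑ ^ 2) * eLpNorm w 2 volume ^ 2) := by
  have ht0 : ENNReal.ofReal t ≠ 0 := by simpa using ht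
  have hpt : ∀ ξ, ‖∑ i, (starRingEnd ℂ) (f i ξ) * (g ξ : ℂ) * 𝓕 (fun x ↦ w x * e i x) ξ‖ₑ ≤
      (∑ i, ENNReal.ofReal t * ‖f i ξ‖ₑ ^ 2) +
        (ENNReal.ofReal t)⁻¹ * (‖g ξ‖ₑ ^ 2 * eLpNorm w 2 volume ^ 2) := by
    intro ξ
    refine (enorm_sum_le _ _).trans ?_
    calc ∑ i, ‖(starRingEnd ℂ) (f i ξ) * (g ξ : ℂ) * 𝓕 (fun x ↦ w x * e i x) ξ‖ₑ
        ≤ ∑ i, (ENNReal.ofReal t * ‖f i ξ‖ₑ ^ 2 +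
          (ENNReal.ofReal t)⁻¹ * (‖g ξ‖ₑ ^ 2 * ‖𝓕 (fun x ↦ w x * e i x) ξ‖ₑ ^ 2)) := by
          refine Finset.sum_le_sum fun i _ ↦ ?_
          have h1 : ‖(starRingEnd ℂ) (f i ξ)‖ₑ = ‖f i ξ‖ₑ := by
            rw [← ofReal_norm, ← ofReal_norm, RCLike.norm_conj]
          have h2 : ‖(g ξ : ℂ)‖ₑ = ‖g ξ‖ₑ := by
            rw [← ofReal_norm, ← ofReal_norm, Complex.norm_real]
          rw [mul_assoc, enorm_mul, enorm_mul, h1, h2, ← mul_pow]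
          exact ENNReal.mul_le_mul_sq_add_inv_mul_sq ht0 ENNReal.ofReal_ne_top _ _
      _ ≤ _ := by
          rw [Finset.sum_add_distrib, ← Finset.mul_sum _ _ (ENNReal.ofReal t)⁻¹, ← Finset.mul_sum,
            ← Finset.mul_sum]
          gcongr
          exact sum_enorm_fourier_sq_le he hw ξ
  refine (lintegral_mono hpt).trans ?_
  have hgm : Measurable fun ξ ↦ ‖g ξ‖ₑ ^ 2 := hg.enorm.pow_const 2
  rw [lintegral_add_right _ ((hgm.mul_const _).const_mul _)]
  refine add_le_add ?_ ?_
  · rw [lintegral_finsetSum' _ fun i _ ↦ ((aemeasurable_enorm_coeFn (f i) s).pow_const 2).const_mul _]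
    calc ∑ i, ∫⁻ ξ in s, ENNReal.ofReal t * ‖f i ξ‖ₑ ^ 2
        ≤ ∑ i, ENNReal.ofReal t * ∫⁻ ξ, ‖f i ξ‖ₑ ^ 2 := by
          refine Finset.sum_le_sum fun i _ ↦ ?_
          rw [lintegral_const_mul' _ _ ENNReal.ofReal_ne_top]
          exact mul_le_mul_right (setLIntegral_le_lintegral _ _) _
      _ = _ := by rw [← Finset.mul_sum, sum_lintegral_enorm_sq_eq hf]
  · rw [lintegral_const_mul _ (hgm.mul_const _), lintegral_mul_const _ hgm]

/-- If the symbol is square integrable, the operator is Hilbert-Schmidt. -/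
theorem exists_hasFourierKernel_of_memLp {g : RSpace d → ℝ} (hg : Measurable g) (hg2 : MemLp g 2)
    {w : RSpace d → ℂ} (hw : MemLp w 2) :
    ∃ G : L2Space d →L[ℂ] L2Space d, HasFourierKernel g w G ∧
      KyFanBound G (2 * ((eLpNorm g 2 volume).toReal * (eLpNorm w 2 volume).toReal)) := by
  set a := (eLpNorm g 2 volume).toReal with ha
  set b := (eLpNorm w 2 volume).toReal with hb
  have ha' : eLpNorm g 2 volume = ENNReal.ofReal a := (ENNReal.ofReal_toReal hg2.2.ne).symm
  have hb' : eLpNorm w 2 volume = ENNReal.ofReal b := (ENNReal.ofReal_toReal hw.2.ne).symm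
  have ha0 : 0 ≤ a := ENNReal.toReal_nonneg
  have hb0 : 0 ≤ b := ENNReal.toReal_nonneg
  obtain ⟨G, hG⟩ := exists_hasFourierKernel hg hw (C := a * b) (by positivity) fun f ↦ by
    have h1 : ∀ ξ, ‖(g ξ : ℂ) * 𝓕 (fun x ↦ w x * f x) ξ‖ₑ ^ 2 ≤
        ‖g ξ‖ₑ ^ 2 * (eLpNorm w 2 volume * ‖f‖ₑ) ^ 2 := by
      intro ξ
      rw [enorm_mul, mul_pow]
      have h2 : ‖(g ξ : ℂ)‖ₑ = ‖g ξ‖ₑ := by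
        rw [← ofReal_norm, ← ofReal_norm, Complex.norm_real]
      rw [h2]
      gcongr
      refine (enorm_fourier_le_lintegral_enorm _ ξ).trans ?_
      rw [Lp.enorm_def]
      exact lintegral_enorm_mul_le hw.1 (Lp.aestronglyMeasurable f)
    refine (lintegral_mono h1).trans (le_of_eq ?_)
    rw [lintegral_mul_const _ (hg.enorm.pow_const 2), lintegral_enorm_sq_eq_eLpNorm_sq, ha', hb',
      ← ofReal_norm, ← mul_pow, ← ENNReal.ofReal_mul hb0, ← ENNReal.ofReal_mul ha0,
      ENNReal.ofReal_pow (by positivity), mul_assoc]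
  refine ⟨G, hG, ?_⟩
  have := KyFanBound.of_forall_pos (T := G) (C := 1) (Y := a * b) zero_le_one (by positivity) ?_
  · simpa using this
  intro N e f he hf t ht
  obtain ⟨hint, heq⟩ := sum_inner_eq_integral hG e f
  rw [heq]
  have h1 := lintegral_sum_le_of_hilbertSchmidt he hf hg hw Set.univ ht
  rw [setLIntegral_univ, setLIntegral_univ, lintegral_enorm_sq_eq_eLpNorm_sq, ha', hb', ← mul_pow,
    ← ENNReal.ofReal_mul ha0, ← ENNReal.ofReal_pow (by positivity), ← ENNReal.ofReal_inv_of_pos ht,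
    ← ENNReal.ofReal_mul (by positivity), ← ENNReal.ofReal_natCast, ← ENNReal.ofReal_mul ht.le,
    ← ENNReal.ofReal_add (by positivity) (by positivity)] at h1
  have h2 := (enorm_integral_le_lintegral_enorm _).trans h1
  rw [← ofReal_norm, ENNReal.ofReal_le_ofReal_iff (by positivity)] at h2
  rw [one_mul, div_eq_inv_mul]
  exact h2

end HilbertSchmidt

/-! ### The critical symbol acting on dyadic step functions -/

section Critical

variable {d N : ℕ}

/-- The dyadic shell `2^l ≤ |ξ| < 2^{l+1}`. -/
def dyadicShell (d l : ℕ) : Set (RSpace d) := {ξ | 2 ^ l ≤ ‖ξ‖ ∧ ‖ξ‖ < 2 ^ (l + 1)}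

theorem measurableSet_dyadicShell (l : ℕ) : MeasurableSet (dyadicShell d l) :=
  (measurableSet_le measurable_const measurable_norm).inter
    (measurableSet_lt measurable_norm measurable_const)

theorem pairwise_disjoint_dyadicShell :
    Pairwise (Function.onFun Disjoint (dyadicShell d)) := by
  have h : ∀ m n, m < n → Disjoint (dyadicShell d m) (dyadicShell d n) := by
    intro m n hmn
    refine Set.disjoint_left.2 fun ξ hm hn ↦ ?_
    have : (2 : ℝ) ^ (m + 1) ≤ 2 ^ n := pow_le_pow_right₀ one_le_two hmn
    linarith [hm.2, hn.1]
  intro m n hmn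
  rcases lt_or_gt_of_ne hmn with hlt | hlt
  · exact h m n hlt
  · exact (h n m hlt).symm

theorem iUnion_dyadicShell (L : ℕ) :
    ⋃ k, dyadicShell d (L + k) = (Metric.ball (0 : RSpace d) (2 ^ L))ᶜ := by
  ext ξ
  simp only [Set.mem_iUnion, Set.mem_compl_iff, Metric.mem_ball, dist_zero_right, not_lt]
  constructor
  · rintro ⟨k, hk⟩
    exact (pow_le_pow_right₀ one_le_two (Nat.le_add_right L k)).trans hk.1
  · intro h
    have h1 : (1 : ℝ) ≤ ‖ξ‖ := (one_le_pow₀ one_le_two).trans h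
    obtain ⟨n, hn1, hn2⟩ := exists_nat_pow_near h1 one_lt_two
    have hLn : L ≤ n := by
      by_contra hc
      have : (2 : ℝ) ^ (n + 1) ≤ 2 ^ L := pow_le_pow_right₀ one_le_two (by omega)
      linarith
    obtain ⟨k, rfl⟩ := Nat.exists_eq_add_of_le hLn
    exact ⟨k, hn1, hn2⟩

/-- Symbols of size `|ξ|^{-d/2}` at infinity. -/
structure IsCriticalSymbol (g : RSpace d → ℝ) (C : ℝ≥0) : Prop where
  measurable : Measurable g
  abs_le_one : ∀ ξ, |g ξ| ≤ 1
  decay : ∀ (l : ℕ) (ξ : RSpace d), 2 ^ l ≤ ‖ξ‖ → |g ξ| ≤ C * (dyadicBase d ^ l)⁻¹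
  ball : ∫⁻ ξ in Metric.ball 0 1, ‖g ξ‖ₑ ^ 2 ≤ (C : ℝ≥0∞) ^ 2
  shell : ∀ l, ∫⁻ ξ in dyadicShell d l, ‖g ξ‖ₑ ^ 2 ≤ (C : ℝ≥0∞) ^ 2

variable {g : RSpace d → ℝ} {C : ℝ≥0}

/-- The unit ball and each of the `L` shells contribute at most `C²`. This logarithmic growth is the
origin of the factor `√(L+1)`. -/
theorem IsCriticalSymbol.lintegral_ball_le (hg : IsCriticalSymbol g C) (L : ℕ) :
    ∫⁻ ξ in Metric.ball 0 (2 ^ L), ‖g ξ‖ₑ ^ 2 ≤ (L + 1) * (C : ℝ≥0∞) ^ 2 := by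
  induction L with
  | zero => simpa using hg.ball
  | succ L ih =>
    have hsub : Metric.ball (0 : RSpace d) (2 ^ (L + 1)) ⊆ Metric.ball 0 (2 ^ L) ∪ dyadicShell d L := by
      intro ξ hξ
      rw [Metric.mem_ball, dist_zero_right] at hξ
      by_cases h : ‖ξ‖ < 2 ^ L
      · left; simpa using h
      · right; exact ⟨not_lt.1 h, hξ⟩
    refine (lintegral_mono_set hsub).trans ((lintegral_union_le _ _ _).trans ?_)
    refine (add_le_add ih (hg.shell L)).trans (le_of_eq ?_)
    push_cast
    ring

theorem enorm_ofReal_complex (r : ℝ) : ‖(r : ℂ)‖ₑ = ‖r‖ₑ := by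
  rw [← ofReal_norm, ← ofReal_norm, Complex.norm_real]

theorem enorm_conj_complex (z : ℂ) : ‖(starRingEnd ℂ) z‖ₑ = ‖z‖ₑ := by
  rw [← ofReal_norm, ← ofReal_norm, RCLike.norm_conj]

theorem IsCriticalSymbol.memLp_shell (hg : IsCriticalSymbol g C) (l : ℕ) :
    MemLp ((dyadicShell d l).indicator fun ξ ↦ (g ξ : ℂ)) 2 volume ∧
      eLpNorm ((dyadicShell d l).indicator fun ξ ↦ (g ξ : ℂ)) 2 volume ≤ C := by
  have hm := (Complex.measurable_ofReal.comp hg.measurable).aestronglyMeasurable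
    (μ := (volume : Measure (RSpace d)))
  have h1 : eLpNorm ((dyadicShell d l).indicator fun ξ ↦ (g ξ : ℂ)) 2 volume ≤ C := by
    rw [eLpNorm_indicator_eq_eLpNorm_restrict (measurableSet_dyadicShell l)]
    have h2 := hg.shell l
    have h3 : ∫⁻ ξ in dyadicShell d l, ‖g ξ‖ₑ ^ 2 = ∫⁻ ξ in dyadicShell d l, ‖(g ξ : ℂ)‖ₑ ^ 2 := by
      simp_rw [enorm_ofReal_complex]
    rw [h3, lintegral_enorm_sq_eq_eLpNorm_sq] at h2
    exact (ENNReal.pow_le_pow_left_iff two_ne_zero).1 h2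
  exact ⟨⟨hm.indicator (measurableSet_dyadicShell l), h1.trans_lt ENNReal.coe_lt_top⟩, h1⟩

theorem integrable_sum_conj_mul_fourier (e f : Fin N → L2Space d) {A w : RSpace d → ℂ}
    (hA : MemLp A 2) (hw : MemLp w 2) :
    Integrable fun ξ ↦ ∑ i, (starRingEnd ℂ) (f i ξ) * A ξ * 𝓕 (fun x ↦ w x * e i x) ξ := by
  refine integrable_finsetSum _ fun i _ ↦ ?_
  have hi := memLp_two_mul_integrable hw (e i)
  refine (integrable_conj_mul (f i) hA).mul_bdd (c := ∫ x, ‖w x * e i x‖)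
    (continuous_fourier_of_integrable hi).aestronglyMeasurable ?_
  exact Filter.Eventually.of_forall fun ξ ↦ norm_fourier_le_integral_norm _ ξ

theorem memLp_bounded_mul_coeFn {h : RSpace d → ℂ} (hh : AEStronglyMeasurable h volume) {M : ℝ}
    (hM : ∀ x, ‖h x‖ ≤ M) (e : L2Space d) : MemLp (fun x ↦ h x * e x) 2 := by
  refine ((Lp.memLp e).const_mul (M : ℂ)).mono (hh.mul (Lp.aestronglyMeasurable e))
    (Filter.Eventually.of_forall fun x ↦ ?_)
  rw [norm_mul, norm_mul, Complex.norm_real]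
  gcongr
  exact (hM x).trans (le_abs_self M)

/-- On the shell `|g| ≤ C 2^{-dl/2}`, and Plancherel replaces the transform of `h e_i` by `h e_i`
itself. The bound `M` enters only to ensure that `h e_i` is in `L²`. -/
theorem IsCriticalSymbol.enorm_integral_shell_high_le (hg : IsCriticalSymbol g C) (l : ℕ)
    (e f : Fin N → L2Space d) {h : RSpace d → ℂ} (hh : MemLp h 2) {M : ℝ} (hM : ∀ x, ‖h x‖ ≤ M)
    {t : ℝ} (ht : 0 < t) :
    ‖∫ ξ, ∑ i, (starRingEnd ℂ) (f i ξ) * ((dyadicShell d l).indicator (fun ξ ↦ (g ξ : ℂ)) ξ) *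
      𝓕 (fun x ↦ h x * e i x) ξ‖ₑ ≤
      C * (ENNReal.ofReal t * (∑ i, ∫⁻ ξ in dyadicShell d l, ‖f i ξ‖ₑ ^ 2) +
        (ENNReal.ofReal t)⁻¹ *
          ∑ i, ENNReal.ofReal (dyadicBase d ^ l)⁻¹ ^ 2 * ∫⁻ x, ‖h x * e i x‖ₑ ^ 2) := by
  have ht0 : ENNReal.ofReal t ≠ 0 := by simpa using ht
  have hS := measurableSet_dyadicShell (d := d) l
  set b := ENNReal.ofReal (dyadicBase d ^ l)⁻¹ with hb
  have hpt : ∀ ξ, ‖∑ i, (starRingEnd ℂ) (f i ξ) *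
      ((dyadicShell d l).indicator (fun ξ ↦ (g ξ : ℂ)) ξ) * 𝓕 (fun x ↦ h x * e i x) ξ‖ₑ ≤
      ∑ i, C * (ENNReal.ofReal t * (dyadicShell d l).indicator (fun ξ ↦ ‖f i ξ‖ₑ ^ 2) ξ +
        (ENNReal.ofReal t)⁻¹ * (b ^ 2 * ‖𝓕 (fun x ↦ h x * e i x) ξ‖ₑ ^ 2)) := by
    intro ξ
    refine (enorm_sum_le _ _).trans (Finset.sum_le_sum fun i _ ↦ ?_)
    by_cases hξ : ξ ∈ dyadicShell d l
    · rw [Set.indicator_of_mem hξ, Set.indicator_of_mem hξ, enorm_mul, enorm_mul,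
        enorm_conj_complex, enorm_ofReal_complex]
      have h1 : ‖g ξ‖ₑ ≤ C * b := by
        rw [← ofReal_norm, Real.norm_eq_abs, ← ENNReal.ofReal_coe_nnreal, hb,
          ← ENNReal.ofReal_mul C.coe_nonneg]
        exact ENNReal.ofReal_le_ofReal (hg.decay l ξ hξ.1)
      calc ‖f i ξ‖ₑ * ‖g ξ‖ₑ * ‖𝓕 (fun x ↦ h x * e i x) ξ‖ₑ
          ≤ ‖f i ξ‖ₑ * (C * b) * ‖𝓕 (fun x ↦ h x * e i x) ξ‖ₑ := by gcongr
        _ = C * (‖f i ξ‖ₑ * (b * ‖𝓕 (fun x ↦ h x * e i x) ξ‖ₑ)) := by ring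
        _ ≤ _ := by
          rw [← mul_pow]
          gcongr
          exact ENNReal.mul_le_mul_sq_add_inv_mul_sq ht0 ENNReal.ofReal_ne_top _ _
    · simp [Set.indicator_of_notMem hξ]
  have hi : ∀ i, Integrable fun x ↦ h x * e i x := fun i ↦ memLp_two_mul_integrable hh (e i)
  have hF : ∀ i, Measurable fun ξ ↦ ‖𝓕 (fun x ↦ h x * e i x) ξ‖ₑ ^ 2 := fun i ↦
    (continuous_fourier_of_integrable (hi i)).measurable.enorm.pow_const 2
  have hfm : ∀ i, AEMeasurable (fun ξ ↦ ‖f i ξ‖ₑ ^ 2) (volume : Measure (RSpace d)) := fun i ↦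
    (Lp.aestronglyMeasurable (f i)).enorm.pow_const 2
  have hfi := fun i ↦ (hfm i).indicator hS
  refine (enorm_integral_le_lintegral_enorm _).trans ((lintegral_mono hpt).trans (le_of_eq ?_))
  have haem : ∀ i, AEMeasurable (fun ξ ↦ C * (ENNReal.ofReal t *
      (dyadicShell d l).indicator (fun ξ ↦ ‖f i ξ‖ₑ ^ 2) ξ +
        (ENNReal.ofReal t)⁻¹ * (b ^ 2 * ‖𝓕 (fun x ↦ h x * e i x) ξ‖ₑ ^ 2)))
      (volume : Measure (RSpace d)) := fun i ↦
    (((hfi i).const_mul _).add (((hF i).const_mul _).const_mul _).aemeasurable).const_mul _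
  rw [lintegral_finsetSum' _ fun i _ ↦ haem i, Finset.mul_sum, Finset.mul_sum,
    ← Finset.sum_add_distrib, Finset.mul_sum]
  refine Finset.sum_congr rfl fun i _ ↦ ?_
  rw [lintegral_const_mul' _ _ ENNReal.coe_ne_top,
    lintegral_add_right _ (((hF i).const_mul _).const_mul _),
    lintegral_const_mul' _ _ ENNReal.ofReal_ne_top, lintegral_indicator hS,
    lintegral_const_mul _ ((hF i).const_mul _), lintegral_const_mul _ (hF i),
    lintegral_enorm_fourier_sq (hi i) (memLp_bounded_mul_coeFn hh.1 hM (e i))]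

/-- `u` is split at height `t 2^{dl/2}`: the nuclear bound handles the large values and Plancherel
the small ones. With this threshold, each of the two contributions of `u` forms a geometric series
in `l` at a fixed point. -/
theorem IsCriticalSymbol.enorm_integral_shell_le (hg : IsCriticalSymbol g C) {l : ℕ}
    {e f : Fin N → L2Space d} (he : Orthonormal ℂ e) (hf : Orthonormal ℂ f) {u : RSpace d → ℂ}
    (hum : Measurable u) (hu : MemLp u 2) (hs : IsDyadicStep l u) {t : ℝ} (ht : 0 < t) :
    ‖∫ ξ in dyadicShell d l, ∑ i, (starRingEnd ℂ) (f i ξ) * (g ξ : ℂ) *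
      𝓕 (fun x ↦ u x * e i x) ξ‖ₑ ≤
      ENNReal.ofReal (Real.exp (4 * Real.pi * d)) * C * (ENNReal.ofReal (dyadicBase d ^ l) *
        ∫⁻ x in {x | t * dyadicBase d ^ l < ‖u x‖}, ‖u x‖ₑ) +
      C * (ENNReal.ofReal t * (∑ i, ∫⁻ ξ in dyadicShell d l, ‖f i ξ‖ₑ ^ 2) +
        (ENNReal.ofReal t)⁻¹ * ∑ i, ENNReal.ofReal (dyadicBase d ^ l)⁻¹ ^ 2 *
          ∫⁻ x in {x | t * dyadicBase d ^ l < ‖u x‖}ᶜ, ‖u x * e i x‖ₑ ^ 2) := by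
  set A := (dyadicShell d l).indicator fun ξ ↦ (g ξ : ℂ) with hAdef
  obtain ⟨hA, hAC⟩ := hg.memLp_shell l
  rw [← hAdef] at hA hAC
  set E : Set (RSpace d) := {x | t * dyadicBase d ^ l < ‖u x‖} with hE
  have hEm : MeasurableSet E := measurableSet_lt measurable_const hum.norm
  have hu1 : MemLp (E.indicator u) 2 := hu.indicator hEm
  have hu2 : MemLp (Eᶜ.indicator u) 2 := hu.indicator hEm.compl
  -- A superlevel set of a step function is a union of cubes, so truncation preserves the step
  -- property.
  have hs1 : IsDyadicStep l (E.indicator u) := by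
    intro x y hxy
    have h := hs x y hxy
    simp only [Set.indicator, hE, Set.mem_ofPred_eq, h]
  have hb := dyadicBase_pos d
  have hM : ∀ x, ‖Eᶜ.indicator u x‖ ≤ t * dyadicBase d ^ l := by
    intro x
    by_cases hx : x ∈ Eᶜ
    · rw [Set.indicator_of_mem hx]; exact not_lt.1 hx
    · rw [Set.indicator_of_notMem hx, norm_zero]; positivity
  have hsplit : ∫ ξ in dyadicShell d l, ∑ i, (starRingEnd ℂ) (f i ξ) * (g ξ : ℂ) *
      𝓕 (fun x ↦ u x * e i x) ξ =
      (∫ ξ, ∑ i, (starRingEnd ℂ) (f i ξ) * A ξ * 𝓕 (fun x ↦ E.indicator u x * e i x) ξ) +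
      ∫ ξ, ∑ i, (starRingEnd ℂ) (f i ξ) * A ξ * 𝓕 (fun x ↦ Eᶜ.indicator u x * e i x) ξ := by
    rw [← integral_indicator (measurableSet_dyadicShell l),
      ← integral_add (integrable_sum_conj_mul_fourier e f hA hu1)
        (integrable_sum_conj_mul_fourier e f hA hu2)]
    refine integral_congr_ae (Filter.Eventually.of_forall fun ξ ↦ ?_)
    simp only
    rw [← Finset.sum_add_distrib]
    by_cases hξ : ξ ∈ dyadicShell d l
    · rw [Set.indicator_of_mem hξ]
      refine Finset.sum_congr rfl fun i _ ↦ ?_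
      rw [hAdef, Set.indicator_of_mem hξ, ← mul_add, ← fourier_add_of_integrable
        (memLp_two_mul_integrable hu1 (e i)) (memLp_two_mul_integrable hu2 (e i))]
      simp_rw [← add_mul, ← Pi.add_apply (E.indicator u), Set.indicator_self_add_compl]
    · rw [Set.indicator_of_notMem hξ]
      simp [hAdef, Set.indicator_of_notMem hξ]
  rw [hsplit]
  refine (enorm_add_le _ _).trans (add_le_add ?_ ?_)
  · have hsA : ∀ ξ, A ξ ≠ 0 → ∀ j, |ξ j| ≤ 2 ^ (l + 1) := by
      intro ξ hξ j
      have hξ' : ξ ∈ dyadicShell d l := by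
        by_contra hc
        exact hξ (Set.indicator_of_notMem hc _)
      exact (PiLp.norm_apply_le ξ j).trans hξ'.2.le
    refine (hs1.enorm_sum_integral_le he hf hA hu1 hsA).trans ?_
    have h1 : ∫⁻ x, ‖E.indicator u x‖ₑ = ∫⁻ x in E, ‖u x‖ₑ := by
      rw [← lintegral_indicator hEm]
      exact lintegral_congr fun x ↦ enorm_indicator_eq_indicator_enorm u x
    rw [h1]
    gcongr
  · refine (hg.enorm_integral_shell_high_le l e f hu2 hM ht).trans (le_of_eq ?_)
    have h1 : ∀ i, ∫⁻ x, ‖Eᶜ.indicator u x * e i x‖ₑ ^ 2 = ∫⁻ x in Eᶜ, ‖u x * e i x‖ₑ ^ 2 := by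
      intro i
      rw [← lintegral_indicator hEm.compl]
      refine lintegral_congr fun x ↦ ?_
      by_cases hx : x ∈ Eᶜ
      · rw [Set.indicator_of_mem hx, Set.indicator_of_mem hx]
      · rw [Set.indicator_of_notMem hx, Set.indicator_of_notMem hx]; simp
    simp_rw [h1]

theorem dyadicBase_ge (hd : 1 ≤ d) : 4 / 3 ≤ dyadicBase d ∧ 2 ≤ dyadicBase d ^ 2 := by
  have h2 : (2 : ℝ) ≤ dyadicBase d ^ 2 := by
    rw [dyadicBase_sq]
    calc (2 : ℝ) = 2 ^ 1 := by norm_num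
      _ ≤ 2 ^ d := pow_le_pow_right₀ one_le_two hd
  refine ⟨?_, h2⟩
  nlinarith [dyadicBase_pos d]

/-- After exchanging sum and integral, the sum of `2^{dl/2}` over the `l` with `2^{dl/2} < |u(x)| /
t` is at most `4 |u(x)| / t`. -/
theorem tsum_lintegral_superlevel_le (hd : 1 ≤ d) {u : RSpace d → ℂ} (hum : Measurable u) {t : ℝ}
    (ht : 0 < t) :
    ∑' l, ENNReal.ofReal (dyadicBase d ^ l) *
      ∫⁻ x in {x | t * dyadicBase d ^ l < ‖u x‖}, ‖u x‖ₑ ≤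
      4 * ((ENNReal.ofReal t)⁻¹ * eLpNorm u 2 volume ^ 2) := by
  have hb := dyadicBase_pos d
  have hEm : ∀ l, MeasurableSet {x | t * dyadicBase d ^ l < ‖u x‖} := fun l ↦
    measurableSet_lt measurable_const hum.norm
  have h1 : ∀ l, ENNReal.ofReal (dyadicBase d ^ l) *
      ∫⁻ x in {x | t * dyadicBase d ^ l < ‖u x‖}, ‖u x‖ₑ =
      ∫⁻ x, ENNReal.ofReal (if t * dyadicBase d ^ l < ‖u x‖ then dyadicBase d ^ l else 0) *
        ‖u x‖ₑ := by
    intro l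
    rw [← lintegral_const_mul _ hum.enorm, ← lintegral_indicator (hEm l)]
    refine lintegral_congr fun x ↦ ?_
    by_cases hx : t * dyadicBase d ^ l < ‖u x‖
    · rw [if_pos hx, Set.indicator_of_mem (by exact hx)]
    · rw [if_neg hx, Set.indicator_of_notMem (by exact hx)]; simp
  have hmeas : ∀ l, Measurable fun x ↦
      ENNReal.ofReal (if t * dyadicBase d ^ l < ‖u x‖ then dyadicBase d ^ l else 0) * ‖u x‖ₑ :=
    fun l ↦ (Measurable.ite (hEm l) measurable_const measurable_const).ennreal_ofReal.mul hum.enorm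
  simp_rw [h1]
  rw [← lintegral_tsum fun l ↦ (hmeas l).aemeasurable, ← lintegral_enorm_sq_eq_eLpNorm_sq,
    ← lintegral_const_mul _ (hum.enorm.pow_const 2),
    ← lintegral_const_mul _ ((hum.enorm.pow_const 2).const_mul _)]
  refine lintegral_mono fun x ↦ ?_
  simp only
  rw [ENNReal.tsum_mul_right]
  have h2 : ∑' l, ENNReal.ofReal (if t * dyadicBase d ^ l < ‖u x‖ then dyadicBase d ^ l else 0) ≤
      ENNReal.ofReal (4 * (‖u x‖ / t)) := by
    refine ENNReal.tsum_le_of_sum_range_le fun M ↦ ?_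
    rw [← ENNReal.ofReal_sum_of_nonneg fun l _ ↦ by split_ifs <;> positivity]
    exact ENNReal.ofReal_le_ofReal
      (sum_geometric_below_le (dyadicBase_ge hd).1 ht (norm_nonneg _) M)
  refine (mul_le_mul_left h2 _).trans (le_of_eq ?_)
  rw [ENNReal.ofReal_mul (by norm_num), div_eq_inv_mul, ENNReal.ofReal_mul (by positivity),
    ENNReal.ofReal_inv_of_pos ht, ofReal_norm]
  norm_num
  ring

/-- At a fixed point the terms `|u(x)|² 2^{-dl}` over the `l` with `t 2^{dl/2} ≥ |u(x)|` sum to at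
most `2 t²`, whatever the value of `u(x)`. -/
theorem tsum_lintegral_sublevel_le (hd : 1 ≤ d) {u : RSpace d → ℂ} (hum : Measurable u)
    (e : L2Space d) {t : ℝ} (ht : 0 < t) :
    ∑' l, ENNReal.ofReal (dyadicBase d ^ l)⁻¹ ^ 2 *
      ∫⁻ x in {x | t * dyadicBase d ^ l < ‖u x‖}ᶜ, ‖u x * e x‖ₑ ^ 2 ≤
      2 * ENNReal.ofReal t ^ 2 * ∫⁻ x, ‖e x‖ₑ ^ 2 := by
  have hb := dyadicBase_pos d
  have hEm : ∀ l, MeasurableSet {x | t * dyadicBase d ^ l < ‖u x‖} := fun l ↦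
    measurableSet_lt measurable_const hum.norm
  have hem : AEMeasurable (fun x ↦ ‖e x‖ₑ ^ 2) (volume : Measure (RSpace d)) :=
    (Lp.aestronglyMeasurable e).enorm.pow_const 2
  have h1 : ∀ l, ENNReal.ofReal (dyadicBase d ^ l)⁻¹ ^ 2 *
      ∫⁻ x in {x | t * dyadicBase d ^ l < ‖u x‖}ᶜ, ‖u x * e x‖ₑ ^ 2 =
      ∫⁻ x, ENNReal.ofReal (if t * dyadicBase d ^ l < ‖u x‖ then 0 else
        ‖u x‖ ^ 2 * ((dyadicBase d ^ l)⁻¹) ^ 2) * ‖e x‖ₑ ^ 2 := by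
    intro l
    rw [← lintegral_const_mul' _ _ (by simp), ← lintegral_indicator (hEm l).compl]
    refine lintegral_congr fun x ↦ ?_
    by_cases hx : t * dyadicBase d ^ l < ‖u x‖
    · rw [if_pos hx, Set.indicator_of_notMem (by simpa using hx)]; simp
    · rw [if_neg hx, Set.indicator_of_mem (by exact hx), enorm_mul, mul_pow,
        ENNReal.ofReal_mul (by positivity), ENNReal.ofReal_pow (norm_nonneg _), ofReal_norm,
        ENNReal.ofReal_pow (by positivity)]
      ring
  have hmeas : ∀ l, AEMeasurable (fun x ↦ ENNReal.ofReal (if t * dyadicBase d ^ l < ‖u x‖ then 0 else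
        ‖u x‖ ^ 2 * ((dyadicBase d ^ l)⁻¹) ^ 2) * ‖e x‖ₑ ^ 2)
        (volume : Measure (RSpace d)) :=
    fun l ↦ ((Measurable.ite (hEm l) measurable_const
      ((hum.norm.pow_const 2).mul_const _)).ennreal_ofReal.aemeasurable).mul hem
  simp_rw [h1]
  rw [← lintegral_tsum hmeas, ← lintegral_const_mul'' _ hem]
  refine lintegral_mono fun x ↦ ?_
  simp only
  rw [ENNReal.tsum_mul_right]
  refine mul_le_mul_left ?_ _
  refine ENNReal.tsum_le_of_sum_range_le fun M ↦ ?_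
  rw [← ENNReal.ofReal_sum_of_nonneg fun l _ ↦ by split_ifs <;> positivity]
  refine (ENNReal.ofReal_le_ofReal
    (sum_geometric_above_le hb (dyadicBase_ge hd).2 ht (norm_nonneg _) M)).trans (le_of_eq ?_)
  rw [ENNReal.ofReal_mul (by norm_num), ENNReal.ofReal_pow ht.le]
  norm_num

/-- The constant in the bound for step functions. -/
noncomputable def stepConst (d : ℕ) (C : ℝ≥0) : ℝ :=
  1 + (C : ℝ) ^ 2 + 4 * (Real.exp (4 * Real.pi * d) * C) + 3 * C

theorem stepConst_pos (d : ℕ) (C : ℝ≥0) : 0 < stepConst d C := by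
  have := C.coe_nonneg
  unfold stepConst
  positivity

/-- Only the ball `|ξ| < 2^L` is estimated in Hilbert-Schmidt norm, at the cost `L + 1`. Beyond it
`u` is constant at the scale dual to the frequency, and the infinitely many shells add no further
logarithm. -/
theorem IsCriticalSymbol.enorm_sum_inner_le (hd : 1 ≤ d) (hg : IsCriticalSymbol g C)
    {L : ℕ} {u : RSpace d → ℂ} (hum : Measurable u) (hu : MemLp u 2) (hs : IsDyadicStep L u)
    {G : L2Space d →L[ℂ] L2Space d} (hG : HasFourierKernel g u G)
    {e f : Fin N → L2Space d} (he : Orthonormal ℂ e) (hf : Orthonormal ℂ f) {t : ℝ} (ht : 0 < t) :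
    ‖∑ i, inner ℂ (f i) (G (e i))‖ₑ ≤
      ENNReal.ofReal (stepConst d C) * (ENNReal.ofReal t * N +
        (ENNReal.ofReal t)⁻¹ * ((L + 1) * eLpNorm u 2 volume ^ 2)) := by
  have ht0 : ENNReal.ofReal t ≠ 0 := by simpa using ht
  have htt : (ENNReal.ofReal t)⁻¹ * ENNReal.ofReal t = 1 :=
    ENNReal.inv_mul_cancel ht0 ENNReal.ofReal_ne_top
  obtain ⟨hint, heq⟩ := sum_inner_eq_integral hG e f
  rw [heq]
  set I : RSpace d → ℂ := fun ξ ↦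
    ∑ i, (starRingEnd ℂ) (f i ξ) * (g ξ : ℂ) * 𝓕 (fun x ↦ u x * e i x) ξ with hI
  set n := eLpNorm u 2 volume with hn
  set K := ENNReal.ofReal (Real.exp (4 * Real.pi * d)) with hK
  set T := ENNReal.ofReal t with hT
  have hball : ‖∫ ξ in Metric.ball 0 (2 ^ L), I ξ‖ₑ ≤
      T * N + T⁻¹ * (((L + 1) * (C : ℝ≥0∞) ^ 2) * n ^ 2) := by
    refine (enorm_integral_le_lintegral_enorm _).trans
      ((lintegral_sum_le_of_hilbertSchmidt he hf hg.measurable hu _ ht).trans ?_)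
    gcongr
    exact hg.lintegral_ball_le L
  have hshell : HasSum (fun k ↦ ∫ ξ in dyadicShell d (L + k), I ξ)
      (∫ ξ in (Metric.ball 0 (2 ^ L))ᶜ, I ξ) := by
    have := hasSum_integral_iUnion (μ := (volume : Measure (RSpace d)))
      (fun k ↦ measurableSet_dyadicShell (d := d) (L + k))
      (fun k m hkm ↦ pairwise_disjoint_dyadicShell (fun h ↦ hkm (Nat.add_left_cancel h)))
      hint.integrableOn
    rwa [iUnion_dyadicShell] at this
  have hinj : Function.Injective fun k ↦ L + k := fun k m h ↦ Nat.add_left_cancel h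
  have h1 : ∑' k, ENNReal.ofReal (dyadicBase d ^ (L + k)) *
        ∫⁻ x in {x | t * dyadicBase d ^ (L + k) < ‖u x‖}, ‖u x‖ₑ ≤ 4 * (T⁻¹ * n ^ 2) :=
    (ENNReal.tsum_comp_le_tsum_of_injective hinj fun l ↦ ENNReal.ofReal (dyadicBase d ^ l) *
        ∫⁻ x in {x | t * dyadicBase d ^ l < ‖u x‖}, ‖u x‖ₑ).trans
      (tsum_lintegral_superlevel_le hd hum ht)
  have h2 : ∑' k, ∑ i, ∫⁻ ξ in dyadicShell d (L + k), ‖f i ξ‖ₑ ^ 2 ≤ N := by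
    rw [Summable.tsum_finsetSum fun i _ ↦ ENNReal.summable, ← sum_lintegral_enorm_sq_eq hf]
    refine Finset.sum_le_sum fun i _ ↦ ?_
    rw [← lintegral_iUnion (fun k ↦ measurableSet_dyadicShell (d := d) (L + k))
      (fun k m hkm ↦ pairwise_disjoint_dyadicShell (fun h ↦ hkm (Nat.add_left_cancel h)))]
    exact setLIntegral_le_lintegral _ _
  have h3 : ∑' k, ∑ i, ENNReal.ofReal (dyadicBase d ^ (L + k))⁻¹ ^ 2 *
      ∫⁻ x in {x | t * dyadicBase d ^ (L + k) < ‖u x‖}ᶜ, ‖u x * e i x‖ₑ ^ 2 ≤ 2 * T ^ 2 * N := by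
    rw [Summable.tsum_finsetSum fun i _ ↦ ENNReal.summable, ← sum_lintegral_enorm_sq_eq he,
      Finset.mul_sum]
    refine Finset.sum_le_sum fun i _ ↦ ?_
    exact (ENNReal.tsum_comp_le_tsum_of_injective hinj fun l ↦
      ENNReal.ofReal (dyadicBase d ^ l)⁻¹ ^ 2 *
      ∫⁻ x in {x | t * dyadicBase d ^ l < ‖u x‖}ᶜ, ‖u x * e i x‖ₑ ^ 2).trans
      (tsum_lintegral_sublevel_le hd hum (e i) ht)
  have hcompl : ‖∫ ξ in (Metric.ball 0 (2 ^ L))ᶜ, I ξ‖ₑ ≤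
      K * C * (4 * (T⁻¹ * n ^ 2)) + C * (T * N + T⁻¹ * (2 * T ^ 2 * N)) := by
    rw [← hshell.tsum_eq]
    refine enorm_tsum_le_tsum_enorm.trans ((ENNReal.tsum_le_tsum fun k ↦
      hg.enorm_integral_shell_le he hf hum hu (hs.of_le (Nat.le_add_right L k)) ht).trans ?_)
    rw [ENNReal.tsum_add, ENNReal.tsum_mul_left, ENNReal.tsum_mul_left, ENNReal.tsum_add,
      ENNReal.tsum_mul_left, ENNReal.tsum_mul_left]
    gcongr
  rw [← integral_add_compl (Metric.isOpen_ball (x := (0 : RSpace d)) (ε := 2 ^ L)).measurableSet hint]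
  refine (enorm_add_le _ _).trans ((add_le_add hball hcompl).trans ?_)
  have hconst : ENNReal.ofReal (stepConst d C) = 1 + (C : ℝ≥0∞) ^ 2 + 4 * (K * C) + 3 * C := by
    have := C.coe_nonneg
    rw [stepConst, ENNReal.ofReal_add (by positivity) (by positivity),
      ENNReal.ofReal_add (by positivity) (by positivity),
      ENNReal.ofReal_add (by positivity) (by positivity), ENNReal.ofReal_mul (by norm_num : (0 : ℝ) ≤ 4),
      ENNReal.ofReal_mul (Real.exp_pos _).le, ENNReal.ofReal_mul (by norm_num : (0 : ℝ) ≤ 3),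
      ENNReal.ofReal_pow (by positivity),
      ENNReal.ofReal_coe_nnreal, hK]
    norm_num
  rw [hconst]
  have h4 : T⁻¹ * (2 * T ^ 2 * N) = 2 * (T * N) := by
    calc T⁻¹ * (2 * T ^ 2 * N) = 2 * (T⁻¹ * T) * (T * N) := by ring
      _ = _ := by rw [htt, mul_one]
  rw [h4]
  set P := T * (N : ℝ≥0∞) with hP
  set Q := T⁻¹ * ((L + 1) * n ^ 2) with hQ
  have h5 : T⁻¹ * n ^ 2 ≤ Q := by
    rw [hQ]
    gcongr
    exact le_mul_of_one_le_left zero_le (by simp)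
  have h6 : T⁻¹ * (((L + 1) * (C : ℝ≥0∞) ^ 2) * n ^ 2) = (C : ℝ≥0∞) ^ 2 * Q := by
    rw [hQ]; ring
  rw [h6]
  calc P + (C : ℝ≥0∞) ^ 2 * Q + (K * C * (4 * (T⁻¹ * n ^ 2)) + C * (P + 2 * P))
      ≤ P + (C : ℝ≥0∞) ^ 2 * Q + (K * C * (4 * Q) + C * (P + 2 * P)) := by gcongr
    _ = (1 + 3 * C) * P + ((C : ℝ≥0∞) ^ 2 + 4 * (K * C)) * Q := by ring
    _ ≤ (1 + (C : ℝ≥0∞) ^ 2 + 4 * (K * C) + 3 * C) * P +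
        (1 + (C : ℝ≥0∞) ^ 2 + 4 * (K * C) + 3 * C) * Q := by
        gcongr ?_ * P + ?_ * Q
        · calc (1 + 3 * C : ℝ≥0∞) ≤ 1 + 3 * C + ((C : ℝ≥0∞) ^ 2 + 4 * (K * C)) := le_self_add
            _ = _ := by ring
        · calc ((C : ℝ≥0∞) ^ 2 + 4 * (K * C)) ≤ (C : ℝ≥0∞) ^ 2 + 4 * (K * C) + (1 + 3 * C) :=
              le_self_add
            _ = _ := by ring
    _ = _ := by ring

/-- A square integrable step function is bounded, so Plancherel yields a bounded operator. That
bound depends badly on `L`; the Ky Fan bound comes from the preceding lemma with `Y² = (L+1) ‖u‖²`.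
-/
theorem IsCriticalSymbol.exists_hasFourierKernel_of_step (hd : 1 ≤ d) (hg : IsCriticalSymbol g C)
    {L : ℕ} {u : RSpace d → ℂ} (hum : Measurable u) (hu : MemLp u 2) (hs : IsDyadicStep L u) :
    ∃ G : L2Space d →L[ℂ] L2Space d, HasFourierKernel g u G ∧
      KyFanBound G (2 * stepConst d C * (√(L + 1) * (eLpNorm u 2 volume).toReal)) := by
  have hb := dyadicBase_pos d
  set n := (eLpNorm u 2 volume).toReal with hn
  have hn' : eLpNorm u 2 volume = ENNReal.ofReal n := (ENNReal.ofReal_toReal hu.2.ne).symm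
  have hn0 : 0 ≤ n := ENNReal.toReal_nonneg
  have hM : ∀ x, ‖u x‖ ≤ dyadicBase d ^ L * n := by
    intro x
    have h := hs.enorm_le x
    rwa [hn', ← ENNReal.ofReal_mul (by positivity), ← ofReal_norm,
      ENNReal.ofReal_le_ofReal_iff (by positivity)] at h
  obtain ⟨G, hG⟩ := exists_hasFourierKernel hg.measurable hu (C := dyadicBase d ^ L * n)
    (by positivity) fun f ↦ by
      calc ∫⁻ ξ, ‖(g ξ : ℂ) * 𝓕 (fun x ↦ u x * f x) ξ‖ₑ ^ 2
          ≤ ∫⁻ ξ, ‖𝓕 (fun x ↦ u x * f x) ξ‖ₑ ^ 2 := by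
            refine lintegral_mono fun ξ ↦ ?_
            rw [enorm_mul, enorm_ofReal_complex]
            refine pow_le_pow_left₀ zero_le (mul_le_of_le_one_left zero_le ?_) 2
            rw [← ofReal_norm, Real.norm_eq_abs]
            exact ENNReal.ofReal_le_one.2 (hg.abs_le_one ξ)
        _ = ∫⁻ x, ‖u x * f x‖ₑ ^ 2 :=
            lintegral_enorm_fourier_sq (memLp_two_mul_integrable hu f)
              (memLp_bounded_mul_coeFn hu.1 hM f)
        _ ≤ ∫⁻ x, ENNReal.ofReal (dyadicBase d ^ L * n) ^ 2 * ‖f x‖ₑ ^ 2 := by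
            refine lintegral_mono fun x ↦ ?_
            rw [enorm_mul, mul_pow]
            gcongr
            rw [← ofReal_norm]
            exact ENNReal.ofReal_le_ofReal (hM x)
        _ = _ := by
            rw [lintegral_const_mul' _ _ (by simp), lintegral_enorm_sq_coeFn, ← ofReal_norm,
              ← mul_pow, ← ENNReal.ofReal_mul (by positivity), ENNReal.ofReal_pow (by positivity)]
  refine ⟨G, hG, KyFanBound.of_forall_pos (stepConst_pos d C).le (by positivity) ?_⟩
  intro N e f he hf t ht
  have hc := stepConst_pos d C
  have h := hg.enorm_sum_inner_le hd hum hu hs hG he hf ht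
  have hL : (L + 1 : ℝ≥0∞) = ENNReal.ofReal (L + 1) := by
    rw [ENNReal.ofReal_add (by positivity) zero_le_one]; simp
  rw [hn', hL, ← ENNReal.ofReal_pow hn0, ← ENNReal.ofReal_mul (by positivity),
    ← ENNReal.ofReal_inv_of_pos ht, ← ENNReal.ofReal_mul (by positivity), ← ENNReal.ofReal_natCast,
    ← ENNReal.ofReal_mul ht.le, ← ENNReal.ofReal_add (by positivity) (by positivity),
    ← ENNReal.ofReal_mul hc.le, ← ofReal_norm, ENNReal.ofReal_le_ofReal_iff (by positivity)] at h
  rw [mul_pow, Real.sq_sqrt (by positivity), div_eq_inv_mul]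
  exact h

end Critical

/-! ### Dyadic averages and functions with a Lipschitz modulus in `L²` -/

section Average

variable {d : ℕ}

/-- The average of `w` over the dyadic cube of side `2^{-l}` that contains `x`. -/
noncomputable def dyadicAverage (l : ℕ) (w : RSpace d → ℂ) (x : RSpace d) : ℂ :=
  (((dyadicBase d ^ l) ^ 2 : ℝ) : ℂ) * ∫ y in dyadicCube l (dyadicIndex l x), w y

theorem measurable_dyadicAverage (l : ℕ) (w : RSpace d → ℂ) : Measurable (dyadicAverage l w) :=
  (Measurable.of_discrete (f := fun n ↦
    (((dyadicBase d ^ l) ^ 2 : ℝ) : ℂ) * ∫ y in dyadicCube l n, w y)).comp (measurable_dyadicIndex l)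

theorem isDyadicStep_dyadicAverage (l : ℕ) (w : RSpace d → ℂ) :
    IsDyadicStep l (dyadicAverage l w) := fun x y hxy ↦ by rw [dyadicAverage, dyadicAverage, hxy]

/-- The box `|h_j| ≤ 2^{-l}`. -/
def dyadicBox (d l : ℕ) : Set (RSpace d) := {h | ∀ j, |h j| ≤ ((2 : ℝ) ^ l)⁻¹}

theorem dyadicBox_eq_preimage (l : ℕ) : dyadicBox d l =
    (WithLp.ofLp : RSpace d → (Fin d → ℝ)) ⁻¹' (Set.univ.pi fun _ ↦
      Set.Icc (-((2 : ℝ) ^ l)⁻¹) (((2 : ℝ) ^ l)⁻¹)) := by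
  ext x
  simp only [dyadicBox, Set.mem_ofPred_eq, Set.mem_preimage, Set.mem_univ_pi, Set.mem_Icc, abs_le]

theorem measurableSet_dyadicBox (l : ℕ) : MeasurableSet (dyadicBox d l) := by
  rw [dyadicBox_eq_preimage]
  exact (PiLp.volume_preserving_ofLp (Fin d)).measurable
    (MeasurableSet.univ_pi fun j ↦ measurableSet_Icc)

theorem volume_dyadicBox (l : ℕ) : ENNReal.ofReal ((dyadicBase d ^ l) ^ 2) *
    volume (dyadicBox d l) = ENNReal.ofReal (dyadicBase d ^ 2) := by
  have hb := dyadicBase_pos d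
  rw [dyadicBox_eq_preimage, (PiLp.volume_preserving_ofLp (Fin d)).measure_preimage
    (MeasurableSet.univ_pi fun j ↦ measurableSet_Icc).nullMeasurableSet, Set.pi_univ_Icc,
    Real.volume_Icc_pi,
    ← ENNReal.ofReal_prod_of_nonneg]
  · rw [← ENNReal.ofReal_mul (by positivity)]
    congr 1
    rw [Finset.prod_const, Finset.card_univ, Fintype.card_fin, sub_neg_eq_add, ← two_mul, mul_pow,
      ← pow_mul, mul_comm l 2, pow_mul, dyadicBase_sq, ← pow_mul, inv_pow, ← pow_mul,
      mul_comm d l]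
    field_simp
  · intro j _
    have : (0 : ℝ) < (2 ^ l)⁻¹ := by positivity
    linarith

theorem norm_le_of_mem_dyadicBox {l : ℕ} {h : RSpace d} (hh : h ∈ dyadicBox d l) :
    ‖h‖ ≤ d * ((2 : ℝ) ^ l)⁻¹ := by
  have h1 : h = ∑ j, h j • EuclideanSpace.single j (1 : ℝ) := by
    ext k
    simp [Finset.sum_apply, Pi.single_apply]
  calc ‖h‖ = ‖∑ j, h j • EuclideanSpace.single j (1 : ℝ)‖ := by rw [← h1]
    _ ≤ ∑ j, ‖h j • EuclideanSpace.single j (1 : ℝ)‖ := norm_sum_le _ _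
    _ ≤ ∑ _j : Fin d, ((2 : ℝ) ^ l)⁻¹ := by
        refine Finset.sum_le_sum fun j _ ↦ ?_
        rw [norm_smul, PiLp.norm_single, norm_one, mul_one, Real.norm_eq_abs]
        exact hh j
    _ = _ := by rw [Finset.sum_const, Finset.card_univ, Fintype.card_fin, nsmul_eq_mul]

theorem sub_mem_dyadicBox {l : ℕ} {x y : RSpace d} (h : dyadicIndex l y = dyadicIndex l x) :
    y - x ∈ dyadicBox d l := by
  intro j
  have h1 : ⌊(2 : ℝ) ^ l * y j⌋ = ⌊(2 : ℝ) ^ l * x j⌋ := congrFun h j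
  have h2 := (Int.abs_sub_lt_one_of_floor_eq_floor h1).le
  rw [← mul_sub, abs_mul, abs_of_pos (by positivity : (0 : ℝ) < 2 ^ l)] at h2
  rw [PiLp.sub_apply, ← one_div, le_div_iff₀' (by positivity)]
  exact h2

/-- This is Jensen's inequality on the cube, obtained from Cauchy-Schwarz against the constant
function. -/
theorem enorm_dyadicAverage_sub_sq_le (l : ℕ) {w : RSpace d → ℂ} (hw : MemLp w 2) (x : RSpace d) :
    ‖dyadicAverage l w x - w x‖ₑ ^ 2 ≤ ENNReal.ofReal ((dyadicBase d ^ l) ^ 2) *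
      ∫⁻ y in dyadicCube l (dyadicIndex l x), ‖w y - w x‖ₑ ^ 2 := by
  have hb := dyadicBase_pos d
  set q := dyadicCube l (dyadicIndex l x) with hq
  set b := dyadicBase d ^ l with hbdef
  have hb0 : 0 < b := by positivity
  have hvol : volume q = ENNReal.ofReal (b ^ 2)⁻¹ := by
    rw [hq, volume_dyadicCube', ← ENNReal.ofReal_pow (by positivity), inv_pow]
  have hfin : IsFiniteMeasure (volume.restrict q) :=
    ⟨by rw [Measure.restrict_apply_univ, hvol]; exact ENNReal.ofReal_lt_top⟩
  have hwi : Integrable w (volume.restrict q) := (hw.restrict q).integrable (by norm_num)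
  have hsub : dyadicAverage l w x - w x = ((b ^ 2 : ℝ) : ℂ) * ∫ y in q, (w y - w x) := by
    rw [integral_sub hwi (integrable_const _), setIntegral_const, measureReal_def, hvol,
      ENNReal.toReal_ofReal (by positivity), mul_sub, dyadicAverage, Complex.real_smul,
      ← mul_assoc, ← Complex.ofReal_mul, mul_inv_cancel₀ (by positivity), Complex.ofReal_one,
      one_mul]
  have hcs : ‖∫ y in q, (w y - w x)‖ₑ ^ 2 ≤
      ENNReal.ofReal (b ^ 2)⁻¹ * ∫⁻ y in q, ‖w y - w x‖ₑ ^ 2 := by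
    have h1 := lintegral_enorm_mul_le (μ := volume.restrict q) (f := fun y ↦ w y - w x)
      (g := fun _ ↦ (1 : ℂ)) (hwi.1.sub aestronglyMeasurable_const) aestronglyMeasurable_const
    simp only [mul_one] at h1
    calc ‖∫ y in q, (w y - w x)‖ₑ ^ 2
        ≤ (eLpNorm (fun y ↦ w y - w x) 2 (volume.restrict q) *
          eLpNorm (fun _ ↦ (1 : ℂ)) 2 (volume.restrict q)) ^ 2 := by
          gcongr
          exact (enorm_integral_le_lintegral_enorm _).trans h1
      _ = _ := by
          rw [mul_pow, ← lintegral_enorm_sq_eq_eLpNorm_sq, ← lintegral_enorm_sq_eq_eLpNorm_sq]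
          simp [hvol, mul_comm]
  rw [hsub, enorm_mul, mul_pow, enorm_ofReal_complex, Real.enorm_eq_ofReal (by positivity)]
  calc ENNReal.ofReal (b ^ 2) ^ 2 * ‖∫ y in q, (w y - w x)‖ₑ ^ 2
      ≤ ENNReal.ofReal (b ^ 2) ^ 2 *
        (ENNReal.ofReal (b ^ 2)⁻¹ * ∫⁻ y in q, ‖w y - w x‖ₑ ^ 2) := by gcongr
    _ = ENNReal.ofReal (b ^ 2) * (ENNReal.ofReal (b ^ 2) * ENNReal.ofReal (b ^ 2)⁻¹) *
        ∫⁻ y in q, ‖w y - w x‖ₑ ^ 2 := by ring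
    _ = _ := by
        rw [← ENNReal.ofReal_mul (by positivity), mul_inv_cancel₀ (by positivity),
          ENNReal.ofReal_one, mul_one]

/-- With `y = x + h` the cube is enlarged to a box of increments that no longer depends on `x`, and
Tonelli allows integrating in `x` first. The factor `2^d` is the ratio of the volumes of box and
cube. -/
theorem lintegral_enorm_dyadicAverage_sub_sq_le (l : ℕ) {w : RSpace d → ℂ} (hwm : Measurable w)
    (hw : MemLp w 2) {Ω : ℝ≥0∞}
    (hΩ : ∀ h ∈ dyadicBox d l, ∫⁻ x, ‖w (x + h) - w x‖ₑ ^ 2 ≤ Ω) :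
    ∫⁻ x, ‖dyadicAverage l w x - w x‖ₑ ^ 2 ≤ ENNReal.ofReal (dyadicBase d ^ 2) * Ω := by
  have hbox := measurableSet_dyadicBox (d := d) l
  have hstep : ∀ x, ∫⁻ y in dyadicCube l (dyadicIndex l x), ‖w y - w x‖ₑ ^ 2 ≤
      ∫⁻ h in dyadicBox d l, ‖w (x + h) - w x‖ₑ ^ 2 := by
    intro x
    rw [← lintegral_indicator (measurableSet_dyadicCube l _), ← lintegral_indicator hbox,
      ← lintegral_add_left_eq_self _ x]
    refine lintegral_mono fun h ↦ ?_
    by_cases hx : x + h ∈ dyadicCube l (dyadicIndex l x)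
    · have hh : h ∈ dyadicBox d l := by
        have := sub_mem_dyadicBox (Set.mem_singleton_iff.1 hx)
        rwa [add_sub_cancel_left] at this
      rw [Set.indicator_of_mem hx, Set.indicator_of_mem hh]
    · rw [Set.indicator_of_notMem hx]
      exact zero_le
  have hm : Measurable fun p : RSpace d × RSpace d ↦ ‖w (p.1 + p.2) - w p.1‖ₑ ^ 2 :=
    (((hwm.comp (measurable_fst.add measurable_snd)).sub (hwm.comp measurable_fst)).enorm).pow_const 2
  calc ∫⁻ x, ‖dyadicAverage l w x - w x‖ₑ ^ 2
      ≤ ∫⁻ x, ENNReal.ofReal ((dyadicBase d ^ l) ^ 2) *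
        ∫⁻ h in dyadicBox d l, ‖w (x + h) - w x‖ₑ ^ 2 :=
        lintegral_mono fun x ↦ (enorm_dyadicAverage_sub_sq_le l hw x).trans 
          (mul_le_mul_right (hstep x) _)
    _ = ENNReal.ofReal ((dyadicBase d ^ l) ^ 2) *
        ∫⁻ h in dyadicBox d l, ∫⁻ x, ‖w (x + h) - w x‖ₑ ^ 2 := by
        rw [lintegral_const_mul' _ _ ENNReal.ofReal_ne_top, lintegral_lintegral_swap hm.aemeasurable]
    _ ≤ ENNReal.ofReal ((dyadicBase d ^ l) ^ 2) * ∫⁻ _ in dyadicBox d l, Ω := by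
        exact mul_le_mul_right (setLIntegral_mono measurable_const hΩ) _
    _ = _ := by rw [setLIntegral_const, mul_left_comm, mul_comm Ω, ← volume_dyadicBox l]

/-- Averaging error for functions with Lipschitz modulus of continuity in `L²`. -/
theorem eLpNorm_dyadicAverage_sub_le (l : ℕ) {w : RSpace d → ℂ} (hwm : Measurable w)
    (hw : MemLp w 2) {κ : ℝ} (hκ : 0 ≤ κ)
    (hmod : ∀ h, eLpNorm (fun x ↦ w (x + h) - w x) 2 volume ≤ ENNReal.ofReal (κ * ‖h‖)) :
    eLpNorm (fun x ↦ dyadicAverage l w x - w x) 2 volume ≤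
      ENNReal.ofReal (dyadicBase d * (κ * (d * ((2 : ℝ) ^ l)⁻¹))) := by
  have hb := dyadicBase_pos d
  refine (ENNReal.pow_le_pow_left_iff two_ne_zero).1 ?_
  rw [← lintegral_enorm_sq_eq_eLpNorm_sq]
  refine (lintegral_enorm_dyadicAverage_sub_sq_le l hwm hw
    (Ω := ENNReal.ofReal (κ * (d * ((2 : ℝ) ^ l)⁻¹)) ^ 2) fun h hh ↦ ?_).trans (le_of_eq ?_)
  · rw [lintegral_enorm_sq_eq_eLpNorm_sq]
    refine pow_le_pow_left₀ zero_le ((hmod h).trans (ENNReal.ofReal_le_ofReal ?_)) 2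
    exact mul_le_mul_of_nonneg_left (norm_le_of_mem_dyadicBox hh) hκ
  · rw [ENNReal.ofReal_mul hb.le, mul_pow, ← ENNReal.ofReal_pow hb.le]

/-- The dyadic martingale differences of `w`, starting from level `L`. -/
noncomputable def dyadicDifference (L : ℕ) (w : RSpace d → ℂ) : ℕ → RSpace d → ℂ
  | 0 => dyadicAverage L w
  | k + 1 => fun x ↦ dyadicAverage (L + (k + 1)) w x - dyadicAverage (L + k) w x

theorem sum_dyadicDifference (L n : ℕ) (w : RSpace d → ℂ) (x : RSpace d) :
    ∑ k ∈ Finset.range (n + 1), dyadicDifference L w k x = dyadicAverage (L + n) w x := by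
  induction n with
  | zero => simp [dyadicDifference]
  | succ n ih => rw [Finset.sum_range_succ, ih]; simp [dyadicDifference]

theorem measurable_dyadicDifference (L k : ℕ) (w : RSpace d → ℂ) :
    Measurable (dyadicDifference L w k) := by
  cases k with
  | zero => exact measurable_dyadicAverage L w
  | succ k => exact (measurable_dyadicAverage _ w).sub (measurable_dyadicAverage _ w)

theorem isDyadicStep_dyadicDifference (L k : ℕ) (w : RSpace d → ℂ) :
    IsDyadicStep (L + k) (dyadicDifference L w k) := by
  cases k with
  | zero => exact isDyadicStep_dyadicAverage L w
  | succ k =>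
    intro x y hxy
    simp only [dyadicDifference]
    rw [isDyadicStep_dyadicAverage _ w x y hxy,
      isDyadicStep_dyadicAverage (L + k) w x y (dyadicIndex_eq_of_succ hxy)]

/-- The level `L` cancels the modulus `2^L`, so averaging at level `L + k` has error `O(2^{-k}
‖w‖)`. The summand `1` accounts for `w` itself at `k = 0`. -/
theorem eLpNorm_dyadicDifference_le (L k : ℕ) {w : RSpace d → ℂ} (hwm : Measurable w)
    (hw : MemLp w 2) (hmod : ∀ h, eLpNorm (fun x ↦ w (x + h) - w x) 2 volume ≤
      ENNReal.ofReal (2 ^ L * (eLpNorm w 2 volume).toReal * ‖h‖)) :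
    eLpNorm (dyadicDifference L w k) 2 volume ≤ ENNReal.ofReal
      ((1 + 4 * (dyadicBase d * d)) * (1 / 2) ^ k * (eLpNorm w 2 volume).toReal) := by
  have hb := dyadicBase_pos d
  set n := (eLpNorm w 2 volume).toReal with hn
  have hn' : eLpNorm w 2 volume = ENNReal.ofReal n := (ENNReal.ofReal_toReal hw.2.ne).symm
  have hn0 : 0 ≤ n := ENNReal.toReal_nonneg
  have herr : ∀ k, eLpNorm (fun x ↦ dyadicAverage (L + k) w x - w x) 2 volume ≤
      ENNReal.ofReal (dyadicBase d * d * n * (1 / 2) ^ k) := by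
    intro k
    refine (eLpNorm_dyadicAverage_sub_le (L + k) hwm hw (κ := 2 ^ L * n) (by positivity) hmod).trans
      (le_of_eq ?_)
    congr 1
    rw [pow_add, mul_inv, one_div, inv_pow]
    field_simp
  have hm : ∀ l, AEStronglyMeasurable (fun x ↦ dyadicAverage l w x - w x) volume := fun l ↦
    (measurable_dyadicAverage l w).aestronglyMeasurable.sub hw.1
  cases k with
  | zero =>
    have h1 : dyadicDifference L w 0 = (fun x ↦ dyadicAverage (L + 0) w x - w x) + w := by
      ext x; simp [dyadicDifference]
    rw [h1]
    refine (eLpNorm_add_le (hm _) hw.1 (by norm_num)).trans ?_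
    rw [hn']
    refine (add_le_add_left (herr 0) _).trans ?_
    rw [← ENNReal.ofReal_add (by positivity) hn0]
    refine ENNReal.ofReal_le_ofReal ?_
    have : 0 ≤ dyadicBase d * d * n := by positivity
    rw [pow_zero]
    linarith
  | succ k =>
    have h1 : dyadicDifference L w (k + 1) = (fun x ↦ dyadicAverage (L + (k + 1)) w x - w x) -
        fun x ↦ dyadicAverage (L + k) w x - w x := by
      ext x; simp [dyadicDifference]
    rw [h1]
    refine (eLpNorm_sub_le (hm _) (hm _) (by norm_num)).trans ((add_le_add (herr _) (herr _)).trans ?_)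
    rw [← ENNReal.ofReal_add (by positivity) (by positivity)]
    refine ENNReal.ofReal_le_ofReal ?_
    have h2 : 0 ≤ dyadicBase d * d * n * (1 / 2) ^ k := by positivity
    have h3 : 0 ≤ (1 / 2 : ℝ) ^ k * n := by positivity
    rw [pow_succ]
    linarith

/-- The constant in the bound for functions with a Lipschitz modulus of continuity. -/
noncomputable def modulusConst (d : ℕ) (C : ℝ≥0) : ℝ :=
  2 * stepConst d C * (1 + 4 * (dyadicBase d * d)) * ∑' k : ℕ, ((k : ℝ) + 1) * (1 / 2) ^ k

theorem modulusConst_nonneg (d : ℕ) (C : ℝ≥0) : 0 ≤ modulusConst d C := by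
  have hb := dyadicBase_pos d
  have hs := stepConst_pos d C
  have : 0 ≤ ∑' k : ℕ, ((k : ℝ) + 1) * (1 / 2) ^ k := tsum_nonneg fun k ↦ by positivity
  unfold modulusConst
  positivity

/-- The `k`-th martingale difference is a step function of level `L + k`. Its cost `√(L+k+1) ≤
√(L+1) (k+1)` is beaten by its norm `O(2^{-k} ‖w‖)`, so the series of operators converges. -/
theorem IsCriticalSymbol.exists_hasFourierKernel_of_modulus (hd : 1 ≤ d) {g : RSpace d → ℝ}
    {C : ℝ≥0} (hg : IsCriticalSymbol g C) {L : ℕ} {w : RSpace d → ℂ} (hwm : Measurable w)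
    (hw : MemLp w 2) (hmod : ∀ h, eLpNorm (fun x ↦ w (x + h) - w x) 2 volume ≤
      ENNReal.ofReal (2 ^ L * (eLpNorm w 2 volume).toReal * ‖h‖)) :
    ∃ G : L2Space d →L[ℂ] L2Space d, HasFourierKernel g w G ∧
      KyFanBound G (modulusConst d C * (√(L + 1) * (eLpNorm w 2 volume).toReal)) := by
  have hb := dyadicBase_pos d
  have hc := stepConst_pos d C
  set n := (eLpNorm w 2 volume).toReal with hn
  have hn0 : 0 ≤ n := ENNReal.toReal_nonneg
  set A := 2 * stepConst d C * (1 + 4 * (dyadicBase d * d)) * (√(L + 1) * n) with hA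
  have hA0 : 0 ≤ A := by positivity
  have hbd := fun k ↦ eLpNorm_dyadicDifference_le L k hwm hw hmod
  have hmem : ∀ k, MemLp (dyadicDifference L w k) 2 := fun k ↦
    ⟨(measurable_dyadicDifference L k w).aestronglyMeasurable,
      (hbd k).trans_lt ENNReal.ofReal_lt_top⟩
  have hsummable : Summable fun k : ℕ ↦ ((k : ℝ) + 1) * (1 / 2) ^ k := by
    have h1 := summable_pow_mul_geometric_of_norm_lt_one 1 (r := (1 / 2 : ℝ)) (by norm_num)
    have h2 := summable_geometric_of_lt_one (r := (1 / 2 : ℝ)) (by norm_num) (by norm_num)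
    refine (h1.add h2).congr fun k ↦ ?_
    ring
  have hlim : Filter.Tendsto (fun m ↦ eLpNorm (fun x ↦ w x -
      ∑ k ∈ Finset.range m, dyadicDifference L w k x) 2 volume) Filter.atTop (nhds 0) := by
    rw [← Filter.tendsto_add_atTop_iff_nat 1]
    have hz : Filter.Tendsto (fun m : ℕ ↦ ENNReal.ofReal
        (dyadicBase d * (2 ^ L * n * (d * ((2 : ℝ) ^ (L + m))⁻¹)))) Filter.atTop (nhds 0) := by
      rw [← ENNReal.ofReal_zero]
      refine ENNReal.tendsto_ofReal ?_
      have h1 := (tendsto_pow_atTop_nhds_zero_of_lt_one (r := (1 / 2 : ℝ)) (by norm_num)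
        (by norm_num)).const_mul (dyadicBase d * n * d)
      rw [mul_zero] at h1
      refine h1.congr fun m ↦ ?_
      rw [pow_add, mul_inv, one_div, inv_pow]
      field_simp
    refine tendsto_of_tendsto_of_tendsto_of_le_of_le tendsto_const_nhds hz (fun _ ↦ zero_le)
      fun m ↦ ?_
    simp only [sum_dyadicDifference]
    have h2 : (fun x ↦ w x - dyadicAverage (L + m) w x) =
        -(fun x ↦ dyadicAverage (L + m) w x - w x) := by ext x; simp
    rw [h2, eLpNorm_neg]
    exact eLpNorm_dyadicAverage_sub_le (L + m) hwm hw (by positivity) hmod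
  obtain ⟨G, hG, hK⟩ := exists_hasFourierKernel_of_series (g := g) hw hmem hlim
    (X := fun k ↦ A * (((k : ℝ) + 1) * (1 / 2) ^ k)) (fun k ↦ by positivity)
    (hsummable.mul_left A) fun k ↦ by
      obtain ⟨G, hG, hK⟩ := hg.exists_hasFourierKernel_of_step hd
        (measurable_dyadicDifference L k w) (hmem k) (isDyadicStep_dyadicDifference L k w)
      refine ⟨G, hG, hK.mono ?_⟩
      have h1 : (eLpNorm (dyadicDifference L w k) 2 volume).toReal ≤
          (1 + 4 * (dyadicBase d * d)) * (1 / 2) ^ k * n :=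
        ENNReal.toReal_le_of_le_ofReal (by positivity) (hbd k)
      have h2 : √(((L + k : ℕ) : ℝ) + 1) ≤ √(L + 1) * (k + 1) := by
        rw [Real.sqrt_le_iff]
        refine ⟨by positivity, ?_⟩
        rw [mul_pow, Real.sq_sqrt (by positivity)]
        push_cast
        have hL : (0 : ℝ) ≤ L := by positivity
        have hk : (0 : ℝ) ≤ k := by positivity
        nlinarith [mul_nonneg hL hk, mul_nonneg hL (sq_nonneg (k : ℝ))]
      calc 2 * stepConst d C * (√(((L + k : ℕ) : ℝ) + 1) *
            (eLpNorm (dyadicDifference L w k) 2 volume).toReal)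
          ≤ 2 * stepConst d C * ((√(L + 1) * (k + 1)) *
            ((1 + 4 * (dyadicBase d * d)) * (1 / 2) ^ k * n)) := by gcongr
        _ = _ := by rw [hA]; ring
  refine ⟨G, hG, hK.mono (le_of_eq ?_)⟩
  rw [tsum_mul_left, hA, modulusConst]
  ring

end Average

/-! ### Gaussians as Schwartz functions -/

section GaussianSchwartz

theorem exp_neg_mul_sq_mul_pow_le {b : ℝ} (hb : 0 < b) (N : ℕ) {r : ℝ} (hr : 0 ≤ r) :
    (1 + r) ^ N * Real.exp (-b * r ^ 2) ≤ Real.exp (N ^ 2 / (4 * b)) := by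
  have h1 : (1 + r) ^ N ≤ Real.exp (N * r) := by
    rw [Real.exp_nat_mul]
    refine pow_le_pow_left₀ (by positivity) ?_ N
    linarith [Real.add_one_le_exp r]
  calc (1 + r) ^ N * Real.exp (-b * r ^ 2) ≤ Real.exp (N * r) * Real.exp (-b * r ^ 2) := by
        gcongr
    _ = Real.exp (N * r + -b * r ^ 2) := (Real.exp_add _ _).symm
    _ ≤ _ := by
        refine Real.exp_le_exp.2 ?_
        rw [le_div_iff₀ (by positivity)]
        nlinarith [sq_nonneg (2 * b * r - N)]

theorem exists_norm_iteratedFDeriv_gaussian_le (d : ℕ) {b : ℝ} (hb : 0 < b) (k n : ℕ) :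
    ∃ C, ∀ x : RSpace d, ‖x‖ ^ k *
      ‖iteratedFDeriv ℝ n (fun x : RSpace d ↦ Real.exp (-b * ‖x‖ ^ 2)) x‖ ≤ C := by
  have hf : (fun x : RSpace d ↦ -b * ‖x‖ ^ 2).HasTemperateGrowth :=
    (Function.HasTemperateGrowth.const (-b)).mul (Function.hasTemperateGrowth_norm_sq (RSpace d))
  obtain ⟨m, C, hC, h⟩ := hf.norm_iteratedFDeriv_le_uniform n
  -- The `n`-th derivative is at most `n! exp(-b|x|²) D^n` with `D = (1+C)(1+|x|)^m`; the polynomial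
  -- of degree `k + m n` is absorbed by the Gaussian.
  refine ⟨n.factorial * (1 + C) ^ n * Real.exp (((k + m * n : ℕ) : ℝ) ^ 2 / (4 * b)), fun x ↦ ?_⟩
  have hx : (1 : ℝ) ≤ 1 + ‖x‖ := by linarith [norm_nonneg x]
  -- Using `1 + C` instead of `C` gives `D ≥ 1`, hence `D ≤ D^i` for all `i ≥ 1`.
  have hD1 : 1 ≤ (1 + C) * (1 + ‖x‖) ^ m := by
    nlinarith [one_le_pow₀ hx (n := m), mul_nonneg hC (pow_nonneg (zero_le_one.trans hx) m)]
  have h2 := norm_iteratedFDeriv_comp_le (𝕜 := ℝ) (N := n) (g := Real.exp)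
    (f := fun x : RSpace d ↦ -b * ‖x‖ ^ 2) (n := n) Real.contDiff_exp (hf.1.of_le
      (by exact_mod_cast le_top)) le_rfl x (C := Real.exp (-b * ‖x‖ ^ 2))
    (D := (1 + C) * (1 + ‖x‖) ^ m) (fun i _ ↦ by
      rw [norm_iteratedFDeriv_eq_norm_iteratedDeriv, iteratedDeriv_eq_iterate, Real.iter_deriv_exp,
        Real.norm_eq_abs, Real.abs_exp]) (fun i hi hin ↦ ?_)
  · calc ‖x‖ ^ k * ‖iteratedFDeriv ℝ n (fun x : RSpace d ↦ Real.exp (-b * ‖x‖ ^ 2)) x‖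
        ≤ (1 + ‖x‖) ^ k * (n.factorial * Real.exp (-b * ‖x‖ ^ 2) *
          ((1 + C) * (1 + ‖x‖) ^ m) ^ n) := by
          refine mul_le_mul (pow_le_pow_left₀ (norm_nonneg x) (by linarith) k) h2 (norm_nonneg _)
            (by positivity)
      _ = n.factorial * (1 + C) ^ n * ((1 + ‖x‖) ^ (k + m * n) * Real.exp (-b * ‖x‖ ^ 2)) := by
          rw [pow_add, pow_mul, mul_pow]; ring
      _ ≤ _ := by
          gcongr
          exact exp_neg_mul_sq_mul_pow_le hb _ (norm_nonneg x)
  · refine (h i hin x).trans ((?_ : _ ≤ (1 + C) * (1 + ‖x‖) ^ m).trans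
      (le_self_pow₀ hD1 (by omega)))
    gcongr
    linarith

/-- The Gaussian `exp(-b |x|²)` as a Schwartz function. -/
noncomputable def gaussianSchwartz (d : ℕ) {b : ℝ} (hb : 0 < b) : 𝓢(RSpace d, ℂ) :=
  SchwartzMap.postcompCLM (𝕜 := ℝ) Complex.ofRealCLM
    { toFun := fun x ↦ Real.exp (-b * ‖x‖ ^ 2)
      smooth' := (contDiff_const.mul (contDiff_norm_sq ℝ)).exp
      decay' := exists_norm_iteratedFDeriv_gaussian_le d hb }

theorem gaussianSchwartz_apply (d : ℕ) {b : ℝ} (hb : 0 < b) (x : RSpace d) :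
    gaussianSchwartz d hb x = (Real.exp (-b * ‖x‖ ^ 2) : ℂ) := by
  rw [gaussianSchwartz, SchwartzMap.postcompCLM_apply]
  simp only [Complex.ofRealCLM_apply]
  norm_cast

end GaussianSchwartz

/-! ### Commutation relations and ladder operators on Schwartz functions -/

section SchwartzOperators

variable {d : ℕ}

/-- The coordinate unit vector. -/
noncomputable def unitVec (j : Fin d) : RSpace d := EuclideanSpace.single j 1

theorem hasTemperateGrowth_coord (j : Fin d) :
    (fun x : RSpace d ↦ ((x j : ℝ) : ℂ)).HasTemperateGrowth :=
  (Complex.ofRealCLM ∘L (EuclideanSpace.proj j : RSpace d →L[ℝ] ℝ)).hasTemperateGrowth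

/-- Multiplication by the coordinate `x_j` on Schwartz functions. -/
noncomputable def coordMul (j : Fin d) : 𝓢(RSpace d, ℂ) →L[ℂ] 𝓢(RSpace d, ℂ) :=
  SchwartzMap.smulLeftCLM ℂ (fun x : RSpace d ↦ ((x j : ℝ) : ℂ))

/-- The partial derivative `∂_j` on Schwartz functions. -/
noncomputable def coordDeriv (j : Fin d) : 𝓢(RSpace d, ℂ) →L[ℂ] 𝓢(RSpace d, ℂ) :=
  LineDeriv.lineDerivOpCLM ℂ 𝓢(RSpace d, ℂ) (unitVec j)

theorem coordMul_apply (j : Fin d) (f : 𝓢(RSpace d, ℂ)) (x : RSpace d) :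
    coordMul j f x = (x j : ℂ) * f x := by
  rw [coordMul, SchwartzMap.smulLeftCLM_apply_apply (hasTemperateGrowth_coord j), smul_eq_mul]

theorem coordDeriv_apply (j : Fin d) (f : 𝓢(RSpace d, ℂ)) (x : RSpace d) :
    coordDeriv j f x = fderiv ℝ f x (unitVec j) := by
  rw [coordDeriv, LineDeriv.lineDerivOpCLM_apply, SchwartzMap.lineDerivOp_apply_eq_fderiv]

theorem coordMul_comm (j k : Fin d) (f : 𝓢(RSpace d, ℂ)) :
    coordMul j (coordMul k f) = coordMul k (coordMul j f) := by
  ext x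
  simp only [coordMul_apply]
  ring

theorem coordDeriv_comm (j k : Fin d) (f : 𝓢(RSpace d, ℂ)) :
    coordDeriv j (coordDeriv k f) = coordDeriv k (coordDeriv j f) := by
  ext x
  have h2 : Differentiable ℝ (fderiv ℝ f) :=
    ((f.smooth 2).fderiv_right (m := 1) (by norm_num)).differentiable one_ne_zero
  have key : ∀ j k : Fin d, coordDeriv j (coordDeriv k f) x =
      fderiv ℝ (fderiv ℝ f) x (unitVec j) (unitVec k) := by
    intro j k
    have h1 : (coordDeriv k f : RSpace d → ℂ) = fun y ↦ fderiv ℝ f y (unitVec k) :=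
      funext fun y ↦ coordDeriv_apply k f y
    rw [coordDeriv_apply, h1]
    rw [((h2 x).hasFDerivAt.clm_apply (hasFDerivAt_const _ x)).fderiv]
    simp
  rw [key, key]
  exact second_derivative_symmetric (fun y ↦ f.hasFDerivAt y) (h2 x).hasFDerivAt _ _

theorem coordDeriv_coordMul (j k : Fin d) (f : 𝓢(RSpace d, ℂ)) :
    coordDeriv j (coordMul k f) = coordMul k (coordDeriv j f) + if j = k then f else 0 := by
  ext x
  have h1 : (coordMul k f : RSpace d → ℂ) = fun y ↦
      (Complex.ofRealCLM ∘L (EuclideanSpace.proj k : RSpace d →L[ℝ] ℝ)) y * f y :=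
    funext fun y ↦ coordMul_apply k f y
  have h2 : HasFDerivAt (fun y ↦
      (Complex.ofRealCLM ∘L (EuclideanSpace.proj k : RSpace d →L[ℝ] ℝ)) y * f y) _ x :=
    ((Complex.ofRealCLM ∘L (EuclideanSpace.proj k : RSpace d →L[ℝ] ℝ)).hasFDerivAt).mul
      (f.hasFDerivAt x)
  rw [coordDeriv_apply, h1, h2.fderiv]
  rw [add_apply, add_apply, coordMul_apply, coordDeriv_apply]
  by_cases h : j = k
  · subst h
    simp [unitVec]
  · simp [unitVec, h, Ne.symm h]

/-- The operator `-Δ + |x|²` on Schwartz functions. -/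
noncomputable def schwartzOscillator (d : ℕ) : 𝓢(RSpace d, ℂ) →L[ℂ] 𝓢(RSpace d, ℂ) :=
  ∑ j, (coordMul j ∘L coordMul j - coordDeriv j ∘L coordDeriv j)

theorem schwartzOscillator_apply (f : 𝓢(RSpace d, ℂ)) : schwartzOscillator d f =
    ∑ j, (coordMul j (coordMul j f) - coordDeriv j (coordDeriv j f)) := by
  simp [schwartzOscillator]

theorem laplacian_eq_sum_coordDeriv (f : 𝓢(RSpace d, ℂ)) :
    Δ f = ∑ j, coordDeriv j (coordDeriv j f) := by
  rw [SchwartzMap.laplacian_eq_sum (EuclideanSpace.basisFun (Fin d) ℝ)]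
  simp [coordDeriv, unitVec]

theorem normSq_smul_eq_sum_coordMul (f : 𝓢(RSpace d, ℂ)) :
    SchwartzMap.smulLeftCLM ℂ (fun x : RSpace d ↦ ((‖x‖ ^ 2 : ℝ) : ℂ)) f =
      ∑ j, coordMul j (coordMul j f) := by
  ext x
  have h : (fun x : RSpace d ↦ ((‖x‖ ^ 2 : ℝ) : ℂ)).HasTemperateGrowth :=
    Function.HasTemperateGrowth.comp Complex.ofRealCLM.hasTemperateGrowth
      (Function.hasTemperateGrowth_norm_sq (RSpace d))
  rw [SchwartzMap.smulLeftCLM_apply_apply h, EuclideanSpace.norm_sq_eq]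
  simp only [sum_apply, coordMul_apply, smul_eq_mul]
  push_cast
  rw [Finset.sum_mul]
  refine Finset.sum_congr rfl fun j _ ↦ ?_
  rw [Real.norm_eq_abs, ← Complex.ofReal_pow, sq_abs]
  push_cast
  ring

theorem schwartzOscillator_eq (f : 𝓢(RSpace d, ℂ)) : schwartzOscillator d f =
    SchwartzMap.smulLeftCLM ℂ (fun x : RSpace d ↦ ((‖x‖ ^ 2 : ℝ) : ℂ)) f - Δ f := by
  rw [schwartzOscillator_apply, Finset.sum_sub_distrib, ← laplacian_eq_sum_coordDeriv,
    ← normSq_smul_eq_sum_coordMul]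

theorem schwartzOscillator_coordMul (k : Fin d) (f : 𝓢(RSpace d, ℂ)) :
    schwartzOscillator d (coordMul k f) =
      coordMul k (schwartzOscillator d f) - (2 : ℂ) • coordDeriv k f := by
  have h : ∀ j, coordMul j (coordMul j (coordMul k f)) - coordDeriv j (coordDeriv j (coordMul k f))
      = coordMul k (coordMul j (coordMul j f) - coordDeriv j (coordDeriv j f)) -
        if j = k then (2 : ℂ) • coordDeriv k f else 0 := by
    intro j
    rw [coordDeriv_coordMul, map_add, coordDeriv_coordMul, coordMul_comm j k, coordMul_comm j k,
      map_sub]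
    by_cases hjk : j = k
    · subst hjk
      simp only [if_true, two_smul]
      abel
    · simp [hjk]
  rw [schwartzOscillator_apply, Finset.sum_congr rfl fun j _ ↦ h j, Finset.sum_sub_distrib,
    ← map_sum, ← schwartzOscillator_apply]
  simp

theorem schwartzOscillator_coordDeriv (k : Fin d) (f : 𝓢(RSpace d, ℂ)) :
    schwartzOscillator d (coordDeriv k f) =
      coordDeriv k (schwartzOscillator d f) - (2 : ℂ) • coordMul k f := by
  have hc : ∀ (j : Fin d) (f : 𝓢(RSpace d, ℂ)), coordMul j (coordDeriv k f) =
      coordDeriv k (coordMul j f) - if k = j then f else 0 := by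
    intro j f
    rw [coordDeriv_coordMul, add_sub_cancel_right]
  have h : ∀ j, coordMul j (coordMul j (coordDeriv k f)) -
        coordDeriv j (coordDeriv j (coordDeriv k f))
      = coordDeriv k (coordMul j (coordMul j f) - coordDeriv j (coordDeriv j f)) -
        if k = j then (2 : ℂ) • coordMul k f else 0 := by
    intro j
    rw [hc, map_sub, hc, coordDeriv_comm j k, coordDeriv_comm j k, map_sub]
    by_cases hjk : k = j
    · subst hjk
      simp only [if_true, two_smul]
      abel
    · simp [hjk]
  rw [schwartzOscillator_apply, Finset.sum_congr rfl fun j _ ↦ h j, Finset.sum_sub_distrib,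
    ← map_sum, ← schwartzOscillator_apply]
  simp

/-- Schwartz eigenfunctions of the oscillator. -/
noncomputable def schwartzEigenspace (d : ℕ) (r : ℝ) : Submodule ℂ 𝓢(RSpace d, ℂ) :=
  Module.End.eigenspace (schwartzOscillator d : 𝓢(RSpace d, ℂ) →ₗ[ℂ] 𝓢(RSpace d, ℂ)) (r : ℂ)

theorem mem_schwartzEigenspace {r : ℝ} {f : 𝓢(RSpace d, ℂ)} :
    f ∈ schwartzEigenspace d r ↔ schwartzOscillator d f = (r : ℂ) • f := by
  rw [schwartzEigenspace, Module.End.mem_eigenspace_iff]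
  rfl

/-- The ladder operators `x_j + ∂_j` and `x_j - ∂_j` shift the eigenvalue by `-2` and `+2`, and
`x_j` is half their sum. Hence all polynomial multiples of the ground state are sums of
eigenfunctions. -/
theorem coordMul_mem_iSup {f : 𝓢(RSpace d, ℂ)} (j : Fin d)
    (hf : f ∈ ⨆ r, schwartzEigenspace d r) : coordMul j f ∈ ⨆ r, schwartzEigenspace d r := by
  induction hf using Submodule.iSup_induction' with
  | mem r f hf =>
    have hf := mem_schwartzEigenspace.1 hf
    have h1 : coordMul j f + coordDeriv j f ∈ schwartzEigenspace d (r - 2) := by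
      rw [mem_schwartzEigenspace, map_add, schwartzOscillator_coordMul,
        schwartzOscillator_coordDeriv, hf, map_smul, map_smul]
      push_cast
      module
    have h2 : coordMul j f - coordDeriv j f ∈ schwartzEigenspace d (r + 2) := by
      rw [mem_schwartzEigenspace, map_sub, schwartzOscillator_coordMul,
        schwartzOscillator_coordDeriv, hf, map_smul, map_smul]
      push_cast
      module
    have h3 : coordMul j f = (2⁻¹ : ℂ) • ((coordMul j f + coordDeriv j f) +
        (coordMul j f - coordDeriv j f)) := by
      module
    rw [h3]
    exact Submodule.smul_mem _ _ (Submodule.add_mem _ (Submodule.mem_iSup_of_mem _ h1)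
      (Submodule.mem_iSup_of_mem _ h2))
  | zero => simp
  | add f g _ _ hf hg => rw [map_add]; exact Submodule.add_mem _ hf hg

/-- The ground state `exp(-|x|²/2)`. -/
noncomputable def groundState (d : ℕ) : 𝓢(RSpace d, ℂ) :=
  gaussianSchwartz d (b := 1 / 2) (by norm_num)

theorem coordDeriv_groundState (j : Fin d) :
    coordDeriv j (groundState d) = -coordMul j (groundState d) := by
  ext x
  have h1 : (groundState d : RSpace d → ℂ) = fun y ↦
      ((Real.exp (-(1 / 2) * ‖y‖ ^ 2) : ℝ) : ℂ) := by
    funext y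
    rw [groundState, gaussianSchwartz_apply]
  have h2 : HasFDerivAt (fun y : RSpace d ↦ ((Real.exp (-(1 / 2) * ‖y‖ ^ 2) : ℝ) : ℂ)) _ x :=
    Complex.ofRealCLM.hasFDerivAt.comp x
      (((hasStrictFDerivAt_norm_sq x).hasFDerivAt.const_mul (-(1 / 2) : ℝ)).exp)
  rw [coordDeriv_apply, neg_apply, coordMul_apply]
  rw [h1, h2.fderiv]
  simp [unitVec, EuclideanSpace.inner_single_right, mul_comm]

theorem groundState_mem : groundState d ∈ schwartzEigenspace d d := by
  rw [mem_schwartzEigenspace, schwartzOscillator_apply]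
  simp only [coordDeriv_groundState, map_neg, coordDeriv_coordMul, if_true, neg_add, map_neg]
  simp [Finset.sum_const, Nat.cast_smul_eq_nsmul]

end SchwartzOperators

/-! ### The oscillator form in `L²` and its distributional eigenspaces -/

section SchwartzL2

variable {d : ℕ}

theorem inner_self_eq_ofReal {H : Type*} [NormedAddCommGroup H] [InnerProductSpace ℂ H] (u : H) :
    inner ℂ u u = ((‖u‖ ^ 2 : ℝ) : ℂ) := by
  rw [inner_self_eq_norm_sq_to_K]
  simp

/-- Complex conjugation on Schwartz functions. -/
noncomputable def schwartzConj (f : 𝓢(RSpace d, ℂ)) : 𝓢(RSpace d, ℂ) :=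
  SchwartzMap.postcompCLM (𝕜 := ℝ) (Complex.conjCLE : ℂ →L[ℝ] ℂ) f

theorem schwartzConj_apply (f : 𝓢(RSpace d, ℂ)) (x : RSpace d) :
    schwartzConj f x = (starRingEnd ℂ) (f x) := by
  rw [schwartzConj, SchwartzMap.postcompCLM_apply]
  rfl

theorem coordMul_schwartzConj (j : Fin d) (f : 𝓢(RSpace d, ℂ)) :
    coordMul j (schwartzConj f) = schwartzConj (coordMul j f) := by
  ext x
  simp [coordMul_apply, schwartzConj_apply]

theorem coordDeriv_schwartzConj (j : Fin d) (f : 𝓢(RSpace d, ℂ)) :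
    coordDeriv j (schwartzConj f) = schwartzConj (coordDeriv j f) := by
  ext x
  have h1 : (schwartzConj f : RSpace d → ℂ) = fun y ↦ (Complex.conjCLE : ℂ →L[ℝ] ℂ) (f y) :=
    funext fun y ↦ schwartzConj_apply f y
  have h2 : HasFDerivAt (fun y ↦ (Complex.conjCLE : ℂ →L[ℝ] ℂ) (f y)) _ x :=
    (Complex.conjCLE : ℂ →L[ℝ] ℂ).hasFDerivAt.comp x (f.hasFDerivAt x)
  rw [coordDeriv_apply, h1, h2.fderiv, schwartzConj_apply, coordDeriv_apply]
  rfl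

theorem schwartzOscillator_schwartzConj (f : 𝓢(RSpace d, ℂ)) :
    schwartzOscillator d (schwartzConj f) = schwartzConj (schwartzOscillator d f) := by
  ext x
  rw [schwartzConj_apply, schwartzOscillator_apply, schwartzOscillator_apply, sum_apply, sum_apply,
    map_sum]
  refine Finset.sum_congr rfl fun j _ ↦ ?_
  simp [coordMul_schwartzConj, coordDeriv_schwartzConj, schwartzConj_apply]

/-- The inclusion of Schwartz functions into `L²`. -/
noncomputable def schwartzToL2 (d : ℕ) : 𝓢(RSpace d, ℂ) →L[ℂ] L2Space d :=
  SchwartzMap.toLpCLM ℂ ℂ 2 volume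

theorem coeFn_schwartzToL2 (f : 𝓢(RSpace d, ℂ)) : schwartzToL2 d f =ᵐ[volume] f :=
  f.coeFn_toLp 2 volume

theorem inner_schwartzToL2 (f : 𝓢(RSpace d, ℂ)) (u : L2Space d) :
    inner ℂ (schwartzToL2 d f) u = ∫ x, schwartzConj f x * u x := by
  rw [L2.inner_def]
  refine integral_congr_ae ?_
  filter_upwards [coeFn_schwartzToL2 f] with x hx
  rw [hx, schwartzConj_apply, RCLike.inner_apply, mul_comm]

theorem inner_schwartzToL2_schwartzToL2 (f g : 𝓢(RSpace d, ℂ)) :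
    inner ℂ (schwartzToL2 d f) (schwartzToL2 d g) = ∫ x, schwartzConj f x * g x := by
  rw [inner_schwartzToL2]
  refine integral_congr_ae ?_
  filter_upwards [coeFn_schwartzToL2 g] with x hx
  rw [hx]

theorem inner_schwartzToL2_coordMul (j : Fin d) (f g : 𝓢(RSpace d, ℂ)) :
    inner ℂ (schwartzToL2 d f) (schwartzToL2 d (coordMul j g)) =
      inner ℂ (schwartzToL2 d (coordMul j f)) (schwartzToL2 d g) := by
  rw [inner_schwartzToL2_schwartzToL2, inner_schwartzToL2_schwartzToL2, ← coordMul_schwartzConj]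
  refine integral_congr_ae (Filter.Eventually.of_forall fun x ↦ ?_)
  simp only [coordMul_apply]
  ring

theorem inner_schwartzToL2_coordDeriv (j : Fin d) (f g : 𝓢(RSpace d, ℂ)) :
    inner ℂ (schwartzToL2 d f) (schwartzToL2 d (coordDeriv j g)) =
      -inner ℂ (schwartzToL2 d (coordDeriv j f)) (schwartzToL2 d g) := by
  rw [inner_schwartzToL2_schwartzToL2, inner_schwartzToL2_schwartzToL2, ← coordDeriv_schwartzConj,
    ← integral_neg]
  rw [coordDeriv, LineDeriv.lineDerivOpCLM_apply, LineDeriv.lineDerivOpCLM_apply,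
    SchwartzMap.integral_mul_lineDerivOp_right_eq_neg_left, integral_neg]

theorem inner_schwartzToL2_schwartzOscillator (f : 𝓢(RSpace d, ℂ)) :
    inner ℂ (schwartzToL2 d f) (schwartzToL2 d (schwartzOscillator d f)) =
      ((∑ j, (‖schwartzToL2 d (coordMul j f)‖ ^ 2 + ‖schwartzToL2 d (coordDeriv j f)‖ ^ 2) : ℝ)
        : ℂ) := by
  rw [schwartzOscillator_apply, map_sum, inner_sum, Complex.ofReal_sum]
  refine Finset.sum_congr rfl fun j _ ↦ ?_
  rw [map_sub, inner_sub_right, inner_schwartzToL2_coordMul, inner_schwartzToL2_coordDeriv,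
    inner_self_eq_ofReal, inner_self_eq_ofReal]
  push_cast
  ring

/-- Heisenberg's uncertainty principle in one coordinate. -/
theorem norm_sq_le_coordMul_add_coordDeriv (j : Fin d) (f : 𝓢(RSpace d, ℂ)) :
    ‖schwartzToL2 d f‖ ^ 2 ≤
      ‖schwartzToL2 d (coordMul j f)‖ ^ 2 + ‖schwartzToL2 d (coordDeriv j f)‖ ^ 2 := by
  -- The commutator `∂_j x_j - x_j ∂_j = 1` gives `2 Re⟨x_j f, ∂_j f⟩ = -‖f‖²`; the claim follows
  -- from `‖(x_j + ∂_j) f‖² ≥ 0`.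
  have h1 : inner ℂ (schwartzToL2 d (coordMul j f)) (schwartzToL2 d (coordDeriv j f)) +
      inner ℂ (schwartzToL2 d (coordDeriv j f)) (schwartzToL2 d (coordMul j f)) =
      -((‖schwartzToL2 d f‖ ^ 2 : ℝ) : ℂ) := by
    rw [← inner_schwartzToL2_coordMul, ← neg_eq_iff_eq_neg.2 (inner_schwartzToL2_coordDeriv j f _),
      coordDeriv_coordMul, if_pos rfl, map_add, inner_add_right, inner_self_eq_ofReal]
    ring
  have h2 := norm_add_sq (𝕜 := ℂ) (schwartzToL2 d (coordMul j f)) (schwartzToL2 d (coordDeriv j f))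
  have h3 := congrArg Complex.re h1
  rw [Complex.add_re, ← inner_conj_symm, Complex.conj_re, Complex.neg_re, Complex.ofReal_re,
    ← inner_conj_symm, Complex.conj_re] at h3
  have h4 : RCLike.re (inner ℂ (schwartzToL2 d (coordMul j f)) (schwartzToL2 d (coordDeriv j f))) =
    (inner ℂ (schwartzToL2 d (coordMul j f)) (schwartzToL2 d (coordDeriv j f))).re := rfl
  have h5 : (inner ℂ (schwartzToL2 d (coordDeriv j f)) (schwartzToL2 d (coordMul j f))).re =
    (inner ℂ (schwartzToL2 d (coordMul j f)) (schwartzToL2 d (coordDeriv j f))).re := by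
    rw [← inner_conj_symm, Complex.conj_re]
  rw [h4] at h2
  have := sq_nonneg ‖schwartzToL2 d (coordMul j f) + schwartzToL2 d (coordDeriv j f)‖
  linarith

/-- Summing the uncertainty inequality over the coordinates gives `-Δ + |x|² ≥ d`, which the
constant `e^e / d` turns into `h ≥ e^e`. -/
theorem le_of_mem_schwartzEigenspace {r : ℝ} {f : 𝓢(RSpace d, ℂ)} (hf : f ∈ schwartzEigenspace d r)
    (h0 : schwartzToL2 d f ≠ 0) : (d : ℝ) ≤ r := by
  have h := inner_schwartzToL2_schwartzOscillator f
  rw [mem_schwartzEigenspace.1 hf, map_smul, inner_smul_right, inner_self_eq_ofReal, ← Complex.ofReal_mul] at h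
  have h1 : r * ‖schwartzToL2 d f‖ ^ 2 = ∑ j, (‖schwartzToL2 d (coordMul j f)‖ ^ 2 +
      ‖schwartzToL2 d (coordDeriv j f)‖ ^ 2) := by
    exact_mod_cast h
  have h2 : (d : ℝ) * ‖schwartzToL2 d f‖ ^ 2 ≤ r * ‖schwartzToL2 d f‖ ^ 2 := by
    rw [h1]
    calc (d : ℝ) * ‖schwartzToL2 d f‖ ^ 2 = ∑ _j : Fin d, ‖schwartzToL2 d f‖ ^ 2 := by simp
      _ ≤ _ := Finset.sum_le_sum fun j _ ↦ norm_sq_le_coordMul_add_coordDeriv j f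
  exact le_of_mul_le_mul_right h2 (by positivity)

/-- The constant in front of the harmonic oscillator. -/
noncomputable def oscillatorConst (d : ℕ) : ℝ := Real.exp (Real.exp 1) / d

theorem oscillatorConst_pos (hd : 1 ≤ d) : 0 < oscillatorConst d :=
  div_pos (Real.exp_pos _) (by exact_mod_cast hd)

/-- By duality the oscillator acts on the test function, so the eigenvalue equation becomes a family
of integral identities that require no regularity of `u`. -/
theorem mem_harmonicEigenspace_iff {t : ℝ} {u : L2Space d} : u ∈ harmonicEigenspace d t ↔
    ∀ g : 𝓢(RSpace d, ℂ), (oscillatorConst d : ℂ) * ∫ x, schwartzOscillator d g x * u x =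
      (t : ℂ) * ∫ x, g x * u x := by
  have key : ∀ g : 𝓢(RSpace d, ℂ), (harmonicOscillator d
      (Lp.toTemperedDistributionCLM ℂ (volume : Measure (RSpace d)) 2 u)) g =
      (oscillatorConst d : ℂ) * ∫ x, schwartzOscillator d g x * u x := by
    intro g
    rw [harmonicOscillator]
    have h1 : ∫ x, schwartzOscillator d g x * u x =
        Lp.toTemperedDistribution u (schwartzOscillator d g) := by
      rw [Lp.toTemperedDistribution_apply]
      rfl
    rw [h1, schwartzOscillator_eq, map_sub, ← TemperedDistribution.smulLeftCLM_apply_apply,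
      ← TemperedDistribution.laplacian_apply_apply, ← TemperedDistribution.laplacianCLM_apply]
    rfl
  have key2 : ∀ g : 𝓢(RSpace d, ℂ), (Lp.toTemperedDistributionCLM ℂ (volume : Measure (RSpace d)) 2
      u) g = ∫ x, g x * u x := by
    intro g
    rw [Lp.toTemperedDistributionCLM_apply, Lp.toTemperedDistribution_apply]
    rfl
  rw [harmonicEigenspace, LinearMap.mem_ker]
  constructor
  · intro h g
    have h2 := congrArg (fun T : 𝓢'(RSpace d, ℂ) ↦ T g) h
    rw [← key, ← key2]
    exact sub_eq_zero.1 h2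
  · intro h
    refine DFunLike.ext _ _ fun g ↦ ?_
    have h2 := h g
    rw [← key, ← key2] at h2
    exact sub_eq_zero.2 h2

theorem integral_schwartzOscillator_mul (f g : 𝓢(RSpace d, ℂ)) :
    ∫ x, schwartzOscillator d g x * f x = ∫ x, g x * schwartzOscillator d f x := by
  have h : ∀ f g : 𝓢(RSpace d, ℂ), ∫ x, schwartzConj g x * f x =
      inner ℂ (schwartzToL2 d g) (schwartzToL2 d f) := fun f g ↦
    (inner_schwartzToL2_schwartzToL2 g f).symm
  have h2 : schwartzConj (schwartzConj g) = g := by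
    ext x
    simp [schwartzConj_apply]
  rw [← h2, schwartzOscillator_schwartzConj, h, h, schwartzOscillator_apply,
    schwartzOscillator_apply, map_sum, map_sum, sum_inner, inner_sum]
  refine Finset.sum_congr rfl fun j _ ↦ ?_
  rw [map_sub, map_sub, inner_sub_left, inner_sub_right, ← inner_schwartzToL2_coordMul,
    ← inner_schwartzToL2_coordMul, inner_schwartzToL2_coordDeriv, inner_schwartzToL2_coordDeriv,
    neg_neg]

theorem schwartzToL2_mem_harmonicEigenspace {r : ℝ} {f : 𝓢(RSpace d, ℂ)}
    (hf : f ∈ schwartzEigenspace d r) :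
    schwartzToL2 d f ∈ harmonicEigenspace d (oscillatorConst d * r) := by
  rw [mem_harmonicEigenspace_iff]
  intro g
  have h : ∀ g : 𝓢(RSpace d, ℂ), ∫ x, g x * schwartzToL2 d f x = ∫ x, g x * f x := fun g ↦
    integral_congr_ae (by filter_upwards [coeFn_schwartzToL2 f] with x hx; rw [hx])
  rw [h, h, integral_schwartzOscillator_mul, mem_schwartzEigenspace.1 hf]
  simp only [smul_apply, smul_eq_mul, mul_left_comm _ (r : ℂ)]
  rw [integral_const_mul]
  push_cast
  ring

/-- The weak equation for `u`, tested with the conjugate of `f`, equates two different multiples of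
the same inner product. Only `f` has to be smooth. -/
theorem inner_eq_zero_of_mem_harmonicEigenspace {r t : ℝ} {f : 𝓢(RSpace d, ℂ)} {u : L2Space d}
    (hf : f ∈ schwartzEigenspace d r) (hu : u ∈ harmonicEigenspace d t)
    (hrt : oscillatorConst d * r ≠ t) : inner ℂ (schwartzToL2 d f) u = 0 := by
  have h := mem_harmonicEigenspace_iff.1 hu (schwartzConj f)
  have h2 : schwartzOscillator d (schwartzConj f) = (r : ℂ) • schwartzConj f := by
    rw [schwartzOscillator_schwartzConj, mem_schwartzEigenspace.1 hf]
    ext x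
    simp [schwartzConj_apply]
  rw [h2] at h
  simp only [smul_apply, smul_eq_mul, mul_assoc] at h
  rw [integral_const_mul, ← inner_schwartzToL2, ← mul_assoc, ← sub_eq_zero, ← sub_mul] at h
  refine (mul_eq_zero.1 h).resolve_left ?_
  refine sub_ne_zero.2 ?_
  exact_mod_cast hrt

end SchwartzL2

/-! ### Totality of the eigenfunctions -/

section Totality

variable {d : ℕ}

/-- Multiplication by the linear form `⟪x, ξ⟫` on Schwartz functions. -/
noncomputable def innerMul (ξ : RSpace d) : 𝓢(RSpace d, ℂ) →L[ℂ] 𝓢(RSpace d, ℂ) :=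
  ∑ j, ((ξ j : ℝ) : ℂ) • coordMul j

theorem innerMul_apply (ξ : RSpace d) (f : 𝓢(RSpace d, ℂ)) (x : RSpace d) :
    innerMul ξ f x = ((inner ℝ x ξ : ℝ) : ℂ) * f x := by
  rw [innerMul, sum_apply, sum_apply, PiLp.inner_apply]
  push_cast
  rw [Finset.sum_mul]
  refine Finset.sum_congr rfl fun j _ ↦ ?_
  simp [coordMul_apply, mul_assoc]

theorem innerMul_iterate_apply (ξ : RSpace d) (n : ℕ) (x : RSpace d) :
    ((innerMul ξ)^[n] (groundState d)) x =
      (((inner ℝ x ξ : ℝ) ^ n * Real.exp (-(1 / 2) * ‖x‖ ^ 2) : ℝ) : ℂ) := by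
  induction n with
  | zero => simp [groundState, gaussianSchwartz_apply]
  | succ n ih =>
    rw [Function.iterate_succ_apply', innerMul_apply, ih, ← Complex.ofReal_mul, pow_succ']
    congr 1
    ring

theorem innerMul_iterate_mem (ξ : RSpace d) (n : ℕ) :
    (innerMul ξ)^[n] (groundState d) ∈ ⨆ r, schwartzEigenspace d r := by
  induction n with
  | zero => exact Submodule.mem_iSup_of_mem _ groundState_mem
  | succ n ih =>
    rw [Function.iterate_succ_apply', innerMul, sum_apply]
    exact Submodule.sum_mem _ fun j _ ↦ Submodule.smul_mem _ _ (coordMul_mem_iSup j ih)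

theorem inner_eq_zero_of_mem_iSup {u : L2Space d}
    (h : ∀ r, ∀ f ∈ schwartzEigenspace d r, inner ℂ (schwartzToL2 d f) u = 0)
    {f : 𝓢(RSpace d, ℂ)} (hf : f ∈ ⨆ r, schwartzEigenspace d r) :
    inner ℂ (schwartzToL2 d f) u = 0 := by
  induction hf using Submodule.iSup_induction' with
  | mem r f hf => exact h r f hf
  | zero => simp
  | add f g _ _ hf hg => rw [map_add, inner_add_left, hf, hg, add_zero]

theorem memLp_exp_mul_gaussian (d : ℕ) (a : ℝ) :
    MemLp (fun x : RSpace d ↦ Real.exp (a * ‖x‖) * Real.exp (-(1 / 2) * ‖x‖ ^ 2)) 2 := by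
  have h1 := ((gaussianSchwartz d (b := 1 / 4) (by norm_num)).memLp 2 volume).const_mul
    ((Real.exp (a ^ 2) : ℝ) : ℂ)
  refine h1.of_le (Continuous.aestronglyMeasurable (by fun_prop))
    (Filter.Eventually.of_forall fun x ↦ ?_)
  rw [gaussianSchwartz_apply, ← Complex.ofReal_mul, Complex.norm_real, ← Real.exp_add,
    ← Real.exp_add, Real.norm_eq_abs, Real.norm_eq_abs, Real.abs_exp, Real.abs_exp]
  refine Real.exp_le_exp.2 ?_
  nlinarith [sq_nonneg (2 * a - ‖x‖), norm_nonneg x]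

/-- The Schwartz eigenfunctions of the oscillator are total in `L²`. -/
theorem eq_zero_of_forall_inner_eigenfunction {u : L2Space d}
    (h : ∀ r, ∀ f ∈ schwartzEigenspace d r, inner ℂ (schwartzToL2 d f) u = 0) : u = 0 := by
  set γ : RSpace d → ℝ := fun x ↦ Real.exp (-(1 / 2) * ‖x‖ ^ 2) with hγ
  -- Polynomials times the ground state are sums of eigenfunctions, so all moments of `γ u` vanish.
  have hpoly : ∀ (ξ : RSpace d) (n : ℕ), ∫ x, (((inner ℝ x ξ : ℝ) ^ n * γ x : ℝ) : ℂ) * u x = 0 := by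
    intro ξ n
    rw [← inner_eq_zero_of_mem_iSup h (innerMul_iterate_mem ξ n), inner_schwartzToL2]
    refine integral_congr_ae (Filter.Eventually.of_forall fun x ↦ ?_)
    simp only [schwartzConj_apply, innerMul_iterate_apply, Complex.conj_ofReal, hγ]
  have hγc : Continuous γ := by fun_prop
  have hum := (Lp.memLp u).1
  have hexp : ∀ a : ℝ, Integrable fun x ↦ Real.exp (a * ‖x‖) * γ x * ‖u x‖ := fun a ↦
    (memLp_exp_mul_gaussian d a).integrable_mul (Lp.memLp u).norm
  -- Expanding the phase in a power series reduces the Fourier integral of `γ u` to its moments. The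
  -- interchange is dominated by `exp(a|x|) γ |u|`, which is integrable for every `a`.
  have hF : ∀ ξ, 𝓕 (fun x ↦ (γ x : ℂ) * u x) ξ = 0 := by
    intro ξ
    rw [Real.fourier_eq']
    have hs : HasSum (fun n : ℕ ↦ ∫ x, ((-2 * Real.pi * Complex.I) ^ n / n.factorial : ℂ) *
        ((((inner ℝ x ξ : ℝ) ^ n * γ x : ℝ) : ℂ) * u x))
        (∫ x, Complex.exp (((-2 * Real.pi * inner ℝ x ξ : ℝ) : ℂ) * Complex.I) •
          ((γ x : ℂ) * u x)) := by
      refine hasSum_integral_of_dominated_convergence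
        (fun n x ↦ (2 * Real.pi * ‖ξ‖ * ‖x‖) ^ n / n.factorial * (γ x * ‖u x‖)) (fun n ↦ ?_)
        (fun n ↦ Filter.Eventually.of_forall fun x ↦ ?_)
        (Filter.Eventually.of_forall fun x ↦ ?_) ?_ (Filter.Eventually.of_forall fun x ↦ ?_)
      · refine AEStronglyMeasurable.const_mul (AEStronglyMeasurable.mul ?_ hum) _
        exact Continuous.aestronglyMeasurable (by fun_prop)
      · rw [norm_mul, norm_mul, norm_div, norm_pow, Complex.norm_real, Real.norm_eq_abs, abs_mul,
          abs_pow, hγ, Real.abs_exp]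
        have h1 : ‖(-2 * Real.pi * Complex.I : ℂ)‖ = 2 * Real.pi := by
          simp [abs_of_pos Real.pi_pos]
        rw [h1, Complex.norm_natCast]
        have h2 : |inner ℝ x ξ| ^ n ≤ (‖x‖ * ‖ξ‖) ^ n :=
          pow_le_pow_left₀ (abs_nonneg _) (abs_real_inner_le_norm x ξ) n
        calc (2 * Real.pi) ^ n / n.factorial * (|inner ℝ x ξ| ^ n *
              Real.exp (-(1 / 2) * ‖x‖ ^ 2) * ‖u x‖)
            ≤ (2 * Real.pi) ^ n / n.factorial * ((‖x‖ * ‖ξ‖) ^ n *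
              Real.exp (-(1 / 2) * ‖x‖ ^ 2) * ‖u x‖) := by gcongr
          _ = _ := by simp only [mul_pow]; ring
      · exact (Real.summable_pow_div_factorial _).mul_right _
      · refine (hexp (2 * Real.pi * ‖ξ‖)).congr (Filter.Eventually.of_forall fun x ↦ ?_)
        simp only
        rw [tsum_mul_right, (NormedSpace.expSeries_div_hasSum_exp (2 * Real.pi * ‖ξ‖ * ‖x‖)).tsum_eq,
          ← Real.exp_eq_exp_ℝ, mul_assoc]
      · have := (NormedSpace.expSeries_div_hasSum_exp (𝔸 := ℂ)
          ((-2 * Real.pi * inner ℝ x ξ : ℝ) * Complex.I)).mul_right ((γ x : ℂ) * u x)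
        rw [← Complex.exp_eq_exp_ℂ] at this
        refine this.congr_fun ?_
        intro n
        push_cast
        simp only [mul_pow]
        ring
    refine hs.unique ?_
    convert hasSum_zero with n
    rw [integral_const_mul, hpoly, mul_zero]
  have hi : Integrable (fun x ↦ (γ x : ℂ) * u x) := by
    refine (hexp 0).mono' ((by fun_prop : Continuous fun x ↦ (γ x : ℂ)).aestronglyMeasurable.mul hum)
      (Filter.Eventually.of_forall fun x ↦ ?_)
    rw [norm_mul, Complex.norm_real, Real.norm_eq_abs, hγ, Real.abs_exp, zero_mul, Real.exp_zero,
      one_mul]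
  have hm : MemLp (fun x ↦ (γ x : ℂ) * u x) 2 := by
    refine (Lp.memLp u).of_le hi.1 (Filter.Eventually.of_forall fun x ↦ ?_)
    rw [norm_mul, Complex.norm_real, hγ, Real.norm_eq_abs, Real.abs_exp]
    refine mul_le_of_le_one_left (norm_nonneg _) (Real.exp_le_one_iff.2 ?_)
    nlinarith [sq_nonneg ‖x‖]
  -- As `γ u` is in `L¹ ∩ L²`, Plancherel gives `γ u = 0`, and `γ` has no zeros.
  have h0 : 𝓕 hm.toLp = (0 : L2Space d) := by
    refine Lp.ext ?_
    filter_upwards [coeFn_fourier_toLp hi hm, Lp.coeFn_zero ℂ 2 (volume : Measure (RSpace d))]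
      with x hx h0
    rw [hx, h0, hF]
    rfl
  have h1 : hm.toLp = (0 : L2Space d) := by
    rw [← norm_eq_zero, ← Lp.norm_fourier_eq, h0, norm_zero]
  refine Lp.ext ?_
  filter_upwards [hm.coeFn_toLp, Lp.coeFn_zero ℂ 2 (volume : Measure (RSpace d))] with x hx h0
  rw [h1] at hx
  rw [h0] at hx ⊢
  have : (γ x : ℂ) ≠ 0 := by exact_mod_cast (Real.exp_pos _).ne'
  exact (mul_eq_zero.1 hx.symm).resolve_left this

end Totality

/-! ### Distributional eigenspaces as closures of smooth ones -/

section Eigenspaces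

variable {d : ℕ}

/-- The image in `L²` of the Schwartz eigenfunctions for the eigenvalue `t` of the harmonic
oscillator. -/
noncomputable def smoothEigenspace (d : ℕ) (t : ℝ) : Submodule ℂ (L2Space d) :=
  (schwartzEigenspace d (t / oscillatorConst d)).map (schwartzToL2 d : _ →ₗ[ℂ] L2Space d)

theorem mem_smoothEigenspace {t : ℝ} {u : L2Space d} : u ∈ smoothEigenspace d t ↔
    ∃ f ∈ schwartzEigenspace d (t / oscillatorConst d), schwartzToL2 d f = u := by
  rw [smoothEigenspace, Submodule.mem_map]
  rfl

/-- The part of a distributional eigenvector orthogonal to the smooth eigenvectors for `t` is also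
orthogonal to those for all other eigenvalues, hence zero by totality. Finite-dimensionality of the
eigenspaces is not needed. -/
theorem harmonicEigenspace_eq_closure (hd : 1 ≤ d) (t : ℝ) :
    harmonicEigenspace d t = (smoothEigenspace d t).topologicalClosure := by
  have hc := oscillatorConst_pos hd
  have hcl : IsClosed (harmonicEigenspace d t : Set (L2Space d)) :=
    (completeSpace_coe_iff_isComplete.1
      (instCompleteSpaceHarmonicEigenspace d t)).isClosed
  have hle : (smoothEigenspace d t).topologicalClosure ≤ harmonicEigenspace d t := by
    refine Submodule.topologicalClosure_minimal _ (fun u hu ↦ ?_) hcl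
    obtain ⟨f, hf, rfl⟩ := mem_smoothEigenspace.1 hu
    have := schwartzToL2_mem_harmonicEigenspace hf
    rwa [mul_div_cancel₀ _ hc.ne'] at this
  refine le_antisymm (fun u hu ↦ ?_) hle
  set V := (smoothEigenspace d t).topologicalClosure with hV
  have hVc : CompleteSpace V := (Submodule.isClosed_topologicalClosure _).completeSpace_coe
  have hw : u - V.starProjection u ∈ harmonicEigenspace d t :=
    Submodule.sub_mem _ hu (hle (Submodule.starProjection_apply_mem V u))
  have h0 : u - V.starProjection u = 0 := by
    refine eq_zero_of_forall_inner_eigenfunction fun r f hf ↦ ?_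
    by_cases hr : oscillatorConst d * r = t
    · refine Submodule.inner_right_of_mem_orthogonal (K := V) ?_
        (Submodule.sub_starProjection_mem_orthogonal u)
      refine Submodule.le_topologicalClosure _ (mem_smoothEigenspace.2 ⟨f, ?_, rfl⟩)
      rwa [← hr, mul_div_cancel_left₀ _ hc.ne']
    · exact inner_eq_zero_of_mem_harmonicEigenspace hf hw hr
  rw [sub_eq_zero.1 h0]
  exact Submodule.starProjection_apply_mem V u

theorem harmonicEigenspace_orthogonal (hd : 1 ≤ d) {s t : ℝ} (hst : s ≠ t) :
    harmonicEigenspace d s ⟂ harmonicEigenspace d t := by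
  have hc := oscillatorConst_pos hd
  rw [Submodule.isOrtho_iff_le, harmonicEigenspace_eq_closure hd s]
  refine Submodule.topologicalClosure_minimal _ (fun u hu ↦ ?_) (Submodule.isClosed_orthogonal _)
  obtain ⟨f, hf, rfl⟩ := mem_smoothEigenspace.1 hu
  rw [Submodule.mem_orthogonal']
  intro w hw
  exact inner_eq_zero_of_mem_harmonicEigenspace hf hw (by rwa [mul_div_cancel₀ _ hc.ne'])

theorem smoothEigenspace_eq_bot (hd : 1 ≤ d) {t : ℝ} (ht : t < Real.exp (Real.exp 1)) :
    smoothEigenspace d t = ⊥ := by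
  have hc := oscillatorConst_pos hd
  rw [eq_bot_iff]
  intro u hu
  obtain ⟨f, hf, rfl⟩ := mem_smoothEigenspace.1 hu
  by_contra h
  have h1 := le_of_mem_schwartzEigenspace hf h
  rw [le_div_iff₀ hc, oscillatorConst, mul_div_cancel₀] at h1
  · linarith
  · exact_mod_cast (by omega : d ≠ 0)

theorem harmonicEigenspace_eq_bot (hd : 1 ≤ d) {t : ℝ} (ht : t < Real.exp (Real.exp 1)) :
    harmonicEigenspace d t = ⊥ := by
  rw [harmonicEigenspace_eq_closure hd, smoothEigenspace_eq_bot hd ht,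
    Submodule.topologicalClosure_eq_self]

end Eigenspaces

/-! ### Translation estimates on spectral subspaces -/

section Translation

variable {d : ℕ}

/-- The fundamental theorem of calculus is combined with Cauchy-Schwarz on the unit interval. -/
theorem enorm_sq_sub_le_setLIntegral {G G' : ℝ → ℂ} (hG : ∀ s, HasDerivAt G (G' s) s)
    (hc : Continuous G') :
    ‖G 1 - G 0‖ₑ ^ 2 ≤ ∫⁻ s in Set.Icc (0 : ℝ) 1, ‖G' s‖ₑ ^ 2 := by
  have h1 : G 1 - G 0 = ∫ s in (0 : ℝ)..1, G' s :=
    (intervalIntegral.integral_eq_sub_of_hasDerivAt (fun s _ ↦ hG s)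
      (hc.intervalIntegrable 0 1)).symm
  rw [h1, intervalIntegral.integral_of_le zero_le_one, ← integral_Icc_eq_integral_Ioc]
  have h2 : ‖∫ s in Set.Icc (0 : ℝ) 1, G' s‖ₑ ≤ ∫⁻ s in Set.Icc (0 : ℝ) 1, ‖G' s * 1‖ₑ := by
    simpa using enorm_integral_le_lintegral_enorm (μ := volume.restrict (Set.Icc (0 : ℝ) 1)) G'
  have h3 := h2.trans (lintegral_enorm_mul_le (g := fun _ ↦ (1 : ℂ)) hc.aestronglyMeasurable
    aestronglyMeasurable_const)
  have h4 : eLpNorm (fun _ : ℝ ↦ (1 : ℂ)) 2 (volume.restrict (Set.Icc (0 : ℝ) 1)) ≤ 1 := by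
    rw [eLpNorm_const' _ two_ne_zero ENNReal.ofNat_ne_top]
    simp
  rw [lintegral_enorm_sq_eq_eLpNorm_sq]
  exact pow_le_pow_left₀ zero_le (h3.trans (mul_le_of_le_one_right' h4)) 2

/-- Translation of `L²` functions. -/
noncomputable def translateL2 (h : RSpace d) : L2Space d →ₗᵢ[ℂ] L2Space d :=
  Lp.compMeasurePreservingₗᵢ ℂ (fun x ↦ x + h) (measurePreserving_add_right volume h)

theorem coeFn_translateL2 (h : RSpace d) (u : L2Space d) :
    translateL2 h u =ᵐ[volume] fun x ↦ u (x + h) :=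
  Lp.coeFn_compMeasurePreserving u (measurePreserving_add_right volume h)

theorem norm_translateL2_sub (h : RSpace d) (u : L2Space d) :
    eLpNorm (fun x ↦ u (x + h) - u x) 2 volume = ENNReal.ofReal ‖translateL2 h u - u‖ := by
  rw [ofReal_norm, Lp.enorm_def]
  refine eLpNorm_congr_ae ?_
  filter_upwards [coeFn_translateL2 h u, Lp.coeFn_sub (translateL2 h u) u] with x h1 h2
  rw [h2, Pi.sub_apply, h1]

theorem sum_smul_coordDeriv_apply (h x : RSpace d) (f : 𝓢(RSpace d, ℂ)) :
    (∑ j, ((h j : ℝ) : ℂ) • coordDeriv j f) x = fderiv ℝ f x h := by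
  have h1 : h = ∑ j, h j • unitVec j := by
    ext k
    simp [unitVec, Finset.sum_apply, Pi.single_apply]
  conv_rhs => rw [h1]
  rw [sum_apply, map_sum]
  refine Finset.sum_congr rfl fun j _ ↦ ?_
  rw [map_smul, smul_apply, coordDeriv_apply]
  simp

/-- The increment is the integral of the directional derivative along the segment from `x` to `x +
h`; Tonelli and translation invariance bound its `L²` norm by that of the derivative. -/
theorem norm_translateL2_schwartz_sub_le (h : RSpace d) (f : 𝓢(RSpace d, ℂ)) :
    ‖translateL2 h (schwartzToL2 d f) - schwartzToL2 d f‖ ≤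
      ∑ j, |h j| * ‖schwartzToL2 d (coordDeriv j f)‖ := by
  set g := ∑ j, ((h j : ℝ) : ℂ) • coordDeriv j f with hg
  have h1 : ‖translateL2 h (schwartzToL2 d f) - schwartzToL2 d f‖ ≤ ‖schwartzToL2 d g‖ := by
    rw [← ENNReal.ofReal_le_ofReal_iff (norm_nonneg _), ← norm_translateL2_sub, ofReal_norm,
      Lp.enorm_def, eLpNorm_congr_ae (coeFn_schwartzToL2 g)]
    have h2 : (fun x ↦ schwartzToL2 d f (x + h) - schwartzToL2 d f x) =ᵐ[volume]
        fun x ↦ f (x + h) - f x := by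
      filter_upwards [coeFn_schwartzToL2 f,
        (measurePreserving_add_right volume h).quasiMeasurePreserving.ae (coeFn_schwartzToL2 f)]
        with x h1 h2
      rw [h1, h2]
    rw [eLpNorm_congr_ae h2]
    refine (ENNReal.pow_le_pow_left_iff two_ne_zero).1 ?_
    rw [← lintegral_enorm_sq_eq_eLpNorm_sq, ← lintegral_enorm_sq_eq_eLpNorm_sq]
    have hgm : Measurable fun p : RSpace d × ℝ ↦ ‖g (p.1 + p.2 • h)‖ₑ ^ 2 := by
      have : Continuous fun p : RSpace d × ℝ ↦ g (p.1 + p.2 • h) := g.continuous.comp (by fun_prop)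
      exact this.measurable.enorm.pow_const 2
    calc ∫⁻ x, ‖f (x + h) - f x‖ₑ ^ 2
        ≤ ∫⁻ x, ∫⁻ s in Set.Icc (0 : ℝ) 1, ‖g (x + s • h)‖ₑ ^ 2 := by
          refine lintegral_mono fun x ↦ ?_
          have h3 : ∀ s : ℝ, HasDerivAt (fun s : ℝ ↦ f (x + s • h)) (g (x + s • h)) s := by
            intro s
            rw [hg, sum_smul_coordDeriv_apply]
            have h4 : HasDerivAt (fun s : ℝ ↦ x + s • h) h s := by
              simpa using ((hasDerivAt_id s).smul_const h).const_add x
            exact (f.hasFDerivAt (x + s • h)).comp_hasDerivAt s h4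
          have := enorm_sq_sub_le_setLIntegral h3 (g.continuous.comp (by fun_prop))
          simpa using this
      _ = ∫⁻ s in Set.Icc (0 : ℝ) 1, ∫⁻ x, ‖g (x + s • h)‖ₑ ^ 2 :=
          lintegral_lintegral_swap hgm.aemeasurable
      _ = ∫⁻ s in Set.Icc (0 : ℝ) 1, ∫⁻ x, ‖g x‖ₑ ^ 2 := by
          refine lintegral_congr fun s ↦ ?_
          exact lintegral_add_right_eq_self (fun x ↦ ‖g x‖ₑ ^ 2) (s • h)
      _ = _ := by simp
  refine h1.trans ?_
  rw [hg, map_sum]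
  refine (norm_sum_le _ _).trans_eq (Finset.sum_congr rfl fun j _ ↦ ?_)
  rw [map_smul, norm_smul, Complex.norm_real, Real.norm_eq_abs]

/-- The closed span of the eigenfunctions with eigenvalue at most `Λ`. -/
noncomputable def spectralSubspace (d : ℕ) (Λ : ℝ) : Submodule ℂ (L2Space d) :=
  (⨆ t : Set.Iic Λ, smoothEigenspace d t).topologicalClosure

theorem harmonicEigenspace_le_spectralSubspace (hd : 1 ≤ d) {t Λ : ℝ} (ht : t ≤ Λ) :
    harmonicEigenspace d t ≤ spectralSubspace d Λ := by
  rw [harmonicEigenspace_eq_closure hd]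
  exact Submodule.topologicalClosure_mono
    (le_iSup (fun t : Set.Iic Λ ↦ smoothEigenspace d t) ⟨t, ht⟩)

theorem inner_smoothEigenspace_eq_zero (hd : 1 ≤ d) {s t : ℝ} (hst : s ≠ t) {u w : L2Space d}
    (hu : u ∈ smoothEigenspace d s) (hw : w ∈ smoothEigenspace d t) : inner ℂ u w = 0 := by
  refine (harmonicEigenspace_orthogonal hd hst).inner_eq ?_ ?_
  · rw [harmonicEigenspace_eq_closure hd]
    exact Submodule.le_topologicalClosure _ hu
  · rw [harmonicEigenspace_eq_closure hd]
    exact Submodule.le_topologicalClosure _ hw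

/-- This is a Bernstein inequality: on finite sums of eigenfunctions `‖∂_j u‖²` is at most the
oscillator form, hence at most `Λ ‖u‖²` divided by the constant. The inequality is closed in `u` and
passes to the closure. -/
theorem norm_translateL2_sub_le (hd : 1 ≤ d) {Λ : ℝ} (hΛ : 0 ≤ Λ) {u : L2Space d}
    (hu : u ∈ spectralSubspace d Λ) (h : RSpace d) :
    ‖translateL2 h u - u‖ ≤ d * √(Λ / oscillatorConst d) * ‖h‖ * ‖u‖ := by
  have hc := oscillatorConst_pos hd
  have hcl : IsClosed {u : L2Space d |
      ‖translateL2 h u - u‖ ≤ d * √(Λ / oscillatorConst d) * ‖h‖ * ‖u‖} :=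
    isClosed_le (((translateL2 h).continuous.sub continuous_id).norm)
      (continuous_const.mul continuous_norm)
  refine hcl.closure_subset_iff.2 (fun u hu ↦ ?_) hu
  obtain ⟨F, hF, rfl⟩ := (Submodule.mem_iSup_iff_exists_finsupp _ _).1 hu
  have hF' := fun t ↦ mem_smoothEigenspace.1 (hF t)
  choose f hf hfF using hF'
  set s := F.support
  have hsum : (F.sum fun _ x ↦ x) = schwartzToL2 d (∑ t ∈ s, f t) := by
    rw [Finsupp.sum, map_sum]
    exact Finset.sum_congr rfl fun t _ ↦ (hfF t).symm
  set ψ := ∑ t ∈ s, f t with hψ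
  -- The weights `a = 1` give the norm and `a t = t / oscillatorConst d` gives the energy.
  have horth : ∀ (a : Set.Iic Λ → ℝ), inner ℂ (schwartzToL2 d ψ) (schwartzToL2 d
      (∑ t ∈ s, (a t : ℂ) • f t)) = ((∑ t ∈ s, a t * ‖schwartzToL2 d (f t)‖ ^ 2 : ℝ) : ℂ) := by
    intro a
    rw [hψ, map_sum, map_sum, sum_inner, Complex.ofReal_sum]
    refine Finset.sum_congr rfl fun t ht ↦ ?_
    rw [inner_sum, Finset.sum_eq_single_of_mem t ht fun t' _ htt' ↦ ?_]
    · rw [map_smul, inner_smul_right, inner_self_eq_ofReal, Complex.ofReal_mul]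
    · rw [map_smul, inner_smul_right, hfF, hfF, inner_smoothEigenspace_eq_zero hd
        (fun h ↦ htt' (Subtype.ext h.symm)) (hF t) (hF t'), mul_zero]
  have hnorm : ‖schwartzToL2 d ψ‖ ^ 2 = ∑ t ∈ s, ‖schwartzToL2 d (f t)‖ ^ 2 := by
    have := horth 1
    simp only [Pi.one_apply, Complex.ofReal_one, one_smul, one_mul, ← hψ,
      inner_self_eq_ofReal] at this
    exact_mod_cast this
  have henergy : ∑ j, (‖schwartzToL2 d (coordMul j ψ)‖ ^ 2 +
      ‖schwartzToL2 d (coordDeriv j ψ)‖ ^ 2) ≤ Λ / oscillatorConst d * ‖schwartzToL2 d ψ‖ ^ 2 := by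
    have h1 := inner_schwartzToL2_schwartzOscillator ψ
    have h2 : schwartzOscillator d ψ = ∑ t ∈ s, ((t / oscillatorConst d : ℝ) : ℂ) • f t := by
      rw [hψ, map_sum]
      exact Finset.sum_congr rfl fun t _ ↦ mem_schwartzEigenspace.1 (hf t)
    rw [h2, horth fun t ↦ t / oscillatorConst d, Complex.ofReal_inj] at h1
    rw [← h1, hnorm, Finset.mul_sum]
    refine Finset.sum_le_sum fun t _ ↦ mul_le_mul_of_nonneg_right ?_ (by positivity)
    exact div_le_div_of_nonneg_right t.2 hc.le
  have hderiv : ∀ j, ‖schwartzToL2 d (coordDeriv j ψ)‖ ≤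
      √(Λ / oscillatorConst d) * ‖schwartzToL2 d ψ‖ := by
    intro j
    refine abs_le_of_sq_le_sq' ?_ (by positivity) |>.2
    rw [mul_pow, Real.sq_sqrt (by positivity)]
    refine le_trans ?_ henergy
    refine le_trans ?_ (Finset.single_le_sum (f := fun j ↦ ‖schwartzToL2 d (coordMul j ψ)‖ ^ 2 +
      ‖schwartzToL2 d (coordDeriv j ψ)‖ ^ 2) (fun j _ ↦ by positivity) (Finset.mem_univ j))
    exact le_add_of_nonneg_left (by positivity)
  rw [hsum]
  refine (norm_translateL2_schwartz_sub_le h ψ).trans ?_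
  calc ∑ j, |h j| * ‖schwartzToL2 d (coordDeriv j ψ)‖
      ≤ ∑ _j : Fin d, ‖h‖ * (√(Λ / oscillatorConst d) * ‖schwartzToL2 d ψ‖) := by
        refine Finset.sum_le_sum fun j _ ↦ mul_le_mul ?_ (hderiv j) (norm_nonneg _) (norm_nonneg _)
        exact PiLp.norm_apply_le h j
    _ = _ := by
        rw [Finset.sum_const, Finset.card_univ, Fintype.card_fin, nsmul_eq_mul]
        ring

end Translation

/-! ### Orthogonal decomposition into eigenspaces -/

section SpectralDecomposition

variable {d : ℕ}

/-- The sum runs over all real `t`; eigenspaces for distinct `t` are orthogonal, and a vector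
orthogonal to all of them vanishes by totality. -/
theorem isHilbertSum_harmonicEigenspace (hd : 1 ≤ d) :
    IsHilbertSum ℂ (fun t : ℝ ↦ harmonicEigenspace d t)
      fun t ↦ (harmonicEigenspace d t).subtypeₗᵢ := by
  have hc := oscillatorConst_pos hd
  refine IsHilbertSum.mkInternal _
    (fun s t hst u w ↦ (harmonicEigenspace_orthogonal hd hst).inner_eq u.2 w.2) ?_
  rw [top_le_iff, Submodule.topologicalClosure_eq_top_iff, eq_bot_iff]
  intro u hu
  refine eq_zero_of_forall_inner_eigenfunction fun r f hf ↦ ?_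
  exact Submodule.inner_right_of_mem_orthogonal
    (Submodule.mem_iSup_of_mem _ (schwartzToL2_mem_harmonicEigenspace hf)) hu

theorem hasSum_starProjection_harmonicEigenspace (hd : 1 ≤ d) (v : L2Space d) :
    HasSum (fun t ↦ (harmonicEigenspace d t).starProjection v) v := by
  have hH := isHilbertSum_harmonicEigenspace (d := d) hd
  have h := hH.hasSum_linearIsometryEquiv_symm (hH.linearIsometryEquiv v)
  rw [LinearIsometryEquiv.symm_apply_apply] at h
  convert h using 1
  funext t
  refine Submodule.eq_starProjection_of_mem_orthogonal (Subtype.coe_prop _) ?_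
  rw [Submodule.mem_orthogonal]
  intro x hx
  rw [inner_sub_right, sub_eq_zero]
  refine (((innerSL ℂ x).hasSum h).unique (hasSum_single t fun s hs ↦ ?_))
  exact (harmonicEigenspace_orthogonal hd hs.symm).inner_eq hx (Subtype.coe_prop _)

theorem hasSum_norm_sq_of_orthogonal {ι H : Type*} [NormedAddCommGroup H] [InnerProductSpace ℂ H]
    {l : ι → H} (hl : ∀ i j, i ≠ j → inner ℂ (l i) (l j) = 0) {x : H} (hx : HasSum l x) :
    HasSum (fun i ↦ ‖l i‖ ^ 2) (‖x‖ ^ 2) := by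
  refine (hx.norm.pow 2).congr fun s ↦ ?_
  have h : ((‖∑ i ∈ s, l i‖ ^ 2 : ℝ) : ℂ) = ((∑ i ∈ s, ‖l i‖ ^ 2 : ℝ) : ℂ) := by
    rw [← inner_self_eq_ofReal, sum_inner, Complex.ofReal_sum]
    refine Finset.sum_congr rfl fun i hi ↦ ?_
    rw [inner_sum, Finset.sum_eq_single_of_mem i hi fun j _ hij ↦ hl i j hij.symm,
      inner_self_eq_ofReal]
  exact_mod_cast h

end SpectralDecomposition

/-! ### Doubly exponential spectral blocks and the logarithmic weight -/

section LogDomain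

variable {d : ℕ}

/-- The index of the doubly exponential block of the spectrum containing `t`. -/
noncomputable def spectralIndex (t : ℝ) : ℕ := ⌊Real.log (Real.log t)⌋₊

/-- The component of `v` in the doubly exponential block of the spectrum with index `n`. -/
noncomputable def spectralBlock (v : L2Space d) (n : ℕ) : L2Space d :=
  ∑' t : spectralIndex ⁻¹' {n}, (harmonicEigenspace d t).starProjection v

theorem starProjection_harmonicEigenspace_eq_zero (hd : 1 ≤ d) {t : ℝ}
    (ht : t < Real.exp (Real.exp 1)) (v : L2Space d) :
    (harmonicEigenspace d t).starProjection v = 0 := by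
  have h := Submodule.starProjection_apply_mem (harmonicEigenspace d t) v
  have h2 := harmonicEigenspace_eq_bot hd ht
  exact (Submodule.mem_bot ℂ).1 (h2 ▸ h)

theorem exp_one_le_log {t : ℝ} (ht : Real.exp (Real.exp 1) ≤ t) : Real.exp 1 ≤ Real.log t :=
  (Real.le_log_iff_exp_le ((Real.exp_pos _).trans_le ht)).2 ht

theorem one_le_log_log {t : ℝ} (ht : Real.exp (Real.exp 1) ≤ t) : 1 ≤ Real.log (Real.log t) :=
  (Real.le_log_iff_exp_le ((Real.exp_pos _).trans_le (exp_one_le_log ht))).2 (exp_one_le_log ht)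

theorem hasSum_spectralBlock (hd : 1 ≤ d) (v : L2Space d) : HasSum (spectralBlock v) v :=
  (hasSum_starProjection_harmonicEigenspace hd v).tsum_fiberwise spectralIndex

theorem hasSum_subtype_spectralBlock (hd : 1 ≤ d) (v : L2Space d) (n : ℕ) :
    HasSum (fun t : spectralIndex ⁻¹' {n} ↦ (harmonicEigenspace d t).starProjection v)
      (spectralBlock v n) :=
  ((hasSum_starProjection_harmonicEigenspace hd v).summable.subtype _).hasSum

/-- Since `ln ln t ≥ 1` for `t ≥ e^e`, index `0` meets only values of `t` that are not eigenvalues.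
-/
theorem spectralBlock_zero (hd : 1 ≤ d) (v : L2Space d) : spectralBlock v 0 = 0 := by
  refine (tsum_congr fun t ↦ ?_).trans tsum_zero
  refine starProjection_harmonicEigenspace_eq_zero hd (lt_of_not_ge fun ht ↦ ?_) v
  have h1 : ⌊Real.log (Real.log t)⌋₊ = 0 := t.2
  rw [Nat.floor_eq_zero] at h1
  exact absurd (one_le_log_log ht) (not_le.2 h1)

theorem spectralBlock_mem (hd : 1 ≤ d) (v : L2Space d) (n : ℕ) :
    spectralBlock v n ∈ spectralSubspace d (Real.exp (Real.exp (n + 1))) := by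
  have hcl : IsClosed (spectralSubspace d (Real.exp (Real.exp (n + 1))) : Set (L2Space d)) :=
    Submodule.isClosed_topologicalClosure _
  refine hcl.mem_of_tendsto (hasSum_subtype_spectralBlock hd v n)
    (Filter.Eventually.of_forall fun s ↦ Submodule.sum_mem _ fun t _ ↦ ?_)
  -- Below `e^e` the index carries no information about `t`, but the projection vanishes there.
  by_cases ht : (t : ℝ) < Real.exp (Real.exp 1)
  · rw [starProjection_harmonicEigenspace_eq_zero hd ht]
    exact Submodule.zero_mem _
  · have ht := not_lt.1 ht
    refine harmonicEigenspace_le_spectralSubspace hd ?_ (Submodule.starProjection_apply_mem _ v)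
    have h1 : ⌊Real.log (Real.log t)⌋₊ = n := t.2
    have h2 : Real.log (Real.log t) ≤ n + 1 := by
      have := (Nat.lt_floor_add_one (Real.log (Real.log t))).le
      rwa [h1] at this
    have h3 := exp_one_le_log ht
    rw [Real.log_le_iff_le_exp ((Real.exp_pos _).trans_le h3)] at h2
    rwa [Real.log_le_iff_le_exp ((Real.exp_pos _).trans_le ht)] at h2

theorem hasSum_norm_sq_spectralBlock (hd : 1 ≤ d) (v : L2Space d) (n : ℕ) :
    HasSum (fun t : spectralIndex ⁻¹' {n} ↦ ‖(harmonicEigenspace d t).starProjection v‖ ^ 2)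
      (‖spectralBlock v n‖ ^ 2) :=
  hasSum_norm_sq_of_orthogonal (fun _ _ hst ↦ (harmonicEigenspace_orthogonal hd
    (fun h ↦ hst (Subtype.ext h))).inner_eq (Submodule.starProjection_apply_mem _ v)
    (Submodule.starProjection_apply_mem _ v)) (hasSum_subtype_spectralBlock hd v n)

/-- The lower bound for `logWeight` on the `n`-th block. -/
noncomputable def blockWeight (ε : ℝ) (n : ℕ) : ℝ :=
  Real.exp (n / 2) * (n : ℝ) ^ (1 / 2 + ε)

theorem blockWeight_nonneg (ε : ℝ) (n : ℕ) : 0 ≤ blockWeight ε n := by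
  unfold blockWeight
  positivity

/-- With `n ≤ ln ln t` one has `(ln t)^{1/2} = exp((ln ln t) / 2) ≥ e^{n/2}`. -/
theorem blockWeight_le_logWeight {ε : ℝ} (hε : 0 < ε) {t : ℝ} (ht : Real.exp (Real.exp 1) ≤ t) :
    blockWeight ε (spectralIndex t) ≤ logWeight ε t := by
  have h1 := one_le_log_log ht
  have h2 : ((spectralIndex t : ℕ) : ℝ) ≤ Real.log (Real.log t) := Nat.floor_le (by linarith)
  have h3 : 0 < Real.log t := (Real.exp_pos _).trans_le (exp_one_le_log ht)
  refine mul_le_mul ?_ (Real.rpow_le_rpow (by positivity) h2 (by positivity)) (by positivity)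
    (by positivity)
  rw [Real.rpow_def_of_pos h3]
  exact Real.exp_le_exp.2 (by linarith)

theorem tsum_blockWeight_le (hd : 1 ≤ d) {ε : ℝ} (hε : 0 < ε) (v : L2Space d) :
    ∑' n, ENNReal.ofReal ((blockWeight ε n * ‖spectralBlock v n‖) ^ 2) ≤
      harmonicCalculusNorm d (logWeight ε) v ^ 2 := by
  have h0 : harmonicCalculusNorm d (logWeight ε) v ^ 2 = ∑' t : ℝ, (‖logWeight ε t‖ₑ *
      ‖(harmonicEigenspace d t).starProjection v‖ₑ) ^ 2 := by
    rw [harmonicCalculusNorm, ← ENNReal.rpow_natCast, ← ENNReal.rpow_mul]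
    norm_num
  rw [h0, ← ENNReal.tsum_fiberwise _ spectralIndex]
  refine ENNReal.tsum_le_tsum fun n ↦ ?_
  have h1 := (hasSum_norm_sq_spectralBlock hd v n).mul_left (blockWeight ε n ^ 2)
  rw [mul_pow, ← h1.tsum_eq, ENNReal.ofReal_tsum_of_nonneg (fun t ↦ by positivity) h1.summable]
  refine ENNReal.tsum_le_tsum fun t ↦ ?_
  by_cases ht : (t : ℝ) < Real.exp (Real.exp 1)
  · rw [starProjection_harmonicEigenspace_eq_zero hd ht]
    simp
  · have h2 := blockWeight_le_logWeight hε (not_lt.1 ht)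
    have h3 : spectralIndex t = n := t.2
    rw [h3] at h2
    rw [← mul_pow, ENNReal.ofReal_pow (mul_nonneg (blockWeight_nonneg _ _) (norm_nonneg _)),
      ENNReal.ofReal_mul (blockWeight_nonneg _ _), ofReal_norm]
    refine pow_le_pow_left₀ zero_le (mul_le_mul_left ?_ _) 2
    rw [← ofReal_norm]
    exact ENNReal.ofReal_le_ofReal (h2.trans (Real.le_norm_self _))

theorem summable_blockWeight (hd : 1 ≤ d) {ε : ℝ} (hε : 0 < ε) {v : L2Space d}
    (hv : harmonicCalculusNorm d (logWeight ε) v < ∞) :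
    Summable (fun n ↦ (blockWeight ε n * ‖spectralBlock v n‖) ^ 2) ∧
      ∑' n, (blockWeight ε n * ‖spectralBlock v n‖) ^ 2 ≤
        (harmonicCalculusNorm d (logWeight ε) v).toReal ^ 2 := by
  have h := tsum_blockWeight_le hd hε v
  have hfin := ENNReal.pow_lt_top hv (n := 2)
  have hs : Summable (fun n ↦ (blockWeight ε n * ‖spectralBlock v n‖) ^ 2) := by
    have := ENNReal.summable_toReal (h.trans_lt hfin).ne
    refine this.congr fun n ↦ ENNReal.toReal_ofReal (by positivity)
  refine ⟨hs, ?_⟩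
  rw [← ENNReal.ofReal_tsum_of_nonneg (fun n ↦ by positivity) hs] at h
  rw [← ENNReal.toReal_pow]
  exact (ENNReal.ofReal_le_iff_le_toReal hfin.ne).1 h

/-- The dyadic level resolving the oscillations of the `n`-th block. -/
noncomputable def blockLevel (d n : ℕ) : ℕ := 2 * d + ⌈Real.exp (n + 1)⌉₊

/-- The level grows like `e^n`, so the cost of a block is of order `e^{n/2}`, which is the
exponential factor of `blockWeight`. -/
theorem sqrt_blockLevel_le (d n : ℕ) :
    √((blockLevel d n : ℝ) + 1) ≤ √(2 * d + 5) * Real.exp (n / 2) := by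
  rw [Real.sqrt_le_iff]
  refine ⟨by positivity, ?_⟩
  rw [mul_pow, Real.sq_sqrt (by positivity), ← Real.exp_nat_mul]
  have h1 : (⌈Real.exp ((n : ℝ) + 1)⌉₊ : ℝ) < Real.exp (n + 1) + 1 :=
    Nat.ceil_lt_add_one (Real.exp_pos _).le
  have h2 : Real.exp ((n : ℝ) + 1) = Real.exp n * Real.exp 1 := Real.exp_add _ _
  have h3 : Real.exp ((2 : ℕ) * ((n : ℝ) / 2)) = Real.exp n := by
    congr 1
    push_cast
    ring
  have h4 : 1 ≤ Real.exp (n : ℝ) := Real.one_le_exp (by positivity)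
  have h5 := Real.exp_one_lt_d9
  rw [h3, blockLevel]
  push_cast
  rw [h2] at h1 ⊢
  nlinarith [mul_nonneg (Nat.cast_nonneg (α := ℝ) d) (sub_nonneg.2 h4)]

/-- With `y = e^{n+1}` the modulus is at most `d² e^{y/2}`. The summand `2 * d` of `blockLevel` pays
for `d² ≤ 2^{2d}`, and `e^{1/2} ≤ 2` for the rest. -/
theorem modulus_le_two_pow_blockLevel (hd : 1 ≤ d) (n : ℕ) :
    d * √(Real.exp (Real.exp (n + 1)) / oscillatorConst d) ≤ 2 ^ blockLevel d n := by
  have hd1 : (1 : ℝ) ≤ d := by exact_mod_cast hd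
  have hd2 : (d : ℝ) ≤ 2 ^ d := by exact_mod_cast Nat.lt_two_pow_self.le
  have hy : 0 < Real.exp ((n : ℝ) + 1) := Real.exp_pos _
  set y := Real.exp ((n : ℝ) + 1)
  have h1 : Real.exp y / oscillatorConst d ≤ (d * Real.exp (y / 2)) ^ 2 := by
    rw [mul_pow, ← Real.exp_nat_mul, oscillatorConst, div_div_eq_mul_div,
      div_le_iff₀ (Real.exp_pos _)]
    have h3 : Real.exp ((2 : ℕ) * (y / 2)) = Real.exp y := by
      congr 1
      push_cast
      ring
    rw [h3]
    have h4 : 1 ≤ Real.exp (Real.exp 1) := Real.one_le_exp (Real.exp_pos _).le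
    have h5 := Real.exp_pos y
    nlinarith [mul_nonneg h5.le (sub_nonneg.2 hd1), mul_nonneg (mul_nonneg h5.le (sq_nonneg (d : ℝ))) (sub_nonneg.2 h4)]
  have h2 : Real.exp (y / 2) ≤ 2 ^ ⌈y⌉₊ := by
    have h3 : Real.exp (1 / 2) ≤ 2 := by
      have := Real.exp_one_lt_d9
      have h4 : Real.exp (1 / 2) ^ 2 = Real.exp 1 := by
        rw [← Real.exp_nat_mul]
        norm_num
      nlinarith [Real.exp_pos (1 / 2)]
    calc Real.exp (y / 2) ≤ Real.exp ((⌈y⌉₊ : ℝ) * (1 / 2)) :=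
          Real.exp_le_exp.2 (by linarith [Nat.le_ceil y])
      _ = Real.exp (1 / 2) ^ ⌈y⌉₊ := Real.exp_nat_mul _ _
      _ ≤ _ := pow_le_pow_left₀ (Real.exp_pos _).le h3 _
  calc d * √(Real.exp y / oscillatorConst d) ≤ d * (d * Real.exp (y / 2)) := by
        gcongr
        exact Real.sqrt_le_iff.2 ⟨by positivity, h1⟩
    _ ≤ 2 ^ d * (2 ^ d * 2 ^ ⌈y⌉₊) := by gcongr
    _ = _ := by rw [blockLevel, pow_add, two_mul, pow_add, mul_assoc]

theorem exists_hasFourierKernel_spectralBlock (hd : 1 ≤ d) {g : RSpace d → ℝ} {C : ℝ≥0}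
    (hg : IsCriticalSymbol g C) (v : L2Space d) (n : ℕ) :
    ∃ G : L2Space d →L[ℂ] L2Space d, HasFourierKernel g (spectralBlock v n) G ∧
      KyFanBound G (modulusConst d C * (√(blockLevel d n + 1) * ‖spectralBlock v n‖)) := by
  have hm := (Lp.stronglyMeasurable (spectralBlock v n)).measurable
  have h : (eLpNorm (spectralBlock v n) 2 volume).toReal = ‖spectralBlock v n‖ :=
    (Lp.norm_def _).symm
  rw [← h]
  refine hg.exists_hasFourierKernel_of_modulus hd hm (Lp.memLp _) fun y ↦ ?_
  rw [norm_translateL2_sub, h]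
  refine ENNReal.ofReal_le_ofReal ?_
  refine (norm_translateL2_sub_le hd (Real.exp_pos _).le (spectralBlock_mem hd v n) y).trans ?_
  have := modulus_le_two_pow_blockLevel hd n
  calc _ ≤ 2 ^ blockLevel d n * ‖y‖ * ‖spectralBlock v n‖ := by gcongr
    _ = _ := by ring

/-- The constant in `IsCriticalSymbol.exists_hasFourierKernel_of_logDomain`. -/
noncomputable def logDomainConst (d : ℕ) (C : ℝ≥0) (ε : ℝ) : ℝ :=
  modulusConst d C * √(2 * d + 5) * √(∑' n : ℕ, ((n : ℝ) ^ (-(1 / 2 + ε))) ^ 2)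

/-- The block costs `e^{n/2} ‖v_n‖` equal `n^{-(1/2+ε)}` times the weighted norms. By Cauchy-Schwarz
they are summable, since `∑ n^{-1-2ε}` converges; this is where `ε > 0` is indispensable to the
argument. -/
theorem IsCriticalSymbol.exists_hasFourierKernel_of_logDomain (hd : 1 ≤ d) {g : RSpace d → ℝ}
    {C : ℝ≥0} (hg : IsCriticalSymbol g C) {ε : ℝ} (hε : 0 < ε) {v : L2Space d}
    (hv : harmonicCalculusNorm d (logWeight ε) v < ∞) :
    ∃ G : L2Space d →L[ℂ] L2Space d, HasFourierKernel g v G ∧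
      KyFanBound G (logDomainConst d C ε * (harmonicCalculusNorm d (logWeight ε) v).toReal) := by
  set N := (harmonicCalculusNorm d (logWeight ε) v).toReal with hN
  have hM := modulusConst_nonneg d C
  obtain ⟨hs, hle⟩ := summable_blockWeight hd hε hv
  set b : ℕ → ℝ := fun n ↦ (n : ℝ) ^ (-(1 / 2 + ε)) with hb
  set y : ℕ → ℝ := fun n ↦ blockWeight ε n * ‖spectralBlock v n‖ with hy
  have hb0 : ∀ n, 0 ≤ b n := fun n ↦ by positivity
  have hy0 : ∀ n, 0 ≤ y n := fun n ↦ mul_nonneg (blockWeight_nonneg _ _) (norm_nonneg _)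
  have hbs : Summable fun n ↦ b n ^ 2 := by
    have := Real.summable_nat_rpow.2 (by linarith : -(1 + 2 * ε) < -1)
    refine this.congr fun n ↦ ?_
    rw [hb, ← Real.rpow_natCast, ← Real.rpow_mul (by positivity)]
    congr 1
    push_cast
    ring
  obtain ⟨hps, hple⟩ := Real.summable_and_inner_le_Lp_mul_Lq_tsum_of_nonneg
    Real.HolderConjugate.two_two hb0 hy0 (by simpa using hbs) (by simpa using hs)
  have hby : ∀ n : ℕ, Real.exp (n / 2) * ‖spectralBlock v n‖ = b n * y n := by
    intro n
    -- For `n = 0` the negative power cannot be cancelled, but the block is zero.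
    rcases Nat.eq_zero_or_pos n with rfl | hn
    · simp [hy, spectralBlock_zero hd]
    · have hn' : (0 : ℝ) < n := by exact_mod_cast hn
      simp only [hb, hy, blockWeight]
      rw [Real.rpow_neg hn'.le]
      have := (Real.rpow_pos_of_pos hn' (1 / 2 + ε)).ne'
      field_simp
  have hlim : Filter.Tendsto (fun n ↦ eLpNorm (fun x ↦ v x -
      ∑ k ∈ Finset.range n, spectralBlock v k x) 2 volume) Filter.atTop (nhds 0) := by
    have h1 := (hasSum_spectralBlock hd v).tendsto_sum_nat
    rw [tendsto_iff_norm_sub_tendsto_zero] at h1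
    have h2 := ENNReal.tendsto_ofReal h1
    rw [ENNReal.ofReal_zero] at h2
    refine h2.congr fun n ↦ ?_
    rw [norm_sub_rev, ofReal_norm, Lp.enorm_def]
    refine eLpNorm_congr_ae ?_
    filter_upwards [Lp.coeFn_sub v (∑ k ∈ Finset.range n, spectralBlock v k),
      Lp.coeFn_fun_finsetSum (Finset.range n) (spectralBlock v)] with x h1 h2
    rw [h1, Pi.sub_apply, h2]
  obtain ⟨G, hG, hK⟩ := exists_hasFourierKernel_of_series (g := g) (Lp.memLp v)
    (fun n ↦ Lp.memLp (spectralBlock v n)) hlim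
    (X := fun n ↦ modulusConst d C * √(2 * d + 5) * (b n * y n))
    (fun n ↦ mul_nonneg (by positivity) (mul_nonneg (hb0 n) (hy0 n)))
    (hps.mul_left _) fun n ↦ by
      obtain ⟨G, hG, hK⟩ := exists_hasFourierKernel_spectralBlock hd hg v n
      refine ⟨G, hG, hK.mono ?_⟩
      rw [← hby, mul_assoc]
      refine mul_le_mul_of_nonneg_left ?_ hM
      rw [← mul_assoc]
      exact mul_le_mul_of_nonneg_right (sqrt_blockLevel_le d n) (norm_nonneg _)
  refine ⟨G, hG, hK.mono ?_⟩
  rw [tsum_mul_left, logDomainConst, mul_assoc _ √(∑' n, _)]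
  refine mul_le_mul_of_nonneg_left (hple.trans ?_) (by positivity)
  simp only [Real.rpow_ofNat]
  rw [← Real.sqrt_eq_rpow, ← Real.sqrt_eq_rpow]
  refine mul_le_mul_of_nonneg_left ?_ (Real.sqrt_nonneg _)
  exact Real.sqrt_le_iff.2 ⟨ENNReal.toReal_nonneg, hle⟩

end LogDomain

/-! ### Factorisation of the Birman-Schwinger operator -/

section BirmanSchwingerFactorization

variable {d : ℕ}

/-- The product `v b` need not be in `L²` a priori. The test function `f = (a - v b) / (1 + v²)` is
admissible, as both `f` and `v f` are dominated by `|a| + |b|`, and it yields `∫ |a - v b|² / (1 +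
v²) = 0`. -/
theorem ae_eq_mul_of_forall_integral {v : RSpace d → ℝ} (hv : AEStronglyMeasurable v)
    (a b : L2Space d) (h : ∀ f : RSpace d → ℂ, MemLp f 2 → MemLp (fun x ↦ (v x : ℂ) * f x) 2 →
      ∫ x, (starRingEnd ℂ) (f x) * a x = ∫ x, (starRingEnd ℂ) ((v x : ℂ) * f x) * b x) :
    a =ᵐ[volume] fun x ↦ (v x : ℂ) * b x := by
  have hvc : AEStronglyMeasurable (fun x ↦ (v x : ℂ)) :=
    Complex.continuous_ofReal.comp_aestronglyMeasurable hv
  set D : RSpace d → ℂ := fun x ↦ a x - v x * b x with hD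
  set f : RSpace d → ℂ := fun x ↦ ((1 + v x ^ 2)⁻¹ : ℝ) * D x with hf
  have hDm : AEStronglyMeasurable D := (Lp.memLp a).1.sub (hvc.mul (Lp.memLp b).1)
  have hfm : AEStronglyMeasurable f := by
    refine AEStronglyMeasurable.mul ?_ hDm
    have hc : Continuous fun r : ℝ ↦ (((1 + r ^ 2)⁻¹ : ℝ) : ℂ) := by
      refine Complex.continuous_ofReal.comp (Continuous.inv₀ (by fun_prop) fun r ↦ ?_)
      positivity
    exact hc.comp_aestronglyMeasurable hv
  have hsum : MemLp (fun x ↦ ‖a x‖ + ‖b x‖) 2 := (Lp.memLp a).norm.add (Lp.memLp b).norm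
  have hbound : ∀ x, ‖D x‖ ≤ ‖a x‖ + |v x| * ‖b x‖ := fun x ↦ by
    refine (norm_sub_le _ _).trans_eq ?_
    rw [norm_mul, Complex.norm_real, Real.norm_eq_abs]
  have hpos : ∀ x, 0 < 1 + v x ^ 2 := fun x ↦ by positivity
  have hnf : ∀ x, ‖f x‖ = (1 + v x ^ 2)⁻¹ * ‖D x‖ := fun x ↦ by
    rw [hf, norm_mul, Complex.norm_real, Real.norm_of_nonneg (inv_nonneg.2 (hpos x).le)]
  have hf2 : MemLp f 2 := by
    refine hsum.of_le hfm (Filter.Eventually.of_forall fun x ↦ ?_)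
    rw [hnf, Real.norm_of_nonneg (by positivity), inv_mul_le_iff₀ (hpos x)]
    refine (hbound x).trans ?_
    have := sq_abs (v x)
    nlinarith [norm_nonneg (a x), norm_nonneg (b x), sq_nonneg (v x),
      mul_nonneg (norm_nonneg (b x)) (sq_nonneg (|v x| - 1)), mul_nonneg (norm_nonneg (a x)) (sq_nonneg (v x)),
      mul_nonneg (norm_nonneg (b x)) (sq_nonneg (v x))]
  have hvf2 : MemLp (fun x ↦ (v x : ℂ) * f x) 2 := by
    refine hsum.of_le (hvc.mul hfm) (Filter.Eventually.of_forall fun x ↦ ?_)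
    rw [norm_mul, Complex.norm_real, Real.norm_eq_abs, hnf, Real.norm_of_nonneg (by positivity),
      mul_left_comm, inv_mul_le_iff₀ (hpos x)]
    refine (mul_le_mul_of_nonneg_left (hbound x) (abs_nonneg _)).trans ?_
    have := sq_abs (v x)
    nlinarith [norm_nonneg (a x), norm_nonneg (b x), sq_nonneg (v x),
      mul_nonneg (norm_nonneg (a x)) (sq_nonneg (|v x| - 1)), mul_nonneg (norm_nonneg (a x)) (sq_nonneg (v x)),
      mul_nonneg (norm_nonneg (b x)) (sq_nonneg (v x))]
  have hi1 : Integrable fun x ↦ (starRingEnd ℂ) (f x) * a x := hf2.star.integrable_mul (Lp.memLp a)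
  have hi2 : Integrable fun x ↦ (starRingEnd ℂ) ((v x : ℂ) * f x) * b x :=
    hvf2.star.integrable_mul (Lp.memLp b)
  have heq : ∀ x, (starRingEnd ℂ) (f x) * a x - (starRingEnd ℂ) ((v x : ℂ) * f x) * b x =
      (((1 + v x ^ 2)⁻¹ * ‖D x‖ ^ 2 : ℝ) : ℂ) := by
    intro x
    have h1 : (starRingEnd ℂ) (D x) * D x = ((‖D x‖ ^ 2 : ℝ) : ℂ) := by
      rw [Complex.conj_mul']
      push_cast
      rfl
    rw [Complex.ofReal_mul, ← h1]
    simp only [hf, map_mul, Complex.conj_ofReal]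
    rw [show D x = a x - v x * b x from rfl]
    ring
  have hint : ∫ x, (1 + v x ^ 2)⁻¹ * ‖D x‖ ^ 2 = 0 := by
    have h0 := integral_sub hi1 hi2
    rw [h f hf2 hvf2, sub_self] at h0
    simp only [heq] at h0
    rw [integral_complex_ofReal] at h0
    exact_mod_cast h0
  have hii : Integrable fun x ↦ (1 + v x ^ 2)⁻¹ * ‖D x‖ ^ 2 := by
    have := (hi1.sub hi2).re
    refine this.congr (Filter.Eventually.of_forall fun x ↦ ?_)
    simp only [Pi.sub_apply, heq]
    exact RCLike.ofReal_re _
  rw [integral_eq_zero_iff_of_nonneg (fun x ↦ mul_nonneg (inv_nonneg.2 (hpos x).le) (by positivity))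
    hii] at hint
  filter_upwards [hint] with x hx
  have h1 : ‖D x‖ ^ 2 = 0 := (mul_eq_zero.1 hx).resolve_left (inv_ne_zero (hpos x).ne')
  exact sub_eq_zero.1 (norm_eq_zero.1 (pow_eq_zero_iff two_ne_zero |>.1 h1))

/-- The square root of the high-frequency symbol. -/
noncomputable def sqrtSymbol {d : ℕ} (s E : ℝ) (ξ : RSpace d) : ℝ :=
  √(highFrequencySymbol s E ((2 * Real.pi) • ξ))

theorem measurable_sqrtSymbol (s E : ℝ) : Measurable (sqrtSymbol s E : RSpace d → ℝ) := by
  have h : Measurable (highFrequencySymbol s E : RSpace d → ℝ) := by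
    refine Measurable.indicator ?_ (measurableSet_lt measurable_const measurable_norm)
    exact ((measurable_norm.pow_const _).sub_const _).inv
  exact Real.continuous_sqrt.measurable.comp (h.comp (measurable_const_smul (2 * Real.pi)))

theorem highFrequencySymbol_nonneg {s E : ℝ} (hE : E ≤ 0) (k : RSpace d) :
    0 ≤ highFrequencySymbol s E k := by
  refine Set.indicator_nonneg (fun k _ ↦ inv_nonneg.2 ?_) k
  have := Real.rpow_nonneg (norm_nonneg k) (2 * s)
  linarith

/-- Discarding `-E ≥ 0` from the denominator makes all later constants independent of `E`. -/
theorem highFrequencySymbol_le {s E : ℝ} (hE : E ≤ 0) (k : RSpace d) :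
    highFrequencySymbol s E k ≤ {k : RSpace d | 1 < ‖k‖}.indicator (fun k ↦ (‖k‖ ^ (2 * s))⁻¹) k := by
  refine Set.indicator_le_indicator' fun hk ↦ ?_
  have : 0 < ‖k‖ ^ (2 * s) := Real.rpow_pos_of_pos (zero_lt_one.trans hk) _
  exact inv_anti₀ this (by linarith)

theorem highFrequencySymbol_le_one {s E : ℝ} (hs : 0 ≤ s) (hE : E ≤ 0) (k : RSpace d) :
    highFrequencySymbol s E k ≤ 1 := by
  refine (highFrequencySymbol_le hE k).trans (Set.indicator_le' (fun k hk ↦ ?_)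
    (fun _ _ ↦ zero_le_one) k)
  exact inv_le_one_of_one_le₀ (Real.one_le_rpow (le_of_lt hk) (by linarith))

theorem sqrtSymbol_sq {s E : ℝ} (hE : E ≤ 0) (ξ : RSpace d) :
    sqrtSymbol s E ξ ^ 2 = highFrequencySymbol s E ((2 * Real.pi) • ξ) :=
  Real.sq_sqrt (highFrequencySymbol_nonneg hE _)

theorem abs_sqrtSymbol_le_one {s E : ℝ} (hs : 0 ≤ s) (hE : E ≤ 0) (ξ : RSpace d) :
    |sqrtSymbol s E ξ| ≤ 1 := by
  rw [sqrtSymbol, abs_of_nonneg (Real.sqrt_nonneg _)]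
  exact Real.sqrt_le_iff.2 ⟨zero_le_one, by simpa using highFrequencySymbol_le_one hs hE _⟩

/-- The adjoint of `G` is formally `v 𝓕⁻¹ g`. This is verified in weak form: if `f` and `v f` are in
`L²`, then `v f` is in `L¹ ∩ L²` and Parseval's identity applies to it. -/
theorem HasFourierKernel.isHighFrequencyBirmanSchwinger {s E : ℝ} (hs : 0 ≤ s) (hE : E ≤ 0)
    {v : RSpace d → ℝ} (hv : MemLp v 2) {G : L2Space d →L[ℂ] L2Space d}
    (hG : HasFourierKernel (sqrtSymbol s E) (fun x ↦ (v x : ℂ)) G) :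
    IsHighFrequencyBirmanSchwinger s E v (G.adjoint ∘L G) := by
  intro u
  have hw : MemLp (fun ξ ↦ (sqrtSymbol s E ξ : ℂ) * G u ξ) 2 :=
    memLp_bounded_mul_coeFn (M := 1)
      (Complex.measurable_ofReal.comp (measurable_sqrtSymbol s E)).aestronglyMeasurable
      (fun ξ ↦ (Complex.norm_real _).trans_le (abs_sqrtSymbol_le_one hs hE ξ)) (G u)
  refine ⟨hw.toLp, ?_, ?_⟩
  · filter_upwards [hw.coeFn_toLp, hG u] with ξ h1 h2
    rw [h1, h2, ← sqrtSymbol_sq hE]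
    push_cast
    ring
  · refine ae_eq_mul_of_forall_integral hv.1 _ _ fun f hf hvf ↦ ?_
    have hvfi : Integrable fun x ↦ (v x : ℂ) * f x := by
      have hvc : MemLp (fun x ↦ (v x : ℂ)) 2 := hv.ofReal
      exact hvc.integrable_mul hf
    have h1 : ∫ x, (starRingEnd ℂ) (f x) * ((G.adjoint ∘L G) u) x =
        inner ℂ (hf.toLp f) ((G.adjoint ∘L G) u) := by
      rw [L2.inner_def]
      refine integral_congr_ae (hf.coeFn_toLp.mono fun x hx ↦ ?_)
      simp only [hx, RCLike.inner_apply]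
      ring
    have h2 : ∫ x, (starRingEnd ℂ) ((v x : ℂ) * f x) * (𝓕⁻ hw.toLp : L2Space d) x =
        inner ℂ (hvf.toLp : L2Space d) (𝓕⁻ hw.toLp : L2Space d) := by
      rw [L2.inner_def]
      refine integral_congr_ae (hvf.coeFn_toLp.mono fun x hx ↦ ?_)
      simp only [hx, RCLike.inner_apply]
      ring
    rw [h1, h2, ContinuousLinearMap.comp_apply, ContinuousLinearMap.adjoint_inner_right,
      ← Lp.inner_fourier_eq (hvf.toLp : L2Space d), FourierTransform.fourier_fourierInv_eq,
      L2.inner_def, L2.inner_def]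
    refine integral_congr_ae ?_
    have h3 : (fun x ↦ (v x : ℂ) * (hf.toLp f) x) =ᵐ[volume] fun x ↦ (v x : ℂ) * f x :=
      hf.coeFn_toLp.mono fun x hx ↦ by simp only [hx]
    filter_upwards [hG (hf.toLp f), hw.coeFn_toLp, coeFn_fourier_toLp hvfi hvf] with ξ h4 h5 h6
    rw [h4, h5, h6, Real.fourier_congr_ae h3]
    simp only [RCLike.inner_apply, map_mul, Complex.conj_ofReal]
    ring

end BirmanSchwingerFactorization

/-! ### Bounds on the symbol, uniform in the energy -/

section SymbolBounds

variable {d : ℕ}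

theorem enorm_sqrtSymbol_sq {s E : ℝ} (hE : E ≤ 0) (ξ : RSpace d) :
    ‖sqrtSymbol s E ξ‖ₑ ^ 2 = ENNReal.ofReal (highFrequencySymbol s E ((2 * Real.pi) • ξ)) := by
  have h : 0 ≤ sqrtSymbol s E ξ := Real.sqrt_nonneg _
  rw [← sqrtSymbol_sq hE, ENNReal.ofReal_pow h, ← ofReal_norm, Real.norm_of_nonneg h]

/-- The constant in `isCriticalSymbol_sqrtSymbol`. -/
noncomputable def criticalConst (d : ℕ) : ℝ≥0 :=
  1 + 2 ^ d * (volume (Metric.ball (0 : RSpace d) 1)).toNNReal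

theorem norm_two_pi_smul (ξ : RSpace d) : ‖(2 * Real.pi) • ξ‖ = 2 * Real.pi * ‖ξ‖ := by
  rw [norm_smul, Real.norm_of_nonneg Real.two_pi_pos.le]

theorem highFrequencySymbol_le_of_le {E : ℝ} (hE : E ≤ 0) (l : ℕ) {ξ : RSpace d}
    (hξ : 2 ^ l ≤ ‖ξ‖) : highFrequencySymbol ((d : ℝ) / 2) E ((2 * Real.pi) • ξ) ≤
      ((dyadicBase d ^ l)⁻¹) ^ 2 := by
  refine (highFrequencySymbol_le hE _).trans (Set.indicator_apply_le' (fun _ ↦ ?_)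
    (fun _ ↦ by positivity))
  have h1 : (2 : ℝ) * (d / 2) = d := by ring
  rw [h1, Real.rpow_natCast, inv_pow, ← pow_mul, mul_comm l 2, pow_mul, dyadicBase_sq, ← pow_mul,
    mul_comm d l, pow_mul]
  refine inv_anti₀ (by positivity) (pow_le_pow_left₀ (by positivity) ?_ d)
  rw [norm_two_pi_smul]
  nlinarith [Real.pi_gt_three, norm_nonneg ξ]

theorem isCriticalSymbol_sqrtSymbol {E : ℝ} (hE : E ≤ 0) :
    IsCriticalSymbol (sqrtSymbol ((d : ℝ) / 2) E : RSpace d → ℝ) (criticalConst d) := by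
  have hb := dyadicBase_pos d
  have hC1 : 1 ≤ criticalConst d := le_self_add
  have hC : 2 ^ d * volume (Metric.ball (0 : RSpace d) 1) ≤ (criticalConst d : ℝ≥0∞) ^ 2 := by
    have h1 : 2 ^ d * volume (Metric.ball (0 : RSpace d) 1) ≤ (criticalConst d : ℝ≥0∞) := by
      rw [criticalConst]
      push_cast
      rw [ENNReal.coe_toNNReal measure_ball_lt_top.ne]
      exact le_add_self
    refine h1.trans ?_
    exact_mod_cast le_self_pow₀ hC1 two_ne_zero
  refine ⟨measurable_sqrtSymbol _ _, abs_sqrtSymbol_le_one (by positivity) hE, fun l ξ hξ ↦ ?_, ?_,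
    fun l ↦ ?_⟩
  · rw [sqrtSymbol, abs_of_nonneg (Real.sqrt_nonneg _)]
    calc _ ≤ (dyadicBase d ^ l)⁻¹ :=
          Real.sqrt_le_iff.2 ⟨by positivity, highFrequencySymbol_le_of_le hE l hξ⟩
      _ ≤ _ := le_mul_of_one_le_left (by positivity) (by exact_mod_cast hC1)
  · refine le_trans ?_ hC
    calc _ ≤ ∫⁻ _ in Metric.ball (0 : RSpace d) 1, 1 := by
          refine lintegral_mono fun ξ ↦ ?_
          simp only [enorm_sqrtSymbol_sq hE]
          exact ENNReal.ofReal_le_one.2 (highFrequencySymbol_le_one (by positivity) hE _)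
      _ = volume (Metric.ball (0 : RSpace d) 1) := by simp
      _ ≤ _ := le_mul_of_one_le_left' (one_le_pow₀ one_le_two)
  · refine le_trans ?_ hC
    calc _ ≤ ∫⁻ _ in dyadicShell d l, ENNReal.ofReal (((dyadicBase d ^ l)⁻¹) ^ 2) := by
          refine setLIntegral_mono measurable_const fun ξ hξ ↦ ?_
          rw [enorm_sqrtSymbol_sq hE]
          exact ENNReal.ofReal_le_ofReal (highFrequencySymbol_le_of_le hE l hξ.1)
      _ = ENNReal.ofReal (((dyadicBase d ^ l)⁻¹) ^ 2) * volume (dyadicShell d l) := by simp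
      _ ≤ ENNReal.ofReal (((dyadicBase d ^ l)⁻¹) ^ 2) *
          volume (Metric.ball (0 : RSpace d) (2 ^ (l + 1))) := by
          refine mul_le_mul_right (measure_mono fun ξ hξ ↦ ?_) _
          rw [mem_ball_zero_iff]
          exact hξ.2
      -- The exponent is critical: the size `2^{-dl}` of the symbol and the volume of the ball of
      -- radius `2^{l+1}` compensate up to `2^d`.
      _ = 2 ^ d * volume (Metric.ball (0 : RSpace d) 1) := by
          rw [Measure.addHaar_ball_of_pos _ _ (by positivity), ← mul_assoc,
            ← ENNReal.ofReal_mul (by positivity)]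
          congr 1
          rw [finrank_euclideanSpace_fin, inv_pow, ← pow_mul, mul_comm l 2, pow_mul, dyadicBase_sq,
            ← pow_mul, ← pow_mul, ← ENNReal.ofReal_ofNat 2, ← ENNReal.ofReal_pow (by norm_num)]
          congr 1
          rw [add_mul, one_mul, pow_add, mul_comm l d]
          field_simp

/-- On the support `1 + |ξ| ≤ 2 |2πξ|`, so the symbol is dominated by a multiple of `(1 +
|ξ|)^{-2s}`, which is integrable because `2s > d`. -/
theorem exists_eLpNorm_sqrtSymbol_le {s : ℝ} (hs : (d : ℝ) / 2 < s) :
    ∃ B : ℝ≥0, ∀ E ≤ 0, eLpNorm (sqrtSymbol s E : RSpace d → ℝ) 2 volume ≤ B := by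
  have hs0 : 0 < s := lt_of_le_of_lt (by positivity) hs
  have hfin : ∫⁻ ξ : RSpace d, ENNReal.ofReal ((1 + ‖ξ‖) ^ (-(2 * s))) < ∞ :=
    finite_integral_one_add_norm (by rw [finrank_euclideanSpace_fin]; linarith)
  set I := ENNReal.ofReal (2 ^ (2 * s)) *
    ∫⁻ ξ : RSpace d, ENNReal.ofReal ((1 + ‖ξ‖) ^ (-(2 * s))) with hI
  have hIfin : I < ∞ := ENNReal.mul_lt_top ENNReal.ofReal_lt_top hfin
  have hbound : ∀ E ≤ 0, ∫⁻ ξ : RSpace d, ‖sqrtSymbol s E ξ‖ₑ ^ 2 ≤ I := by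
    intro E hE
    rw [hI, ← lintegral_const_mul' _ _ ENNReal.ofReal_ne_top]
    refine lintegral_mono fun ξ ↦ ?_
    rw [enorm_sqrtSymbol_sq hE, ← ENNReal.ofReal_mul (by positivity)]
    refine ENNReal.ofReal_le_ofReal ((highFrequencySymbol_le hE _).trans
      (Set.indicator_apply_le' (fun hk ↦ ?_) (fun _ ↦ by positivity)))
    have hk : 1 < ‖(2 * Real.pi) • ξ‖ := hk
    have h1 : 1 + ‖ξ‖ ≤ 2 * ‖(2 * Real.pi) • ξ‖ := by
      rw [norm_two_pi_smul] at hk ⊢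
      nlinarith [Real.pi_gt_three, norm_nonneg ξ]
    rw [Real.rpow_neg (by positivity), ← div_eq_mul_inv, inv_le_comm₀
      (Real.rpow_pos_of_pos (by linarith) _) (by positivity), inv_div, div_le_iff₀ (by positivity),
      mul_comm (‖(2 * Real.pi) • ξ‖ ^ (2 * s)), ← Real.mul_rpow (by norm_num) (norm_nonneg _)]
    exact Real.rpow_le_rpow (by positivity) h1 (by positivity)
  refine ⟨(I ^ (1 / 2 : ℝ)).toNNReal, fun E hE ↦ ?_⟩
  rw [ENNReal.coe_toNNReal (ENNReal.rpow_ne_top_of_nonneg (by norm_num) hIfin.ne)]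
  have h := hbound E hE
  rw [lintegral_enorm_sq_eq_eLpNorm_sq] at h
  rw [one_div, ENNReal.le_rpow_inv_iff (by norm_num)]
  exact_mod_cast h

end SymbolBounds

/-! ### The two bounds -/

theorem mainTheorem3 (d : ℕ) (hd : 1 ≤ d) :
    (∀ ε : ℝ, 0 < ε → ∃ C : ℝ≥0, ∀ E : ℝ, E ≤ 0 →
      ∀ (v : RSpace d → ℝ) (hv : MemLp v 2 volume),
        harmonicCalculusNorm d (logWeight ε) (hv.ofReal (K := ℂ)).toLp < ∞ →
        ∃ K : L2Space d →L[ℂ] L2Space d,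
          IsHighFrequencyBirmanSchwinger ((d : ℝ) / 2) E v K ∧
          MemWeakTraceIdeal 1 K ∧
          weakTraceQuasinorm 1 K ≤
            C * harmonicCalculusNorm d (logWeight ε) (hv.ofReal (K := ℂ)).toLp ^ 2) ∧
    (∀ s : ℝ, (d : ℝ) / 2 < s → ∃ C : ℝ≥0, ∀ E : ℝ, E ≤ 0 →
      ∀ v : RSpace d → ℝ, MemLp v 2 volume →
        ∃ K : L2Space d →L[ℂ] L2Space d,
          IsHighFrequencyBirmanSchwinger s E v K ∧
          MemWeakTraceIdeal 1 K ∧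
          weakTraceQuasinorm 1 K ≤ C * eLpNorm v 2 volume ^ 2) := by
  refine ⟨fun ε hε ↦ ?_, fun s hs ↦ ?_⟩
  · set c := logDomainConst d (criticalConst d) ε
    -- The constant is squared because the quasinorm of `G* G` is bounded by the square of the Ky
    -- Fan constant of `G`.
    refine ⟨(c ^ 2).toNNReal, fun E hE v hv hN ↦ ?_⟩
    obtain ⟨G, hG, hK⟩ := (isCriticalSymbol_sqrtSymbol (d := d)
      hE).exists_hasFourierKernel_of_logDomain hd hε hN
    refine ⟨G.adjoint ∘L G, (hG.congr_ae (hv.ofReal (K := ℂ)).coeFn_toLp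
      ).isHighFrequencyBirmanSchwinger (by positivity) hE hv, hK.memWeakTraceIdeal,
      (hK.weakTraceQuasinorm_le).trans_eq ?_⟩
    rw [mul_pow, ENNReal.ofReal_mul (by positivity), ENNReal.ofReal_pow ENNReal.toReal_nonneg,
      ENNReal.ofReal_toReal hN.ne]
    rfl
  · obtain ⟨B, hB⟩ := exists_eLpNorm_sqrtSymbol_le hs
    have hs0 : 0 ≤ s := le_trans (by positivity) hs.le
    refine ⟨(2 * B) ^ 2, fun E hE v hv ↦ ?_⟩
    have hg : MemLp (sqrtSymbol s E : RSpace d → ℝ) 2 :=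
      ⟨(measurable_sqrtSymbol s E).aestronglyMeasurable, (hB E hE).trans_lt ENNReal.coe_lt_top⟩
    obtain ⟨G, hG, hK⟩ := exists_hasFourierKernel_of_memLp (measurable_sqrtSymbol s E) hg
      (hv.ofReal (K := ℂ))
    have hn : eLpNorm (fun x ↦ ((v x : ℝ) : ℂ)) 2 volume = eLpNorm v 2 volume :=
      eLpNorm_congr_norm_ae (Filter.Eventually.of_forall fun x ↦ Complex.norm_real _)
    have hK' : KyFanBound G (2 * (B * (eLpNorm v 2 volume).toReal)) := by
      refine hK.mono ?_
      have h1 : (eLpNorm (sqrtSymbol s E : RSpace d → ℝ) 2 volume).toReal ≤ B :=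
        ENNReal.toReal_mono ENNReal.coe_ne_top (hB E hE)
      have h2 := congrArg ENNReal.toReal hn
      refine mul_le_mul_of_nonneg_left (mul_le_mul h1 (le_of_eq h2) ENNReal.toReal_nonneg
        B.2) zero_le_two
    refine ⟨G.adjoint ∘L G, hG.isHighFrequencyBirmanSchwinger hs0 hE hv, hK'.memWeakTraceIdeal,
      (hK'.weakTraceQuasinorm_le).trans_eq ?_⟩
    rw [← mul_assoc, mul_pow, ENNReal.ofReal_mul (by positivity),
      ENNReal.ofReal_pow ENNReal.toReal_nonneg, ENNReal.ofReal_toReal hv.2.ne]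
    congr 1
    rw [ENNReal.ofReal_pow (by positivity), ENNReal.ofReal_mul (by norm_num)]
    simp
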